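/- Let $m\in\{1,2,4,8\}$ and let $\mathbb A$ be the complexification of the composition algebra of dimension $m$ (the real numbers, complex numbers, quaternions, octonions), with its complex-linearly extended conjugation, norm $n$, and trace $x+\bar x$. Let $\mathfrak J$ be the space of $3\times3$ Hermitian matrices over $\mathbb A$, with its cubic form $N$ (the determinant), trace form $T(X,Y)=\operatorname{tr}(X\circ Y)$ and quadratic adjoint $X\mapsto X^{\#}$, so that $dN_X(Y)=T(X^{\#},Y)$. Let $V=\mathbb C\oplus\mathbb C\oplus\mathfrak J\oplus\mathfrak J$ be the defining module of the $e_7$ series (for $m=1,2,4,8$ the Lie algebras $c_3,a_5,d_6,e_7$), with symplectic form $$\omega\big((a,b,A,B),(a',b',A',B')\big)=ab'-ba'+T(A,B')-T(B,A')$$ and with the symmetric quartic form $$q(a,b,A,B)=36\left(4T(A^{\#},B^{\#})-4aN(A)-4bN(B)-\big(ab-T(A,B)\big)^2\right).$$ Fix a basis of $V$, let $J_{ab}$ be the matrix of $\omega$, $J^{ab}$ its inverse matrix, and $d_{abcd}$ the symmetric tensor with $q(v)=d_{abcd}v^av^bv^cv^d$. Define endomorphisms of $V\otimes V$ by $$\mathbf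 P^{ab}_{cd}=\delta^a_d\delta^b_c,\qquad K^{ab}_{cd}=J^{ab}J_{cd},\qquad D^{ab}_{cd}=J^{as}J^{bt}d_{stcd},$$ and $$P_1=\frac{3(m+3)(1+\mathbf P)-D}{6(m+4)},\quad P_2=\frac{1-\mathbf P}2+\frac{K}{6m+8},\quad P_3=\frac{3(1+\mathbf P)+D}{6(m+4)},\quad P_4=-\frac{K}{6m+8}.$$ **Theorem 5.8.** $\dim V=6m+8$, $\omega$ is antisymmetric and nondegenerate, and $d$ is symmetric. $P_1,P_2,P_3,P_4$ are mutually orthogonal idempotents with sum $1$. A tensor $t^{ab}$ lies in the range of $P_3$ if and only if the endomorphism $X^a{}_c=t^{ab}J_{bc}$ lies in the Lie algebra of infinitesimal symmetries of the pair $(\omega,d)$. Put $$\check R(u)=P_1+\frac{2+u}{2-u}P_2+\frac{2+u}{2-u}\,\frac{m+2+u}{m+2-u}P_3+\frac{2+u}{2-u}\,\frac{m+2+u}{m+2-u}\,\frac{2m+2+u}{2m+2-u}P_4 .$$ For $u\notin\{2,m+2,2m+2\}$, $$(2-u)(m+2-u)\,\check R(u)=(2m+4-u)\,1+u(u-m-1)\,\mathbf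 P-\frac{u(2+u)}{2m+2-u}K+\frac u3D .$$ Both $\check R(u)$ and the rescaled R-matrix on the right-hand side satisfy the Yang–Baxter equation in $\mathrm{End}(V\otimes V\otimes V)$, $$(\check R(u)\otimes1)(1\otimes\check R(u+v))(\check R(v)\otimes1)=(1\otimes\check R(v))(\check R(u+v)\otimes1)(1\otimes\check R(u)),$$ for all $u,v\in\mathbb C$ such that none of $u$, $v$, $u+v$ is a pole: $2$, $m+2$ and $2m+2$ are excluded for $\check R$, and $2m+2$ for the rescaled R-matrix. -/

import Mathlib

open scoped Kronecker

noncomputable section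

namespace ESeven

/-! ### Composition algebras

`HAlg k` is the complexification of the `k`-th Cayley–Dickson algebra, of dimension `m = 2 ^ k`:
the reals, complex numbers, quaternions, octonions for `k = 0, 1, 2, 3`.  All operations are
extended complex-(bi)linearly; in particular `conj` is complex-linear. -/

/-- Coordinates with respect to the standard basis of `2 ^ k` units; the unit element
corresponds to the constant index `false`. -/
abbrev HAlg (k : ℕ) : Type := (Fin k → Bool) → ℂ

/-- The component `a` of `(a, b)` in the Cayley–Dickson doubling. -/
def HAlg.fst {k : ℕ} (x : HAlg (k + 1)) : HAlg k := fun s => x (Fin.cons false s)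

/-- The component `b` of `(a, b)` in the Cayley–Dickson doubling. -/
def HAlg.snd {k : ℕ} (x : HAlg (k + 1)) : HAlg k := fun s => x (Fin.cons true s)

/-- The element `(a, b)` of the Cayley–Dickson doubling. -/
def HAlg.mk {k : ℕ} (a b : HAlg k) : HAlg (k + 1) :=
  fun s => if s 0 = true then b (Fin.tail s) else a (Fin.tail s)

/-- Conjugation, `conj (a, b) = (conj a, -b)`. -/
def HAlg.conj : (k : ℕ) → HAlg k → HAlg k
  | 0, x => x
  | k + 1, x => HAlg.mk (HAlg.conj k x.fst) (-x.snd)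

/-- Cayley–Dickson product, `(a, b) (c, d) = (a c - conj d b, d a + b conj c)`. -/
def HAlg.mul : (k : ℕ) → HAlg k → HAlg k → HAlg k
  | 0, x, y => fun s => x s * y s
  | k + 1, x, y =>
      HAlg.mk
        (HAlg.mul k x.fst y.fst - HAlg.mul k (HAlg.conj k y.snd) x.snd)
        (HAlg.mul k y.snd x.fst + HAlg.mul k x.snd (HAlg.conj k y.fst))

variable {k : ℕ}

/-- The multiplicative norm `x * conj x`, a sum of squares of the coordinates. -/
def HAlg.normSq (x : HAlg k) : ℂ := ∑ s, x s ^ 2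

/-- The polar form of the norm, `x * conj y + y * conj x`. -/
def HAlg.polar (x y : HAlg k) : ℂ := 2 * ∑ s, x s * y s

/-- The trace `x + conj x`, that is, twice the coordinate at the unit element. -/
def HAlg.trace (x : HAlg k) : ℂ := 2 * x (fun _ => false)

/-! ### The cubic Jordan algebra of `3 × 3` Hermitian matrices

An element is
`[[a 0, x 2, conj (x 1)], [conj (x 2), a 1, x 0], [x 1, conj (x 0), a 2]]`
with `a i : ℂ` and `x i : HAlg k`; the space has dimension `3 m + 3`. -/

/-- Coordinates of `3 × 3` Hermitian matrices: diagonal entries and off-diagonal entries. -/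
abbrev HermIdx (k : ℕ) : Type := Fin 3 ⊕ (Fin 3 × (Fin k → Bool))

abbrev Herm (k : ℕ) : Type := HermIdx k → ℂ

def Herm.diag (X : Herm k) (i : Fin 3) : ℂ := X (Sum.inl i)

def Herm.off (X : Herm k) (i : Fin 3) : HAlg k := fun s => X (Sum.inr (i, s))

/-- The determinant `a₀ a₁ a₂ - ∑ aᵢ |xᵢ|² + tr (x₀ x₁ x₂)`. -/
def Herm.det (X : Herm k) : ℂ :=
  X.diag 0 * X.diag 1 * X.diag 2 - ∑ i, X.diag i * (X.off i).normSq
    + (HAlg.mul k (HAlg.mul k (X.off 0) (X.off 1)) (X.off 2)).trace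

/-- The trace form `(X, Y) = tr (X ∘ Y)`. -/
def Herm.form (X Y : Herm k) : ℂ :=
  ∑ i, (X.diag i * Y.diag i + (X.off i).polar (Y.off i))

/-- The quadratic adjoint `X ↦ X^#`, so that `form X^# Y` is the derivative of `det` at `X`
in direction `Y`. -/
def Herm.sharp (X : Herm k) : Herm k
  | Sum.inl i => X.diag (i + 1) * X.diag (i + 2) - (X.off i).normSq
  | Sum.inr (i, s) =>
      HAlg.conj k (HAlg.mul k (X.off (i + 1)) (X.off (i + 2))) s - X.diag i * X.off i s

/-! ### The defining module `V = ℂ ⊕ ℂ ⊕ Herm ⊕ Herm`, of dimension `6 m + 8` -/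

abbrev VIdx (k : ℕ) : Type := Bool × (Unit ⊕ HermIdx k)

instance (k : ℕ) : DecidableEq (VIdx k) :=
  inferInstanceAs (DecidableEq (Bool × (Unit ⊕ HermIdx k)))

/-- A vector `(a, b, A, B)` of `V`, in coordinates. -/
abbrev V (k : ℕ) : Type := VIdx k → ℂ

def V.a (v : V k) : ℂ := v (false, Sum.inl ())
def V.b (v : V k) : ℂ := v (true, Sum.inl ())
def V.A (v : V k) : Herm k := fun i => v (false, Sum.inr i)
def V.B (v : V k) : Herm k := fun i => v (true, Sum.inr i)

/-- The symplectic form on `V`. -/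
def sympl (v w : V k) : ℂ :=
  v.a * w.b - v.b * w.a + v.A.form w.B - v.B.form w.A

/-- Freudenthal's invariant quartic form on `V`; the factor `36` makes `projP` below
idempotent. -/
def quartic (v : V k) : ℂ :=
  36 * (4 * v.A.sharp.form v.B.sharp - 4 * v.a * v.A.det - 4 * v.b * v.B.det
    - (v.a * v.b - v.A.form v.B) ^ 2)

/-- The standard basis vectors of `V`. -/
def stdVec (p : VIdx k) : V k := Pi.single p 1

/-- The matrix `J_{pq}` of the symplectic form. -/
def J (k : ℕ) : Matrix (VIdx k) (VIdx k) ℂ := fun p q => sympl (stdVec p) (stdVec q)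

/-- The components `d_{p₀p₁p₂p₃}` of the symmetric quartic tensor: the full polarization of
`quartic`, so that `∑ d_{p₀p₁p₂p₃} v_{p₀} v_{p₁} v_{p₂} v_{p₃} = quartic v`. -/
def dTensor (k : ℕ) (p : Fin 4 → VIdx k) : ℂ :=
  (1 / 24) * ∑ S : Finset (Fin 4), (-1) ^ S.card * quartic (∑ i ∈ S, stdVec (p i))

/-- `X` preserves both `J` and the quartic tensor infinitesimally, i.e. it lies in the Lie algebra
of the group of symplectic transformations of `V` that fix the quartic form. -/
def IsInfinitesimalSymmetry (X : Matrix (VIdx k) (VIdx k) ℂ) : Prop :=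
  X.transpose * J k + J k * X = 0 ∧
    ∀ p : Fin 4 → VIdx k,
      ∑ i : Fin 4, ∑ t : VIdx k, X t (p i) * dTensor k (Function.update p i t) = 0

/-! ### Endomorphisms of `V ⊗ V`

`End (V ⊗ V)` is the algebra of matrices indexed by pairs: `M (a, b) (c, d)` is `M^{ab}_{cd}`. -/

abbrev End2 (k : ℕ) : Type := Matrix (VIdx k × VIdx k) (VIdx k × VIdx k) ℂ

/-- The transposition of the two factors. -/
def swapOp (k : ℕ) : End2 k := fun p q => if p.1 = q.2 ∧ p.2 = q.1 then 1 else 0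

/-- `K^{ab}_{cd} = (J⁻¹)^{ab} J_{cd}`. -/
def cupCap (k : ℕ) : End2 k := fun p q => (J k)⁻¹ p.1 p.2 * J k q.1 q.2

/-- The quartic tensor with two indices raised by the symplectic form:
`D^{ab}_{cd} = (J⁻¹)^{as} (J⁻¹)^{bt} d_{stcd}`. -/
def quarticOp (k : ℕ) : End2 k := fun p q =>
  ∑ s, ∑ t, (J k)⁻¹ p.1 s * (J k)⁻¹ p.2 t * dTensor k ![s, t, q.1, q.2]

/-- The parameter `m = 2 ^ k`, the dimension of the composition algebra. -/
def m (k : ℕ) : ℂ := 2 ^ k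

/-- The projectors `P₁, P₂, P₃, P₄` (here indexed by `0, 1, 2, 3`). -/
def projP (k : ℕ) : Fin 4 → End2 k :=
  ![(1 / (6 * (m k + 4))) • ((3 * (m k + 3)) • (1 + swapOp k) - quarticOp k),
    (1 / 2 : ℂ) • (1 - swapOp k) + (1 / (6 * m k + 8)) • cupCap k,
    (1 / (6 * (m k + 4))) • ((3 : ℂ) • (1 + swapOp k) + quarticOp k),
    -((1 / (6 * m k + 8)) • cupCap k)]

/-- The R-matrix given by its spectral decomposition. -/
def Rspec (k : ℕ) (u : ℂ) : End2 k :=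
  projP k 0
    + ((2 + u) / (2 - u)) • projP k 1
    + ((2 + u) / (2 - u) * ((m k + 2 + u) / (m k + 2 - u))) • projP k 2
    + ((2 + u) / (2 - u) * ((m k + 2 + u) / (m k + 2 - u))
        * ((2 * m k + 2 + u) / (2 * m k + 2 - u))) • projP k 3

/-- The rescaled R-matrix. -/
def Rresc (k : ℕ) (u : ℂ) : End2 k :=
  (2 * m k + 4 - u) • (1 : End2 k) + (u * (u - m k - 1)) • swapOp k
    - (u * (2 + u) / (2 * m k + 2 - u)) • cupCap k + (u / 3) • quarticOp k

/-! ### The Yang–Baxter equation on `V ⊗ V ⊗ V` -/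

abbrev End3 (k : ℕ) : Type :=
  Matrix ((VIdx k × VIdx k) × VIdx k) ((VIdx k × VIdx k) × VIdx k) ℂ

/-- `R ⊗ 1`. -/
def on12 (R : End2 k) : End3 k := R ⊗ₖ (1 : Matrix (VIdx k) (VIdx k) ℂ)

/-- `1 ⊗ R`. -/
def on23 (R : End2 k) : End3 k :=
  Matrix.reindex (Equiv.prodAssoc _ _ _).symm (Equiv.prodAssoc _ _ _).symm
    ((1 : Matrix (VIdx k) (VIdx k) ℂ) ⊗ₖ R)

/-- The Yang–Baxter equation for the family `R` at the spectral parameters `u`, `v`. -/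
def YangBaxterAt (R : ℂ → End2 k) (u v : ℂ) : Prop :=
  on12 (R u) * on23 (R (u + v)) * on12 (R v) = on23 (R v) * on12 (R (u + v)) * on23 (R u)

end ESeven

end

open scoped Kronecker

noncomputable section

namespace ESeven

variable {k : ℕ}

/-! ### Algebraic identities in the Cayley–Dickson algebras -/

namespace HAlg

/-! The source of everything is $(A^\#)^\# = N(A)A$, which rests on the multiplicativity of the norm
up to the octonions. Its linearization (`cross_sharp_cross`) makes `raising C` and `lowering C`
infinitesimal symmetries of $(\omega,d)$, and symmetries generate $V\otimes V$ from the single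
tensor high ⊗ low (`eq_top_of_tensor_mem`). An equivariant identity on $V\otimes V$ therefore needs
to be tested only there, where contraction with the quartic form is the diagonal map `gradeQuartic`.

Two such tests give the structure theory. First, $3(1+P)+D$ sends high ⊗ low to a grading operator,
so its range consists of symmetries (`isDerivation_lowered_symOp`). Second, $D^2 = 6(m+2)D +
18(m+3)(1+P)$ (`quarticOp_mul_quarticOp`); here $m$ enters through the dimension of the Jordan
algebra and the trace of $X\mapsto B\times(A\times X)$. So $1,P,K,D$ span an algebra,
$(D-6(m+3))(D+6)=0$ on symmetric tensors, and the projectors follow. Conversely, if the endomorphism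
attached to $t$ is a symmetry, contracting the invariance of $d$ with a second copy of $d$ and
applying the quadratic relation to each term forces $Dt = 6(m+3)t$
(`quarticOp_mulVec_of_isDerivation`).

For the Yang–Baxter equation, the rescaled R-matrix is the flip times a combination of $1$, $P$, $K$
and the Casimir operator $\Omega = D-3P-3K$. Fixing the indices of one factor of $\Omega$ leaves an
infinitesimal symmetry. Hence $\Omega_{13}+\Omega_{23}$ commutes with $\Omega_{12}$ and is
annihilated by $K_{12}$ on either side. In any algebra with these relations, the Brauer relations
for $P,K$ and the quadratic relation for $\Omega$ (`ThreeStrand`), the difference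
$\Omega_{12}\Omega_{13}\Omega_{23}-\Omega_{23}\Omega_{13}\Omega_{12}$ is a combination of words
containing a square. Everything then reduces to normal forms whose coefficients agree as rational
functions (`ThreeStrand.yang_baxter_core`). -/

@[simp] lemma fst_mk (a b : HAlg k) : fst (mk a b) = a := by
  funext s; simp [fst, mk]

@[simp] lemma snd_mk (a b : HAlg k) : snd (mk a b) = b := by
  funext s; simp [snd, mk]

lemma ext_mk {x y : HAlg (k + 1)} (h₁ : x.fst = y.fst) (h₂ : x.snd = y.snd) : x = y := by
  funext s
  rw [← Fin.cons_self_tail s]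
  cases s 0
  · exact congrFun h₁ _
  · exact congrFun h₂ _

@[simp] lemma fst_add (x y : HAlg (k + 1)) : fst (x + y) = fst x + fst y := rfl
@[simp] lemma snd_add (x y : HAlg (k + 1)) : snd (x + y) = snd x + snd y := rfl
@[simp] lemma fst_smul (c : ℂ) (x : HAlg (k + 1)) : fst (c • x) = c • fst x := rfl
@[simp] lemma snd_smul (c : ℂ) (x : HAlg (k + 1)) : snd (c • x) = c • snd x := rfl

@[simp] lemma fst_conj (x : HAlg (k + 1)) : fst (conj (k + 1) x) = conj k (fst x) := by
  simp [conj]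

@[simp] lemma snd_conj (x : HAlg (k + 1)) : snd (conj (k + 1) x) = -snd x := by
  simp [conj]

@[simp] lemma fst_mul (x y : HAlg (k + 1)) :
    fst (mul (k + 1) x y) = mul k (fst x) (fst y) - mul k (conj k (snd y)) (snd x) := by
  simp [mul]

@[simp] lemma snd_mul (x y : HAlg (k + 1)) :
    snd (mul (k + 1) x y) = mul k (snd y) (fst x) + mul k (snd x) (conj k (fst y)) := by
  simp [mul]

lemma conj_add : ∀ (k : ℕ) (x y : HAlg k), conj k (x + y) = conj k x + conj k y
  | 0, _, _ => rfl
  | k + 1, x, y => ext_mk (by simp [conj_add k]) (by simp [add_comm])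

lemma conj_smul : ∀ (k : ℕ) (c : ℂ) (x : HAlg k), conj k (c • x) = c • conj k x
  | 0, _, _ => rfl
  | k + 1, c, x => ext_mk (by simp [conj_smul k]) (by simp)

/-- Conjugation as a linear map. -/
def conjₗ (k : ℕ) : HAlg k →ₗ[ℂ] HAlg k where
  toFun := conj k
  map_add' := conj_add k
  map_smul' := conj_smul k

@[simp] lemma conj_neg (x : HAlg k) : conj k (-x) = -conj k x := (conjₗ k).map_neg x
@[simp] lemma conj_sub (x y : HAlg k) : conj k (x - y) = conj k x - conj k y :=
  (conjₗ k).map_sub x y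
@[simp] lemma conj_zero : conj k 0 = 0 := (conjₗ k).map_zero

/-- Two of the four products in the doubling reverse the order of the factors, so each one-sided law
at level `k + 1` uses both laws at level `k`. -/
lemma mul_add_add : ∀ (k : ℕ) (x y z : HAlg k),
    mul k (x + y) z = mul k x z + mul k y z ∧ mul k z (x + y) = mul k z x + mul k z y
  | 0, x, y, z => ⟨funext fun s => add_mul (x s) (y s) (z s),
      funext fun s => mul_add (z s) (x s) (y s)⟩
  | k + 1, x, y, z => by
    constructor <;> apply ext_mk <;>
      simp only [fst_mul, snd_mul, fst_add, snd_add, conj_add, (mul_add_add k _ _ _).1,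
        (mul_add_add k _ _ _).2] <;> abel

lemma smul_mul_smul : ∀ (k : ℕ) (c : ℂ) (x y : HAlg k),
    mul k (c • x) y = c • mul k x y ∧ mul k x (c • y) = c • mul k x y
  | 0, c, x, y => ⟨funext fun s => mul_assoc c (x s) (y s),
      funext fun s => mul_left_comm (x s) c (y s)⟩
  | k + 1, c, x, y => by
    constructor <;> apply ext_mk <;>
      simp only [fst_mul, snd_mul, fst_smul, snd_smul, conj_smul, (smul_mul_smul k _ _ _).1,
        (smul_mul_smul k _ _ _).2, smul_sub, smul_add]

/-- The product as a bilinear map. -/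
def mulₗ (k : ℕ) : HAlg k →ₗ[ℂ] HAlg k →ₗ[ℂ] HAlg k :=
  LinearMap.mk₂ ℂ (mul k) (fun x y z => (mul_add_add k x y z).1)
    (fun c x y => (smul_mul_smul k c x y).1) (fun x y z => (mul_add_add k y z x).2)
    (fun c x y => (smul_mul_smul k c x y).2)

lemma add_mul' (x y z : HAlg k) : mul k (x + y) z = mul k x z + mul k y z := (mul_add_add k x y z).1
lemma mul_add' (x y z : HAlg k) : mul k x (y + z) = mul k x y + mul k x z := (mul_add_add k y z x).2
lemma smul_mul' (c : ℂ) (x y : HAlg k) : mul k (c • x) y = c • mul k x y :=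
    (smul_mul_smul k c x y).1
lemma mul_smul' (c : ℂ) (x y : HAlg k) : mul k x (c • y) = c • mul k x y :=
    (smul_mul_smul k c x y).2
lemma neg_mul' (x y : HAlg k) : mul k (-x) y = -mul k x y := (mulₗ k).map_neg₂ x y
lemma mul_neg' (x y : HAlg k) : mul k x (-y) = -mul k x y := (mulₗ k x).map_neg y
lemma sub_mul' (x y z : HAlg k) : mul k (x - y) z = mul k x z - mul k y z := (mulₗ k).map_sub₂ x y z
lemma mul_sub' (x y z : HAlg k) : mul k x (y - z) = mul k x y - mul k x z := (mulₗ k x).map_sub y z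

lemma conj_conj : ∀ (k : ℕ) (x : HAlg k), conj k (conj k x) = x
  | 0, _ => rfl
  | k + 1, x => ext_mk (by simp [conj_conj k]) (by simp)

lemma conj_mul : ∀ (k : ℕ) (x y : HAlg k), conj k (mul k x y) = mul k (conj k y) (conj k x)
  | 0, x, y => funext fun s => mul_comm (x s) (y s)
  | k + 1, x, y => by
    apply ext_mk
    · simp [conj_mul k, conj_conj, neg_mul', mul_neg']
    · simp [conj_conj, neg_mul']

lemma polar_comm (x y : HAlg k) : polar x y = polar y x := by
  simp [polar, mul_comm]

lemma polar_add_left (x y z : HAlg k) : polar (x + y) z = polar x z + polar y z := by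
  simp [polar, add_mul, Finset.sum_add_distrib, mul_add]

lemma polar_smul_left (c : ℂ) (x y : HAlg k) : polar (c • x) y = c * polar x y := by
  simp only [polar, Pi.smul_apply, smul_eq_mul, mul_assoc, ← Finset.mul_sum]; ring

/-- The polar form as a bilinear form. -/
def polarₗ (k : ℕ) : HAlg k →ₗ[ℂ] HAlg k →ₗ[ℂ] ℂ :=
  LinearMap.mk₂ ℂ polar polar_add_left polar_smul_left
    (fun x y z => by rw [polar_comm, polar_add_left, polar_comm y, polar_comm z])
    (fun c x y => by rw [polar_comm, polar_smul_left, polar_comm y]; rfl)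

lemma polar_add_right (x y z : HAlg k) : polar x (y + z) = polar x y + polar x z :=
  (polarₗ k x).map_add y z
lemma polar_smul_right (c : ℂ) (x y : HAlg k) : polar x (c • y) = c * polar x y :=
  (polarₗ k x).map_smul c y
@[simp] lemma polar_neg_right (x y : HAlg k) : polar x (-y) = -polar x y := (polarₗ k x).map_neg y
@[simp] lemma polar_neg_left (x y : HAlg k) : polar (-x) y = -polar x y := (polarₗ k).map_neg₂ x y
lemma polar_sub_right (x y z : HAlg k) : polar x (y - z) = polar x y - polar x z :=
  (polarₗ k x).map_sub y z
lemma polar_sub_left (x y z : HAlg k) : polar (x - y) z = polar x z - polar y z :=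
  (polarₗ k).map_sub₂ x y z
@[simp] lemma polar_zero_right (x : HAlg k) : polar x 0 = 0 := (polarₗ k x).map_zero
@[simp] lemma polar_zero_left (x : HAlg k) : polar 0 x = 0 := (polarₗ k).map_zero₂ x

lemma polar_self (x : HAlg k) : polar x x = 2 * normSq x := by simp [polar, normSq, sq]

lemma normSq_add (x y : HAlg k) : normSq (x + y) = normSq x + polar x y + normSq y := by
  have h := polar_self (x + y)
  rw [polar_add_left, polar_add_right, polar_add_right, polar_self, polar_self,
    polar_comm y x] at h
  linear_combination -h / 2

lemma normSq_sub (x y : HAlg k) : normSq (x - y) = normSq x - polar x y + normSq y := by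
  have h := polar_self (x - y)
  rw [polar_sub_left, polar_sub_right, polar_sub_right, polar_self, polar_self,
    polar_comm y x] at h
  linear_combination -h / 2

lemma eq_of_polar {x y : HAlg k} (h : ∀ z, polar x z = polar y z) : x = y := by
  funext s
  simpa [polar, Pi.single_apply] using h (Pi.single s 1)

lemma polar_succ (x y : HAlg (k + 1)) :
    polar x y = polar (fst x) (fst y) + polar (snd x) (snd y) := by
  simp only [polar, ← mul_add]
  rw [← (Fin.consEquiv fun _ => Bool).sum_comp, Fintype.sum_prod_type]
  simp only [Fintype.sum_bool]
  rw [add_comm]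
  rfl

lemma normSq_succ (x : HAlg (k + 1)) : normSq x = normSq (fst x) + normSq (snd x) := by
  have h := polar_succ x x
  simp only [polar_self] at h
  linear_combination h / 2

lemma polar_conj_conj : ∀ (k : ℕ) (x y : HAlg k), polar (conj k x) (conj k y) = polar x y
  | 0, _, _ => rfl
  | k + 1, x, y => by simp [polar_succ, polar_conj_conj k]

lemma polar_conj_left (x y : HAlg k) : polar (conj k x) y = polar x (conj k y) := by
  rw [← polar_conj_conj, conj_conj]

lemma normSq_conj (x : HAlg k) : normSq (conj k x) = normSq x := by
  have h := polar_conj_conj k x x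
  simp only [polar_self] at h
  linear_combination h / 2

/-- Doubling mixes left and right multiplications, so both adjoint formulas go through the induction
together. At each level the right one is the conjugate of the left one. -/
lemma polar_mul : ∀ (k : ℕ) (x y z : HAlg k),
    polar (mul k x y) z = polar y (mul k (conj k x) z) ∧
      polar (mul k x y) z = polar x (mul k z (conj k y))
  | 0, x, y, z => by
    simp only [polar, mul, conj]
    constructor <;> congr 1 <;> refine Finset.sum_congr rfl fun s _ => by ring
  | k + 1, x, y, z => by
    have key : ∀ x y z : HAlg (k + 1),
        polar (mul (k + 1) x y) z = polar y (mul (k + 1) (conj (k + 1) x) z) := by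
      intro x y z
      have e1 := (polar_mul k (fst x) (fst y) (fst z)).1
      have e2 := (polar_mul k (conj k (snd y)) (snd x) (fst z)).2
      rw [polar_conj_left, conj_mul, conj_conj] at e2
      have e3 := (polar_mul k (snd y) (fst x) (snd z)).2
      have e4 := (polar_mul k (snd x) (conj k (fst y)) (snd z)).1
      rw [polar_conj_left, conj_mul, conj_conj] at e4
      simp only [polar_succ, fst_mul, snd_mul, fst_conj, snd_conj, polar_add_left, polar_sub_left,
        polar_add_right, polar_sub_right, mul_neg', neg_mul', polar_neg_right, e1, e2, e3, e4]
      ring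
    refine ⟨key x y z, ?_⟩
    rw [← polar_conj_conj, conj_mul, key, conj_conj, ← conj_conj (k + 1) (mul (k + 1) y _),
      polar_conj_conj, conj_mul, conj_conj]

lemma polar_mul_left (x y z : HAlg k) : polar (mul k x y) z = polar y (mul k (conj k x) z) :=
  (polar_mul k x y z).1

lemma polar_mul_right (x y z : HAlg k) : polar (mul k x y) z = polar x (mul k z (conj k y)) :=
  (polar_mul k x y z).2

lemma trace_mul : ∀ (k : ℕ) (x y : HAlg k), trace (mul k x y) = polar x (conj k y)
  | 0, x, y => by
    rw [trace, polar, Fintype.sum_subsingleton _ (fun _ => false)]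
    simp only [mul, conj]
  | k + 1, x, y => by
    have h : ∀ z : HAlg (k + 1), trace z = trace (fst z) := fun z => by
      simp only [trace, fst]
      congr 2
      funext i
      refine Fin.cases ?_ (fun _ => ?_) i <;> simp
    rw [h, fst_mul, polar_succ, fst_conj, snd_conj, polar_neg_right]
    have h' : ∀ z w : HAlg k, trace (z - w) = trace z - trace w := fun z w => by
      simp [trace, mul_sub]
    rw [h', trace_mul k, trace_mul k, polar_conj_conj, polar_comm (snd y)]
    ring

/-! ### Multiplicativity of the norm, alternativity and the Moufang identity. -/

lemma conj_trivial_zero (x : HAlg 0) : conj 0 x = x := rfl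

lemma mul_comm_zero (x y : HAlg 0) : mul 0 x y = mul 0 y x := funext fun s => mul_comm (x s) (y s)

lemma mul_assoc_zero (x y z : HAlg 0) : mul 0 (mul 0 x y) z = mul 0 x (mul 0 y z) :=
  funext fun s => mul_assoc (x s) (y s) (z s)

lemma mul_comm_succ (hc : ∀ x y : HAlg k, mul k x y = mul k y x)
    (ht : ∀ x : HAlg k, conj k x = x) (x y : HAlg (k + 1)) :
    mul (k + 1) x y = mul (k + 1) y x := by
  apply ext_mk
  · simp [ht, hc (fst x), hc (snd x)]
  · simp [ht, add_comm, hc (snd x)]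

lemma mul_assoc_succ (hc : ∀ x y : HAlg k, mul k x y = mul k y x)
    (ha : ∀ x y z : HAlg k, mul k (mul k x y) z = mul k x (mul k y z)) (x y z : HAlg (k + 1)) :
    mul (k + 1) (mul (k + 1) x y) z = mul (k + 1) x (mul (k + 1) y z) := by
  have hl : ∀ x y z : HAlg k, mul k x (mul k y z) = mul k y (mul k x z) := fun x y z => by
    rw [← ha, hc x y, ha]
  apply ext_mk <;>
  · simp only [fst_mul, snd_mul, conj_sub, conj_add, conj_mul, conj_conj, add_mul', sub_mul',
      mul_add', mul_sub']
    simp only [ha, hc, hl]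
    abel

lemma normSq_mul_zero (x y : HAlg 0) : normSq (mul 0 x y) = normSq x * normSq y := by
  simp [normSq, mul, mul_pow]

lemma polar_mul_mul_self (hn : ∀ x y : HAlg k, normSq (mul k x y) = normSq x * normSq y)
    (x y z : HAlg k) : polar (mul k x y) (mul k x z) = normSq x * polar y z := by
  have h := hn x (y + z)
  rw [mul_add', normSq_add, normSq_add, hn, hn] at h
  linear_combination h

/-- The norms of the four partial products add up to the right-hand side. The two cross terms cancel
after one reassociation, which is the only use of `ha`. -/
lemma normSq_mul_succ (ha : ∀ x y z : HAlg k, mul k (mul k x y) z = mul k x (mul k y z))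
    (hn : ∀ x y : HAlg k, normSq (mul k x y) = normSq x * normSq y) (x y : HAlg (k + 1)) :
    normSq (mul (k + 1) x y) = normSq x * normSq y := by
  have h1 : polar (mul k (fst x) (fst y)) (mul k (conj k (snd y)) (snd x)) =
      polar (mul k (snd y) (fst x)) (mul k (snd x) (conj k (fst y))) := by
    rw [polar_comm, polar_mul_left, conj_conj, ← ha, polar_comm, polar_mul_right]
  rw [normSq_succ, fst_mul, snd_mul, normSq_add, normSq_sub, hn, hn, hn, hn, normSq_conj,
    normSq_conj, h1, normSq_succ x, normSq_succ y]
  ring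

/-- Commutativity of the complex numbers gives associativity of the quaternions, which gives the
composition law for the octonions; there the ladder ends. -/
lemma normSq_mul (hk : k ≤ 3) (x y : HAlg k) :
    normSq (mul k x y) = normSq x * normSq y := by
  have c1 := mul_comm_succ mul_comm_zero conj_trivial_zero
  have a1 := mul_assoc_succ mul_comm_zero mul_assoc_zero
  have a2 := mul_assoc_succ c1 a1
  have n1 := normSq_mul_succ mul_assoc_zero normSq_mul_zero
  have n2 := normSq_mul_succ a1 n1
  have n3 := normSq_mul_succ a2 n2
  interval_cases k
  · exact normSq_mul_zero x y
  · exact n1 x y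
  · exact n2 x y
  · exact n3 x y

lemma polar_mul_add_polar_mul (hk : k ≤ 3) (x y z w : HAlg k) :
    polar (mul k x y) (mul k z w) + polar (mul k x w) (mul k z y) = polar x z * polar y w := by
  have h := polar_mul_mul_self (normSq_mul hk) (x + z) y w
  rw [add_mul', add_mul', polar_add_left, polar_add_right, polar_add_right, normSq_add,
    polar_mul_mul_self (normSq_mul hk), polar_mul_mul_self (normSq_mul hk)] at h
  rw [polar_comm (mul k x w)]
  linear_combination h

/-- By nondegeneracy of the polar form, the linearized composition law becomes alternativity;
associativity is not needed. -/
lemma conj_mul_mul (hk : k ≤ 3) (x y : HAlg k) : mul k (conj k x) (mul k x y) = normSq x • y := by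
  refine eq_of_polar fun z => ?_
  rw [polar_comm, ← polar_mul_left, polar_mul_mul_self (normSq_mul hk), polar_smul_left,
    polar_comm z]

lemma mul_mul_conj (hk : k ≤ 3) (x y : HAlg k) : mul k (mul k y x) (conj k x) = normSq x • y := by
  have h := conj_mul_mul hk (conj k x) (conj k y)
  rw [conj_conj, ← conj_mul, normSq_conj, ← conj_smul] at h
  nth_rewrite 1 [← conj_conj k x] at h
  rw [← conj_mul] at h
  simpa only [conj_conj] using congrArg (conj k) h

/-- The middle Moufang identity, in the form `(x y) (z x) = tr (x y z) x - n(x) conj (y z)`. -/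
lemma mul_mul_mul (hk : k ≤ 3) (x y z : HAlg k) :
    mul k (mul k x y) (mul k z x) =
      polar y (conj k (mul k z x)) • x - normSq x • conj k (mul k y z) := by
  refine eq_of_polar fun w => ?_
  -- With this fourth argument one summand is the pairing of the left-hand side with `w`;
  -- alternativity evaluates the other one in `e`.
  have h := polar_mul_add_polar_mul hk x y w (conj k (mul k z x))
  have e : polar (mul k x (conj k (mul k z x))) (mul k w y) =
      normSq x * polar w (conj k (mul k y z)) := by
    have h' := conj_mul_mul hk (conj k x) (conj k z)
    rw [conj_conj, normSq_conj] at h'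
    rw [conj_mul, h', polar_smul_left, polar_comm, polar_mul_right, conj_mul]
  rw [polar_mul_right, polar_sub_left, polar_smul_left, polar_smul_left,
    polar_comm (conj k (mul k y z))]
  linear_combination h - e

end HAlg

namespace HAlg

/-- Both sides are the trace of the product of `x`, `y`, `z` up to a cyclic shift; the trace does
not see the lack of associativity. -/
lemma polar_conj_mul_cyc (x y z : HAlg k) :
    polar (conj k (mul k x y)) z = polar (conj k (mul k y z)) x := by
  rw [polar_conj_left, polar_mul_right, ← conj_mul, polar_comm]

@[simp] lemma mul_zero' (x : HAlg k) : mul k x 0 = 0 := (mulₗ k x).map_zero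
@[simp] lemma zero_mul' (x : HAlg k) : mul k 0 x = 0 := (mulₗ k).map_zero₂ x

lemma polar_mul_mul_right (hk : k ≤ 3) (x y z : HAlg k) :
    polar (mul k x z) (mul k y z) = normSq z * polar x y := by
  rw [← polar_conj_conj, conj_mul, conj_mul, polar_mul_mul_self (normSq_mul hk), normSq_conj,
    polar_conj_conj]

end HAlg

/-! ### Identities in the cubic Jordan algebra -/

namespace Herm

/-- The polarization of the quadratic adjoint. -/
def cross (X Y : Herm k) : Herm k
  | Sum.inl i => X.diag (i + 1) * Y.diag (i + 2) + X.diag (i + 2) * Y.diag (i + 1)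
      - (X.off i).polar (Y.off i)
  | Sum.inr (i, s) =>
      (HAlg.conj k (HAlg.mul k (X.off (i + 1)) (Y.off (i + 2))) s
        + HAlg.conj k (HAlg.mul k (Y.off (i + 1)) (X.off (i + 2))) s)
      - X.diag i * Y.off i s - Y.diag i * X.off i s

lemma ext_diag_off {X Y : Herm k} (h₁ : ∀ i, X.diag i = Y.diag i) (h₂ : ∀ i, X.off i = Y.off i) :
    X = Y := by
  funext p
  rcases p with i | ⟨i, s⟩
  · exact h₁ i
  · exact congrFun (h₂ i) s

@[simp] lemma diag_add (X Y : Herm k) (i : Fin 3) : diag (X + Y) i = diag X i + diag Y i := rfl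
@[simp] lemma off_add (X Y : Herm k) (i : Fin 3) : off (X + Y) i = off X i + off Y i := rfl
@[simp] lemma diag_smul (c : ℂ) (X : Herm k) (i : Fin 3) : diag (c • X) i = c * diag X i := rfl
@[simp] lemma off_smul (c : ℂ) (X : Herm k) (i : Fin 3) : off (c • X) i = c • off X i := rfl

@[simp] lemma diag_cross (X Y : Herm k) (i : Fin 3) :
    diag (cross X Y) i = X.diag (i + 1) * Y.diag (i + 2) + X.diag (i + 2) * Y.diag (i + 1)
      - (X.off i).polar (Y.off i) := rfl

@[simp] lemma off_cross (X Y : Herm k) (i : Fin 3) :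
    off (cross X Y) i = HAlg.conj k (HAlg.mul k (X.off (i + 1)) (Y.off (i + 2)))
        + HAlg.conj k (HAlg.mul k (Y.off (i + 1)) (X.off (i + 2)))
      - X.diag i • Y.off i - Y.diag i • X.off i := rfl

@[simp] lemma diag_sharp (X : Herm k) (i : Fin 3) :
    diag (sharp X) i = X.diag (i + 1) * X.diag (i + 2) - (X.off i).normSq := rfl

@[simp] lemma off_sharp (X : Herm k) (i : Fin 3) :
    off (sharp X) i = HAlg.conj k (HAlg.mul k (X.off (i + 1)) (X.off (i + 2)))
      - X.diag i • X.off i := rfl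

lemma cross_comm (X Y : Herm k) : cross X Y = cross Y X := by
  refine ext_diag_off (fun i => ?_) fun i => ?_
  · simp [HAlg.polar_comm]; ring
  · simp; abel

/-- The polarized adjoint as a bilinear map. -/
def crossₗ (k : ℕ) : Herm k →ₗ[ℂ] Herm k →ₗ[ℂ] Herm k :=
  have hadd : ∀ X Y Z : Herm k, cross (X + Y) Z = cross X Z + cross Y Z := fun X Y Z => by
    refine ext_diag_off (fun i => ?_) fun i => ?_
    · simp only [diag_cross, diag_add, off_add, HAlg.polar_add_left]; ring
    · simp only [off_cross, diag_add, off_add, HAlg.mul_add', HAlg.add_mul', HAlg.conj_add]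
      module
  have hsmul : ∀ (c : ℂ) (X Y : Herm k), cross (c • X) Y = c • cross X Y := fun c X Y => by
    refine ext_diag_off (fun i => ?_) fun i => ?_
    · simp only [diag_cross, diag_smul, off_smul, HAlg.polar_smul_left]; ring
    · simp only [off_cross, diag_smul, off_smul, HAlg.mul_smul', HAlg.smul_mul', HAlg.conj_smul]
      module
  LinearMap.mk₂ ℂ cross hadd hsmul
    (fun X Y Z => by rw [cross_comm, hadd, cross_comm Y, cross_comm Z])
    (fun c X Y => by rw [cross_comm, hsmul, cross_comm Y])

lemma cross_add_left (X Y Z : Herm k) : cross (X + Y) Z = cross X Z + cross Y Z :=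
  (crossₗ k).map_add₂ X Y Z
lemma cross_add_right (X Y Z : Herm k) : cross X (Y + Z) = cross X Y + cross X Z :=
  (crossₗ k X).map_add Y Z
lemma cross_smul_left (c : ℂ) (X Y : Herm k) : cross (c • X) Y = c • cross X Y :=
  (crossₗ k).map_smul₂ c X Y
lemma cross_smul_right (c : ℂ) (X Y : Herm k) : cross X (c • Y) = c • cross X Y :=
  (crossₗ k X).map_smul c Y
@[simp] lemma cross_zero_left (X : Herm k) : cross 0 X = 0 := (crossₗ k).map_zero₂ X
@[simp] lemma cross_zero_right (X : Herm k) : cross X 0 = 0 := (crossₗ k X).map_zero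

lemma cross_self (X : Herm k) : cross X X = (2 : ℂ) • sharp X := by
  refine ext_diag_off (fun i => ?_) fun i => ?_
  · simp [HAlg.polar_self]; ring
  · simp only [off_cross, off_smul, off_sharp]; module

lemma sharp_eq (X : Herm k) : sharp X = (1 / 2 : ℂ) • cross X X := by
  rw [cross_self, smul_smul]; norm_num

lemma form_comm (X Y : Herm k) : form X Y = form Y X := by
  simp [form, mul_comm, HAlg.polar_comm]

/-- The trace form as a bilinear form. -/
def formₗ (k : ℕ) : Herm k →ₗ[ℂ] Herm k →ₗ[ℂ] ℂ :=
  have hadd : ∀ X Y Z : Herm k, form (X + Y) Z = form X Z + form Y Z := fun X Y Z => by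
    simp only [form, diag_add, off_add, HAlg.polar_add_left, ← Finset.sum_add_distrib]
    refine Finset.sum_congr rfl fun i _ => by ring
  have hsmul : ∀ (c : ℂ) (X Y : Herm k), form (c • X) Y = c * form X Y := fun c X Y => by
    simp only [form, diag_smul, off_smul, HAlg.polar_smul_left, Finset.mul_sum]
    refine Finset.sum_congr rfl fun i _ => by ring
  LinearMap.mk₂ ℂ form hadd hsmul
    (fun X Y Z => by rw [form_comm, hadd, form_comm Y, form_comm Z])
    (fun c X Y => by rw [form_comm, hsmul, form_comm Y]; rfl)

lemma form_add_left (X Y Z : Herm k) : form (X + Y) Z = form X Z + form Y Z :=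
  (formₗ k).map_add₂ X Y Z
lemma form_add_right (X Y Z : Herm k) : form X (Y + Z) = form X Y + form X Z :=
  (formₗ k X).map_add Y Z
lemma form_smul_left (c : ℂ) (X Y : Herm k) : form (c • X) Y = c * form X Y :=
  (formₗ k).map_smul₂ c X Y
lemma form_smul_right (c : ℂ) (X Y : Herm k) : form X (c • Y) = c * form X Y :=
  (formₗ k X).map_smul c Y
@[simp] lemma form_zero_left (X : Herm k) : form 0 X = 0 := (formₗ k).map_zero₂ X
@[simp] lemma form_zero_right (X : Herm k) : form X 0 = 0 := (formₗ k X).map_zero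

/-- The trilinear form here is the full polarization of the determinant, hence totally symmetric.
The terms with a diagonal entry match formally, the others by cyclicity of the trace. -/
lemma form_cross_right_comm (X Y Z : Herm k) : form (cross X Y) Z = form (cross X Z) Y := by
  have c := @HAlg.polar_conj_mul_cyc k
  simp only [form, Fin.sum_univ_three, diag_cross, off_cross, HAlg.polar_add_left,
    HAlg.polar_sub_left, HAlg.polar_smul_left, Fin.isValue, zero_add, Fin.reduceAdd]
  rw [HAlg.polar_comm (Z.off 0) (Y.off 0), HAlg.polar_comm (Z.off 1) (Y.off 1),
    HAlg.polar_comm (Z.off 2) (Y.off 2)]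
  linear_combination c (X.off 1) (Y.off 2) (Z.off 0) + c (Y.off 1) (X.off 2) (Z.off 0)
    + c (X.off 2) (Y.off 0) (Z.off 1) + c (Y.off 2) (X.off 0) (Z.off 1)
    + c (X.off 0) (Y.off 1) (Z.off 2) + c (Y.off 0) (X.off 1) (Z.off 2)
    + c (Y.off 2) (Z.off 0) (X.off 1) + c (Y.off 0) (Z.off 1) (X.off 2)
    + c (Y.off 1) (Z.off 2) (X.off 0)

/-- The determinant written starting from any of the three indices. -/
lemma det_eq (X : Herm k) (i : Fin 3) :
    det X = X.diag i * X.diag (i + 1) * X.diag (i + 2) - X.diag i * (X.off i).normSq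
      - X.diag (i + 1) * (X.off (i + 1)).normSq - X.diag (i + 2) * (X.off (i + 2)).normSq
      + (HAlg.conj k (HAlg.mul k (X.off (i + 1)) (X.off (i + 2)))).polar (X.off i) := by
  have h : (HAlg.mul k (HAlg.mul k (X.off 0) (X.off 1)) (X.off 2)).trace =
      (HAlg.conj k (HAlg.mul k (X.off 0) (X.off 1))).polar (X.off 2) := by
    rw [HAlg.trace_mul, HAlg.polar_conj_left]
  have c1 := HAlg.polar_conj_mul_cyc (X.off 0) (X.off 1) (X.off 2)
  have c2 := HAlg.polar_conj_mul_cyc (X.off 1) (X.off 2) (X.off 0)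
  simp only [det, Fin.sum_univ_three, h]
  fin_cases i <;> simp only [Fin.zero_eta, Fin.mk_one, Fin.reduceFinMk, Fin.isValue, zero_add,
      Fin.reduceAdd, c1, c2] <;> ring

/-- Diagonal entries need multiplicativity of the norm. Off-diagonal entries need alternativity on
both sides and, for the product of two adjoint entries, the middle Moufang identity. -/
lemma sharp_sharp (hk : k ≤ 3) (X : Herm k) : sharp (sharp X) = det X • X := by
  have a1 : ∀ i : Fin 3, i + 1 + 1 = i + 2 := by decide
  have a2 : ∀ i : Fin 3, i + 1 + 2 = i := by decide
  have a3 : ∀ i : Fin 3, i + 2 + 1 = i := by decide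
  have a4 : ∀ i : Fin 3, i + 2 + 2 = i + 1 := by decide
  refine ext_diag_off (fun i => ?_) fun i => ?_
  · simp only [diag_sharp, off_sharp, diag_smul, a1, a2, a3, a4, HAlg.normSq_sub, HAlg.normSq_conj,
      HAlg.normSq_mul hk, HAlg.polar_smul_right, det_eq X i]
    have e : (X.diag i • X.off i).normSq = X.diag i ^ 2 * (X.off i).normSq := by
      have h := HAlg.polar_self (X.diag i • X.off i)
      rw [HAlg.polar_smul_left, HAlg.polar_smul_right, HAlg.polar_self] at h
      linear_combination -h / 2
    rw [e]
    ring
  · simp only [diag_sharp, off_sharp, off_smul, a1, a2, a3, a4, HAlg.mul_sub', HAlg.sub_mul',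
      HAlg.smul_mul', HAlg.mul_smul', HAlg.conj_sub, HAlg.conj_smul, HAlg.conj_mul,
      HAlg.conj_conj, det_eq X i]
    simp only [← HAlg.conj_mul, HAlg.mul_mul_conj hk, HAlg.conj_mul_mul hk, HAlg.mul_mul_mul hk]
    have c : (X.off (i + 1)).polar (HAlg.conj k (HAlg.mul k (X.off (i + 2)) (X.off i))) =
        (HAlg.conj k (HAlg.mul k (X.off (i + 1)) (X.off (i + 2)))).polar (X.off i) := by
      rw [HAlg.polar_comm, ← HAlg.polar_conj_mul_cyc]
    rw [c]
    module

lemma form_cross_self (X : Herm k) : form (cross X X) X = 6 * det X := by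
  have d0 := det_eq X 0
  have d1 := det_eq X 1
  have d2 := det_eq X 2
  simp only [Fin.isValue, zero_add, Fin.reduceAdd] at d0 d1 d2
  simp only [form, Fin.sum_univ_three, diag_cross, off_cross, HAlg.polar_add_left,
    HAlg.polar_sub_left, HAlg.polar_smul_left, HAlg.polar_self, Fin.isValue, zero_add,
    Fin.reduceAdd]
  linear_combination -2 * d0 - 2 * d1 - 2 * d2

/-- This is the coefficient of `c` in `sharp_sharp` at `A + c • C`, with adjoints and determinants
written through `cross` and `form`. -/
lemma cross_cross_cross (hk : k ≤ 3) (A C : Herm k) :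
    (3 : ℂ) • cross (cross A A) (cross A C) =
      form (cross A A) A • C + (3 * form (cross A A) C) • A := by
  have h : ∀ X : Herm k, (3 : ℂ) • cross (cross X X) (cross X X) =
      (4 * form (cross X X) X) • X := fun X => by
    have h := sharp_sharp hk X
    rw [sharp_eq, sharp_eq, cross_smul_left, cross_smul_right] at h
    rw [form_cross_self, show 4 * (6 * det X) = 24 * det X by ring, ← smul_smul, ← h]
    module
  have e : ∀ c : ℂ, (12 * c) • cross (cross A A) (cross A C)
      + (6 * c ^ 2) • (cross (cross A A) (cross C C) + (2 : ℂ) • cross (cross A C) (cross A C))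
      + (12 * c ^ 3) • cross (cross A C) (cross C C) =
      (4 * c * form (cross A A) A) • C + (12 * c * form (cross A A) C) • A
      + (12 * c ^ 2) • (form (cross A A) C • C + form (cross C C) A • A)
      + (4 * c ^ 3) • ((3 * form (cross C C) A) • C + form (cross C C) C • A) := fun c => by
    have hc := h (A + c • C)
    simp only [cross_add_left, cross_add_right, cross_smul_left, cross_smul_right, form_add_left,
      form_add_right, form_smul_left, form_smul_right, cross_comm C A, form_cross_right_comm A C A,
      cross_comm (cross A C) (cross A A),
      cross_comm (cross C C) (cross A A), cross_comm (cross C C) (cross A C)] at hc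
    have hA := h A
    have hC := h C
    have f : form (cross A C) C = form (cross C C) A := by
      rw [cross_comm, form_cross_right_comm]
    rw [f] at hc
    linear_combination (norm := module) hc - hA - (c ^ 4) • hC
  -- The differences at ±1 and ±2 remove the even part of the cubic in `c`; these weights then kill
  -- the cubic coefficient and leave a quarter of the linear one.
  linear_combination (norm := module) (1 / 6 : ℂ) • e 1 - (1 / 6 : ℂ) • e (-1) - (1 / 48 :
      ℂ) • e 2 + (1 / 48 : ℂ) • e (-2)

/-- The linearization of `(A^#)^# = N(A) A`. -/
lemma cross_sharp_cross (hk : k ≤ 3) (A C : Herm k) :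
    cross (sharp A) (cross A C) = det A • C + form (sharp A) C • A := by
  have h := cross_cross_cross hk A C
  rw [form_cross_self, cross_self, form_smul_left, cross_smul_left] at h
  linear_combination (norm := module) (1 / 6 : ℂ) • h

/-! ### A trace computed in the standard basis of the Jordan algebra. -/

lemma diag_single_inl (i j : Fin 3) :
    diag (Pi.single (Sum.inl i) 1 : Herm k) j = if j = i then 1 else 0 := by
  simp [diag, Pi.single_apply]

lemma diag_single_inr (p : Fin 3 × (Fin k → Bool)) (j : Fin 3) :
    diag (Pi.single (Sum.inr p) 1 : Herm k) j = 0 := by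
  simp [diag]

lemma off_single_inl (i j : Fin 3) : off (Pi.single (Sum.inl i) 1 : Herm k) j = 0 := by
  funext s; simp [off]

lemma off_single_inr (i : Fin 3) (s : Fin k → Bool) (j : Fin 3) :
    off (Pi.single (Sum.inr (i, s)) 1 : Herm k) j = if j = i then Pi.single s 1 else 0 := by
  funext t
  by_cases h : j = i <;> simp [off, Pi.single_apply, h]

lemma sum_polar_mul_polar (x y : HAlg k) :
    ∑ s, x.polar (Pi.single s 1) * y.polar (Pi.single s 1) = 2 * x.polar y := by
  simp [HAlg.polar, Pi.single_apply, Finset.mul_sum]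
  refine Finset.sum_congr rfl fun s _ => by ring

lemma normSq_single (s : Fin k → Bool) : HAlg.normSq (Pi.single s 1) = 1 := by
  simp [HAlg.normSq, Pi.single_apply]

lemma sum_form_cross_cross_inl (A B : Herm k) :
    ∑ i, form (cross A (Pi.single (Sum.inl i) 1)) (cross B (Pi.single (Sum.inl i) 1)) =
      ∑ i, (2 * (A.diag i * B.diag i) + (A.off i).polar (B.off i)) := by
  simp only [form, Fin.sum_univ_three, diag_cross, off_cross, diag_single_inl, off_single_inl,
    Fin.isValue, zero_add, Fin.reduceAdd, Fin.reduceEq, if_true, if_false]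
  simp
  ring

lemma form_cross_single_inr (hk : k ≤ 3) (A B : Herm k) (i : Fin 3) (s : Fin k → Bool) :
    form (cross A (Pi.single (Sum.inr (i, s)) 1)) (cross B (Pi.single (Sum.inr (i, s)) 1)) =
      (A.off i).polar (Pi.single s 1) * (B.off i).polar (Pi.single s 1)
        + 2 * (A.diag i * B.diag i) + (A.off (i + 1)).polar (B.off (i + 1))
        + (A.off (i + 2)).polar (B.off (i + 2)) := by
  have e : HAlg.polar (Pi.single s 1 : HAlg k) (Pi.single s 1) = 2 := by
    rw [HAlg.polar_self, normSq_single, mul_one]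
  fin_cases i <;>
  · simp only [form, Fin.sum_univ_three, diag_cross, off_cross, diag_single_inr, off_single_inr,
      Fin.isValue, zero_add, Fin.reduceAdd, Fin.reduceEq, if_true, if_false, HAlg.mul_zero',
      HAlg.zero_mul', HAlg.conj_zero, add_zero, mul_zero, zero_smul, smul_zero, sub_zero, zero_sub,
      HAlg.polar_zero_right, HAlg.polar_neg_left, HAlg.polar_neg_right, HAlg.polar_smul_left,
      HAlg.polar_smul_right, HAlg.polar_conj_conj, HAlg.polar_mul_mul_right hk,
      HAlg.polar_mul_mul_self (HAlg.normSq_mul hk), normSq_single, e, Fin.zero_eta, Fin.mk_one,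
      Fin.reduceFinMk]
    ring

/-- The trace of `X ↦ B × (A × X)`, computed in coordinates. -/
lemma sum_form_cross_cross (hk : k ≤ 3) (A B : Herm k) :
    ∑ i, form (cross A (Pi.single (Sum.inl i) 1)) (cross B (Pi.single (Sum.inl i) 1))
      + (1 / 2) * ∑ p : Fin 3 × (Fin k → Bool), form (cross A (Pi.single (Sum.inr p) 1))
          (cross B (Pi.single (Sum.inr p) 1)) = (2 ^ k + 2) * form A B := by
  rw [sum_form_cross_cross_inl, Fintype.sum_prod_type]
  simp only [form_cross_single_inr hk, Finset.sum_add_distrib, sum_polar_mul_polar,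
    Finset.sum_const, Finset.card_univ, Fintype.card_fun, Fintype.card_bool, Fintype.card_fin,
    nsmul_eq_mul]
  simp only [form, Fin.sum_univ_three, Fin.isValue, zero_add, Fin.reduceAdd]
  push_cast
  ring

end Herm

/-! ### Polarization of quartic forms -/

lemma sum_finset_fin_four {M : Type*} [AddCommMonoid M] (f : Finset (Fin 4) → M) :
    ∑ S, f S = f ∅ + f {0} + f {1} + f {2} + f {3} + f {0, 1} + f {0, 2} + f {0, 3} + f {1, 2}
      + f {1, 3} + f {2, 3} + f {0, 1, 2} + f {0, 1, 3} + f {0, 2, 3} + f {1, 2, 3}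
      + f {0, 1, 2, 3} := by
  have h : (Finset.univ : Finset (Finset (Fin 4))) = {∅, {0}, {1}, {2}, {3}, {0, 1}, {0, 2}, {0, 3},
      {1, 2}, {1, 3}, {2, 3}, {0, 1, 2}, {0, 1, 3}, {0, 2, 3}, {1, 2, 3}, {0, 1, 2, 3}} := by decide
  rw [h]
  repeat rw [Finset.sum_insert (by decide)]
  rw [Finset.sum_singleton]
  simp only [add_assoc]

/-- A symmetric function of four arguments which is additive in each of them. -/
structure IsSymmetricQuadriadditive {W : Type*} [AddCommGroup W] (h : W → W → W → W → ℂ) :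
    Prop where
  add : ∀ x x' y z w, h (x + x') y z w = h x y z w + h x' y z w
  swap₁ : ∀ x y z w, h x y z w = h y x z w
  swap₂ : ∀ x y z w, h x y z w = h x z y w
  swap₃ : ∀ x y z w, h x y z w = h x y w z

namespace IsSymmetricQuadriadditive

variable {W : Type*} [AddCommGroup W] {h : W → W → W → W → ℂ}

lemma add₂ (hh : IsSymmetricQuadriadditive h) (x y y' z w : W) : h x (y + y') z w = h x y z w +
    h x y' z w := by
  rw [hh.swap₁, hh.add, hh.swap₁ y, hh.swap₁ y']

lemma add₃ (hh : IsSymmetricQuadriadditive h) (x y z z' w : W) : h x y (z + z') w = h x y z w +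
    h x y z' w := by
  rw [hh.swap₂, hh.add₂, hh.swap₂ _ z, hh.swap₂ _ z']

lemma add₄ (hh : IsSymmetricQuadriadditive h) (x y z w w' : W) : h x y z (w + w') = h x y z w +
    h x y z w' := by
  rw [hh.swap₃, hh.add₃, hh.swap₃ _ _ w, hh.swap₃ _ _ w']

lemma swap₁₃ (hh : IsSymmetricQuadriadditive h) (x y z w : W) : h x y z w = h z y x w := by
  rw [hh.swap₁, hh.swap₂, hh.swap₁]

lemma swap₁₄ (hh : IsSymmetricQuadriadditive h) (x y z w : W) : h x y z w = h w y z x := by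
  rw [hh.swap₃, hh.swap₁₃, hh.swap₃]

/-- Inclusion–exclusion over subsets keeps the terms in which every `x i` occurs, that is 4! equal
values. The usual sign $(-1)^{4-|S|}$ is $(-1)^{|S|}$ because the degree is even. -/
lemma polarization (hh : IsSymmetricQuadriadditive h) (x : Fin 4 → W) :
    ∑ S : Finset (Fin 4), (-1) ^ S.card * h (∑ i ∈ S, x i) (∑ i ∈ S, x i) (∑ i ∈ S, x i)
      (∑ i ∈ S, x i) = 24 * h (x 0) (x 1) (x 2) (x 3) := by
  have h0 : ∀ y z w, h 0 y z w = 0 := fun y z w => by simpa using hh.add 0 0 y z w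
  have s2 : ∀ (i j : Fin 4), i ≠ j → ∑ l ∈ {i, j}, x l = x i + x j := fun i j e =>
    Finset.sum_pair e
  have s3 : ∀ (i j l : Fin 4), i ≠ j → i ≠ l → j ≠ l → ∑ l ∈ {i, j, l}, x l = x i + (x j + x l) :=
    fun i j l e e' e'' => by
      rw [Finset.sum_insert (by simp [e, e']), s2 _ _ e'']
  have s4 : ∑ l ∈ {0, 1, 2, 3}, x l = x 0 + (x 1 + (x 2 + x 3)) := by
    rw [Finset.sum_insert (by decide), s3 _ _ _ (by decide) (by decide) (by decide)]
  rw [sum_finset_fin_four, s4]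
  simp only [Finset.sum_empty, Finset.sum_singleton, h0]
  rw [s2 _ _ (by decide), s2 _ _ (by decide), s2 _ _ (by decide), s2 _ _ (by decide),
    s2 _ _ (by decide), s2 _ _ (by decide), s3 _ _ _ (by decide) (by decide) (by decide),
    s3 _ _ _ (by decide) (by decide) (by decide), s3 _ _ _ (by decide) (by decide) (by decide),
    s3 _ _ _ (by decide) (by decide) (by decide)]
  have c1 : ∀ i : Fin 4, ({i} : Finset (Fin 4)).card = 1 := by decide
  have c2 : ∀ i j : Fin 4, i ≠ j → ({i, j} : Finset (Fin 4)).card = 2 := by decide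
  have c3 : ∀ i j l : Fin 4, i ≠ j → i ≠ l → j ≠ l → ({i, j, l} : Finset (Fin 4)).card = 3 := by
    decide
  have c4 : ({0, 1, 2, 3} : Finset (Fin 4)).card = 4 := by decide
  rw [c4, c2 _ _ (by decide), c2 _ _ (by decide), c2 _ _ (by decide), c2 _ _ (by decide),
    c2 _ _ (by decide), c2 _ _ (by decide), c3 _ _ _ (by decide) (by decide) (by decide),
    c3 _ _ _ (by decide) (by decide) (by decide), c3 _ _ _ (by decide) (by decide) (by decide),
    c3 _ _ _ (by decide) (by decide) (by decide)]
  simp only [c1, hh.add, hh.add₂, hh.add₃, hh.add₄]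
  generalize x 0 = a
  generalize x 1 = b
  generalize x 2 = c
  generalize x 3 = d
  simp only [hh.swap₁ b a, hh.swap₁ c a, hh.swap₁ d a, hh.swap₁ c b, hh.swap₁ d b, hh.swap₁ d c,
    hh.swap₂ _ b a, hh.swap₂ _ c a, hh.swap₂ _ d a, hh.swap₂ _ c b, hh.swap₂ _ d b, hh.swap₂ _ d c,
    hh.swap₃ _ _ b a, hh.swap₃ _ _ c a, hh.swap₃ _ _ d a, hh.swap₃ _ _ c b, hh.swap₃ _ _ d b,
    hh.swap₃ _ _ d c]
  ring

lemma eq_zero_of_diag (hh : IsSymmetricQuadriadditive h) (hd : ∀ x, h x x x x = 0) (x y z w : W) :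
    h x y z w = 0 := by
  have := hh.polarization ![x, y, z, w]
  simp only [hd, mul_zero, Finset.sum_const_zero] at this
  simpa using this.symm

end IsSymmetricQuadriadditive

/-! ### The symplectic form and the quartic form on `V` -/

namespace V

/-- The vector `(a, b, A, B)`. -/
def mk (a b : ℂ) (A B : Herm k) : V k
  | (false, Sum.inl _) => a
  | (true, Sum.inl _) => b
  | (false, Sum.inr i) => A i
  | (true, Sum.inr i) => B i

@[simp] lemma a_mk (a b : ℂ) (A B : Herm k) : (mk a b A B).a = a := rfl
@[simp] lemma b_mk (a b : ℂ) (A B : Herm k) : (mk a b A B).b = b := rfl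
@[simp] lemma A_mk (a b : ℂ) (A B : Herm k) : (mk a b A B).A = A := rfl
@[simp] lemma B_mk (a b : ℂ) (A B : Herm k) : (mk a b A B).B = B := rfl

@[simp] lemma a_add (v w : V k) : (v + w).a = v.a + w.a := rfl
@[simp] lemma b_add (v w : V k) : (v + w).b = v.b + w.b := rfl
@[simp] lemma A_add (v w : V k) : (v + w).A = v.A + w.A := rfl
@[simp] lemma B_add (v w : V k) : (v + w).B = v.B + w.B := rfl
@[simp] lemma a_smul (c : ℂ) (v : V k) : (c • v).a = c * v.a := rfl
@[simp] lemma b_smul (c : ℂ) (v : V k) : (c • v).b = c * v.b := rfl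
@[simp] lemma A_smul (c : ℂ) (v : V k) : (c • v).A = c • v.A := rfl
@[simp] lemma B_smul (c : ℂ) (v : V k) : (c • v).B = c • v.B := rfl
@[simp] lemma a_neg (v : V k) : (-v).a = -v.a := rfl
@[simp] lemma b_neg (v : V k) : (-v).b = -v.b := rfl
@[simp] lemma A_neg (v : V k) : (-v).A = -v.A := rfl
@[simp] lemma B_neg (v : V k) : (-v).B = -v.B := rfl

lemma ext_parts {v w : V k} (ha : v.a = w.a) (hb : v.b = w.b) (hA : v.A = w.A) (hB : v.B = w.B) :
    v = w := by
  funext p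
  rcases p with ⟨_ | _, _ | i⟩
  · exact ha
  · exact congrFun hA i
  · exact hb
  · exact congrFun hB i

end V

open Herm

lemma sympl_add_left (x y z : V k) : sympl (x + y) z = sympl x z + sympl y z := by
  simp only [sympl, V.a_add, V.b_add, V.A_add, V.B_add, form_add_left]; ring

lemma sympl_smul_left (c : ℂ) (x y : V k) : sympl (c • x) y = c * sympl x y := by
  simp only [sympl, V.a_smul, V.b_smul, V.A_smul, V.B_smul, form_smul_left]; ring

lemma sympl_swap (x y : V k) : sympl y x = -sympl x y := by
  simp only [sympl, form_comm y.A, form_comm y.B]; ring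

/-- The symplectic form as a bilinear map. -/
def symplₗ (k : ℕ) : V k →ₗ[ℂ] V k →ₗ[ℂ] ℂ :=
  LinearMap.mk₂ ℂ sympl sympl_add_left sympl_smul_left
    (fun x y z => by rw [sympl_swap, sympl_add_left, sympl_swap x y, sympl_swap x z]; ring)
    (fun c x y => by rw [sympl_swap, sympl_smul_left, sympl_swap x y, smul_eq_mul]; ring)

lemma sympl_add_right (x y z : V k) : sympl x (y + z) = sympl x y + sympl x z :=
  (symplₗ k x).map_add y z
lemma sympl_smul_right (c : ℂ) (x y : V k) : sympl x (c • y) = c * sympl x y :=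
  (symplₗ k x).map_smul c y

/-- The symmetric pairing `(v, w) ↦ 2 (a b - T(A, B))`, polarized. -/
def pairing (x y : V k) : ℂ := x.a * y.b + y.a * x.b - x.A.form y.B - y.A.form x.B

lemma pairing_comm (x y : V k) : pairing x y = pairing y x := by simp only [pairing]; ring

lemma pairing_add_left (x y z : V k) : pairing (x + y) z = pairing x z + pairing y z := by
  simp only [pairing, V.a_add, V.b_add, V.A_add, V.B_add, form_add_left, form_add_right]; ring

lemma pairing_smul_left (c : ℂ) (x y : V k) : pairing (c • x) y = c * pairing x y := by
  simp only [pairing, V.a_smul, V.b_smul, V.A_smul, V.B_smul, form_smul_left, form_smul_right]; ring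

/-- The symmetric quadrilinear form with `dForm v v v v = quartic v`. -/
def dForm (x y z w : V k) : ℂ :=
  6 * ((cross x.A y.A).form (cross z.B w.B) + (cross x.A z.A).form (cross y.B w.B)
      + (cross x.A w.A).form (cross y.B z.B) + (cross y.A z.A).form (cross x.B w.B)
      + (cross y.A w.A).form (cross x.B z.B) + (cross z.A w.A).form (cross x.B y.B)
      - x.a * (cross y.A z.A).form w.A - y.a * (cross x.A z.A).form w.A
      - z.a * (cross x.A y.A).form w.A - w.a * (cross x.A y.A).form z.A
      - x.b * (cross y.B z.B).form w.B - y.b * (cross x.B z.B).form w.B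
      - z.b * (cross x.B y.B).form w.B - w.b * (cross x.B y.B).form z.B)
    - 3 * (pairing x y * pairing z w + pairing x z * pairing y w + pairing x w * pairing y z)

lemma dForm_isSymmetric : IsSymmetricQuadriadditive (dForm (k := k)) where
  add x x' y z w := by
    simp only [dForm, V.a_add, V.b_add, V.A_add, V.B_add, cross_add_left, form_add_left,
      form_add_right, pairing_add_left]
    ring
  swap₁ x y z w := by
    simp only [dForm, cross_comm y.A x.A, cross_comm y.B x.B, pairing_comm y x]
    ring
  swap₂ x y z w := by
    simp only [dForm, cross_comm z.A y.A, cross_comm z.B y.B, pairing_comm z y,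
      form_cross_right_comm x.A z.A, form_cross_right_comm x.B z.B]
    ring
  swap₃ x y z w := by
    simp only [dForm, cross_comm w.A z.A, cross_comm w.B z.B, pairing_comm w z,
      form_cross_right_comm x.A w.A, form_cross_right_comm x.B w.B,
      form_cross_right_comm y.A w.A, form_cross_right_comm y.B w.B]
    ring

lemma dForm_smul (c : ℂ) (x y z w : V k) : dForm (c • x) y z w = c * dForm x y z w := by
  simp only [dForm, V.a_smul, V.b_smul, V.A_smul, V.B_smul, cross_smul_left, form_smul_left,
    form_smul_right, pairing_smul_left]
  ring

lemma dForm_self (v : V k) : dForm v v v v = quartic v := by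
  simp only [dForm, quartic, pairing, cross_self, form_smul_left, form_smul_right]
  have hA := form_cross_self v.A
  have hB := form_cross_self v.B
  simp only [cross_self, form_smul_left] at hA hB
  linear_combination -24 * v.a * hA - 24 * v.b * hB

lemma dTensor_eq (p : Fin 4 → VIdx k) :
    dTensor k p = dForm (stdVec (p 0)) (stdVec (p 1)) (stdVec (p 2)) (stdVec (p 3)) := by
  have h := dForm_isSymmetric.polarization fun i => stdVec (k := k) (p i)
  simp only [dForm_self] at h
  rw [dTensor, h]
  ring

/-- The quartic form as a linear function of its first argument. -/
def dFormₗ (y z w : V k) : V k →ₗ[ℂ] ℂ where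
  toFun x := dForm x y z w
  map_add' x x' := dForm_isSymmetric.add x x' y z w
  map_smul' c x := dForm_smul c x y z w

/-! ### Infinitesimal symmetries -/

/-- A linear map which preserves the symplectic form and the quartic form infinitesimally. -/
structure IsDerivation (X : V k →ₗ[ℂ] V k) : Prop where
  sympl : ∀ v w, sympl (X v) w + ESeven.sympl v (X w) = 0
  dForm : ∀ x y z w, dForm (X x) y z w + ESeven.dForm x (X y) z w + ESeven.dForm x y (X z) w
    + ESeven.dForm x y z (X w) = 0

/-- The infinitesimal variation of the quartic form under `X`. -/
def variation (X : V k →ₗ[ℂ] V k) (x y z w : V k) : ℂ :=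
  dForm (X x) y z w + dForm x (X y) z w + dForm x y (X z) w + dForm x y z (X w)

lemma variation_isSymmetric (X : V k →ₗ[ℂ] V k) : IsSymmetricQuadriadditive (variation X) :=
  have hd := dForm_isSymmetric (k := k)
  { add := fun x x' y z w => by simp only [variation, map_add, hd.add]; ring
    swap₁ := fun x y z w => by
      simp only [variation, hd.swap₁ y (X x), hd.swap₁ (X y) x, hd.swap₁ y x]; ring
    swap₂ := fun x y z w => by
      simp only [variation, hd.swap₂ _ z (X y), hd.swap₂ _ (X z) y, hd.swap₂ _ z y]; ring
    swap₃ := fun x y z w => by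
      simp only [variation, hd.swap₃ _ _ w (X z), hd.swap₃ _ _ (X w) z, hd.swap₃ _ _ w z]; ring }

/-- It suffices to check the invariance of the quartic form on the diagonal. -/
lemma IsDerivation.of_diag {X : V k →ₗ[ℂ] V k}
    (h₁ : ∀ v w, ESeven.sympl (X v) w + ESeven.sympl v (X w) = 0)
    (h₂ : ∀ v, ESeven.dForm (X v) v v v = 0) : IsDerivation X where
  sympl := h₁
  dForm := by
    have hd := dForm_isSymmetric (k := k)
    refine (variation_isSymmetric X).eq_zero_of_diag fun x => ?_
    rw [variation, hd.swap₁ x (X x), hd.swap₁₃ x x (X x), hd.swap₁₄ x x x (X x), h₂]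
    ring

/-- The raising operator attached to `C`. -/
def raising (C : Herm k) : V k →ₗ[ℂ] V k where
  toFun v := V.mk (v.B.form C) 0 (v.b • C) (cross C v.A)
  map_add' v w := V.ext_parts (by simp [form_add_left]) (by simp) (by simp [add_smul])
    (by simp [cross_add_right])
  map_smul' c v := V.ext_parts (by simp [form_smul_left]) (by simp) (by simp [mul_smul])
    (by simp [cross_smul_right])

/-- The exchange of `(a, A)` and `(b, B)`. -/
def exchange (v : V k) : V k := V.mk v.b v.a v.B v.A

/-- The lowering operator attached to `C`. -/
def lowering (C : Herm k) : V k →ₗ[ℂ] V k where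
  toFun v := V.mk 0 (v.A.form C) (cross C v.B) (v.a • C)
  map_add' v w := V.ext_parts (by simp) (by simp [form_add_left])
    (by simp [cross_add_right]) (by simp [add_smul])
  map_smul' c v := V.ext_parts (by simp) (by simp [form_smul_left])
    (by simp [cross_smul_right]) (by simp [mul_smul])

/-- A quarter of the differential of the quartic form at `v`, which is what invariance has to be
checked on. -/
lemma dForm_diag (x v : V k) : dForm x v v v =
    36 * (cross v.A x.A).form v.B.sharp + 36 * v.A.sharp.form (cross v.B x.B)
      - 36 * x.a * v.A.det - 36 * v.a * v.A.sharp.form x.A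
      - 36 * x.b * v.B.det - 36 * v.b * v.B.sharp.form x.B
      - 18 * pairing x v * (v.a * v.b - v.A.form v.B) := by
  have hA := form_cross_self v.A
  have hB := form_cross_self v.B
  simp only [cross_self, form_smul_left] at hA hB
  simp only [dForm, cross_comm x.A, cross_comm x.B, form_cross_right_comm v.A x.A v.A,
    form_cross_right_comm v.B x.B v.B, cross_self, form_smul_left,
    form_comm (cross _ _)]
  simp only [pairing]
  linear_combination -6 * x.a * hA - 6 * x.b * hB

/-- The one term that does not cancel formally is $T(B, A^\#\times(A\times C))$. The linearized
adjoint identity turns it into $N(A)T(B,C)+T(A^\#,C)T(A,B)$, which cancels against the variation of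
$aN(A)$ and of the squared pairing. -/
lemma isDerivation_raising (hk : k ≤ 3) (C : Herm k) : IsDerivation (raising C) := by
  refine .of_diag (fun v w => ?_) fun v => ?_
  · have h := form_cross_right_comm C v.A w.A
    simp only [sympl, raising, LinearMap.coe_mk, AddHom.coe_mk, V.a_mk, V.b_mk, V.A_mk, V.B_mk,
      form_smul_left, form_smul_right, form_comm v.A (cross _ _), form_comm C, h]
    ring
  · have h1 := congrArg (form v.B) (cross_sharp_cross hk v.A C)
    have h2 : v.A.sharp.form (cross v.B (cross v.A C)) =
        v.B.form (cross v.A.sharp (cross v.A C)) := by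
      rw [form_comm, cross_comm v.B, form_cross_right_comm, form_comm, cross_comm v.A.sharp]
    have h3 : v.A.form (cross v.A C) = 2 * v.A.sharp.form C := by
      rw [form_comm, form_cross_right_comm, cross_self, form_smul_left]
    rw [form_add_right, form_smul_right, form_smul_right] at h1
    rw [dForm_diag]
    simp only [raising, pairing, LinearMap.coe_mk, AddHom.coe_mk, V.a_mk, V.b_mk, V.A_mk, V.B_mk,
      form_smul_left, form_smul_right, cross_smul_right, h2, h1, h3, cross_comm C v.A,
      form_comm (cross _ _), form_comm C, form_comm v.B v.A]
    ring

/-- Conjugation by `exchange` turns raising into lowering; it preserves the quartic form and changes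
the sign of the symplectic form, and that sign is harmless for skewness. -/
lemma isDerivation_lowering (hk : k ≤ 3) (C : Herm k) : IsDerivation (lowering C) := by
  have he : ∀ v : V k, lowering C v = exchange (raising C (exchange v)) := fun v => rfl
  have hs : ∀ v w : V k, sympl (exchange v) w = -sympl v (exchange w) := fun v w => by
    simp only [sympl, exchange, V.a_mk, V.b_mk, V.A_mk, V.B_mk]; ring
  have hd : ∀ x v : V k, dForm (exchange x) v v v =
      dForm x (exchange v) (exchange v) (exchange v) := fun x v => by
    simp only [dForm_diag, pairing, exchange, V.a_mk, V.b_mk, V.A_mk, V.B_mk, form_comm (cross _ _),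
      form_comm v.B v.A, form_comm v.A x.A, form_comm v.B x.B]; ring
  have hr := isDerivation_raising hk C
  refine .of_diag (fun v w => ?_) fun v => ?_
  · have h := hr.sympl (exchange v) (exchange w)
    rw [he, he, hs]
    rw [hs] at h
    linear_combination -h
  · rw [he, hd]
    have h := hr.dForm (exchange v) (exchange v) (exchange v) (exchange v)
    have hd := dForm_isSymmetric (k := k)
    generalize exchange v = x at *
    rw [hd.swap₁ x (raising C x), hd.swap₁₃ x x (raising C x),
      hd.swap₁₄ x x x (raising C x)] at h
    linear_combination h / 4

/-! ### Dual bases -/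

namespace Herm

/-- The weights `g` for which `g p • e_p` is the basis dual to `e_p` for the trace form. -/
def weight : HermIdx k → ℂ
  | Sum.inl _ => 1
  | Sum.inr _ => 1 / 2

lemma form_single (X : Herm k) (p : HermIdx k) :
    weight p * form X (Pi.single p 1) = X p := by
  rcases p with i | ⟨i, s⟩
  · simp [weight, form, diag_single_inl, off_single_inl]
    rfl
  · have h : ∀ j, (X.off j).polar (if j = i then Pi.single s 1 else 0) =
        if j = i then 2 * X (Sum.inr (j, s)) else 0 := fun j => by
      split_ifs <;> simp [HAlg.polar, Pi.single_apply, off]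
    simp [weight, form, diag_single_inr, off_single_inr, h]

lemma sum_single (X : Herm k) : ∑ p, X p • (Pi.single p 1 : Herm k) = X := by
  funext q; simp [Finset.sum_apply, Pi.single_apply]

lemma sum_form_mul_form (X Y : Herm k) :
    ∑ p, weight p * (form X (Pi.single p 1) * form Y (Pi.single p 1)) = form X Y := by
  have h := congrArg (formₗ k Y) (sum_single X)
  rw [map_sum] at h
  simp only [map_smul, smul_eq_mul] at h
  rw [form_comm, ← show formₗ k Y X = form Y X from rfl, ← h]
  refine Finset.sum_congr rfl fun p _ => ?_
  rw [← form_single X p, ← show formₗ k Y (Pi.single p 1) = form Y (Pi.single p 1) from rfl]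
  ring

lemma eq_of_form {X Y : Herm k} (h : ∀ Z, form X Z = form Y Z) : X = Y := by
  funext p
  rw [← form_single X, ← form_single Y, h]

lemma sum_weight_mul_form_cross_cross (hk : k ≤ 3) (A B : Herm k) :
    ∑ p, weight p * form (cross A (Pi.single p 1)) (cross B (Pi.single p 1)) =
      (m k + 2) * form A B := by
  rw [m, ← sum_form_cross_cross hk, Fintype.sum_sum_type, Finset.mul_sum]
  simp [weight]

lemma sum_weight_mul_form_self :
    ∑ p : HermIdx k, weight p * form (Pi.single p 1 : Herm k) (Pi.single p 1) =
      3 * m k + 3 := by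
  simp only [form_single, Pi.single_eq_same]
  simp [m]
  ring

/-- The identity matrix. -/
def one (k : ℕ) : Herm k
  | Sum.inl _ => 1
  | Sum.inr _ => 0

lemma diag_one (i : Fin 3) : diag (one k) i = 1 := rfl

lemma off_one (i : Fin 3) : off (one k) i = 0 := rfl

lemma form_one_one : form (one k) (one k) = 3 := by
  simp [form, diag_one, off_one]

lemma cross_one (X : Herm k) : cross (one k) X = form (one k) X • one k - X := by
  refine ext_diag_off (fun i => ?_) fun i => ?_
  · change _ = form (one k) X * diag (one k) i - diag X i
    simp only [diag_cross, diag_one, off_one, form, HAlg.polar_zero_left, Fin.sum_univ_three]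
    fin_cases i <;> simp <;> ring
  · change _ = form (one k) X • off (one k) i - off X i
    simp [diag_one, off_one]

lemma exists_cross_one (X : Herm k) : ∃ Y, cross (one k) Y = X := by
  -- Since `cross (one k)` is $X\mapsto T(1,X)1-X$ and $T(1,1)=3$, it doubles the identity matrix;
  -- halving the trace term inverts it.
  refine ⟨(form (one k) X / 2) • one k - X, ?_⟩
  rw [sub_eq_add_neg, ← neg_one_smul ℂ X, cross_add_right, cross_smul_right, cross_smul_right,
    cross_one, cross_one, form_one_one]
  module

end Herm

/-! ### Generation of `V` and of `V ⊗ V` by the highest and lowest weight vectors -/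

namespace V

/-- The highest weight vector. -/
def high (k : ℕ) : V k := mk 1 0 0 0

/-- The lowest weight vector. -/
def low (k : ℕ) : V k := mk 0 1 0 0

lemma eq_sum_parts (v : V k) :
    v = v.a • high k + v.b • low k + mk 0 0 v.A 0 + mk 0 0 0 v.B := by
  refine ext_parts ?_ ?_ ?_ ?_ <;> simp [high, low]

end V

/-- Raising climbs from `low` to the `A` summand, then to the `B` summand, all of which is reached
because `cross (one k)` is onto, and finally to a nonzero multiple of `high`. -/
lemma eq_top_of_raising (S : Submodule ℂ (V k)) (h : V.low k ∈ S)
    (hS : ∀ C, ∀ v ∈ S, raising C v ∈ S) : S = ⊤ := by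
  have hA : ∀ C, V.mk 0 0 C 0 ∈ S := fun C => by
    convert hS C _ h using 1
    exact V.ext_parts (by simp [raising, V.low]) (by simp [raising])
      (by simp [raising, V.low]) (by simp [raising, V.low])
  have hB : ∀ B, V.mk 0 0 0 B ∈ S := fun B => by
    obtain ⟨C, rfl⟩ := exists_cross_one B
    convert hS (one k) _ (hA C) using 1
    exact V.ext_parts (by simp [raising]) (by simp [raising]) (by simp [raising])
        (by simp [raising])
  have ha : V.high k ∈ S := by
    convert S.smul_mem (1 / 3 : ℂ) (hS (one k) _ (hB (one k))) using 1
    exact V.ext_parts (by simp [raising, V.high, form_one_one]) (by simp [raising, V.high])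
      (by simp [raising, V.high]) (by simp [raising, V.high])
  refine Submodule.eq_top_iff'.2 fun v => ?_
  rw [v.eq_sum_parts]
  exact S.add_mem (S.add_mem (S.add_mem (S.smul_mem _ ha) (S.smul_mem _ h)) (hA _)) (hB _)

/-- The exchange of `(a, A)` and `(b, B)` as a linear map. -/
def exchangeₗ (k : ℕ) : V k →ₗ[ℂ] V k where
  toFun := exchange
  map_add' _ _ := V.ext_parts rfl rfl rfl rfl
  map_smul' _ _ := V.ext_parts rfl rfl rfl rfl

lemma exchange_exchange (v : V k) : exchange (exchange v) = v := V.ext_parts rfl rfl rfl rfl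

lemma eq_top_of_lowering (S : Submodule ℂ (V k)) (h : V.high k ∈ S)
    (hS : ∀ C, ∀ v ∈ S, lowering C v ∈ S) : S = ⊤ := by
  have h' := eq_top_of_raising (S.comap (exchangeₗ k)) (by
    rw [Submodule.mem_comap]
    convert h using 1
    exact V.ext_parts rfl rfl rfl rfl) fun C v hv => hS C (exchange v) hv
  refine Submodule.eq_top_iff'.2 fun v => ?_
  rw [← exchange_exchange v]
  exact Submodule.eq_top_iff'.1 h' (exchange v)

/-- The decomposable tensor `x ⊗ y` in coordinates. -/
def tensor (x y : V k) : VIdx k × VIdx k → ℂ := fun p => x p.1 * y p.2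

/-- The tensor product of vectors as a bilinear map. -/
def tensorₗ (k : ℕ) : V k →ₗ[ℂ] V k →ₗ[ℂ] (VIdx k × VIdx k → ℂ) :=
  LinearMap.mk₂ ℂ tensor (fun x y z => funext fun p => add_mul (x p.1) (y p.1) (z p.2))
    (fun c x y => funext fun p => mul_assoc c (x p.1) (y p.2))
    (fun x y z => funext fun p => mul_add (x p.1) (y p.2) (z p.2))
    (fun c x y => funext fun p => mul_left_comm (x p.1) c (y p.2))

/-- The diagonal action `X ⊗ 1 + 1 ⊗ X`. -/
def diagAct (X : Matrix (VIdx k) (VIdx k) ℂ) : End2 k := X ⊗ₖ 1 + 1 ⊗ₖ X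

lemma kronecker_one_add_mulVec {ι : Type*} [Fintype ι] [DecidableEq ι] (X : Matrix ι ι ℂ)
    (t : ι × ι → ℂ) (p : ι × ι) : (X ⊗ₖ (1 : Matrix ι ι ℂ) + (1 : Matrix ι ι ℂ) ⊗ₖ X).mulVec t p =
      ∑ s, X p.1 s * t (s, p.2) + ∑ s, X p.2 s * t (p.1, s) := by
  simp only [Matrix.mulVec, dotProduct, Fintype.sum_prod_type, Matrix.add_apply,
    Matrix.kroneckerMap_apply, add_mul, Finset.sum_add_distrib]
  congr 1
  · simp [Matrix.one_apply]
  · rw [Finset.sum_comm]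
    simp [Matrix.one_apply]

lemma diagAct_mulVec (X : Matrix (VIdx k) (VIdx k) ℂ) (t : VIdx k × VIdx k → ℂ) (p :
    VIdx k × VIdx k) :
    (diagAct X).mulVec t p = ∑ s, X p.1 s * t (s, p.2) + ∑ s, X p.2 s * t (p.1, s) := by
  exact kronecker_one_add_mulVec X t p

lemma diagAct_mulVec_tensor (X : Matrix (VIdx k) (VIdx k) ℂ) (x y : V k) :
    (diagAct X).mulVec (tensor x y) = tensor (X.mulVec x) y + tensor x (X.mulVec y) := by
  funext p
  rw [diagAct_mulVec]
  simp only [tensor, Pi.add_apply, Matrix.mulVec, dotProduct, Finset.sum_mul, Finset.mul_sum]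
  congr 1 <;> refine Finset.sum_congr rfl fun s _ => by ring

lemma tensor_stdVec (p : VIdx k × VIdx k) :
    tensor (stdVec p.1) (stdVec p.2) = Pi.single p 1 := by
  funext q
  simp only [tensor, stdVec, Pi.single_apply, Prod.ext_iff, ite_and, mul_ite, mul_one, mul_zero]
  split_ifs <;> rfl

lemma sum_smul_tensor (t : VIdx k × VIdx k → ℂ) :
    ∑ p, t p • tensor (stdVec p.1) (stdVec p.2) = t := by
  simp only [tensor_stdVec]
  exact (pi_eq_sum_univ' t).symm

/-- A subspace of `V ⊗ V` which is stable under the infinitesimal symmetries and contains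
`high ⊗ low` is everything. -/
lemma eq_top_of_tensor_mem (hk : k ≤ 3) (S : Submodule ℂ (VIdx k × VIdx k → ℂ))
    (h : tensor (V.high k) (V.low k) ∈ S)
    (hS : ∀ X : Matrix (VIdx k) (VIdx k) ℂ, IsDerivation (Matrix.toLin' X) →
      ∀ t ∈ S, (diagAct X).mulVec t ∈ S) : S = ⊤ := by
  have key : ∀ X : V k →ₗ[ℂ] V k, IsDerivation X → ∀ x y, tensor x y ∈ S →
      tensor (X x) y + tensor x (X y) ∈ S := fun X hX x y ht => by
    have := hS (LinearMap.toMatrix' X) (by rwa [Matrix.toLin'_toMatrix']) _ ht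
    rwa [diagAct_mulVec_tensor, LinearMap.toMatrix'_mulVec, LinearMap.toMatrix'_mulVec] at this
  -- Raising annihilates `high`, so on high ⊗ y it acts on the second factor alone.
  have h1 : ∀ y, tensor (V.high k) y ∈ S := fun y => by
    have h1 := eq_top_of_raising (S.comap (tensorₗ k (V.high k))) h fun C v hv => by
      have := key _ (isDerivation_raising hk C) _ _ hv
      have e : raising C (V.high k) = 0 := V.ext_parts (by simp [raising, V.high]; rfl)
        (by simp [raising]; rfl) (by simp [raising, V.high]; rfl) (by simp [raising, V.high]; rfl)
      rw [e, ← show tensorₗ k 0 v = tensor 0 v from rfl, map_zero, LinearMap.zero_apply,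
        zero_add] at this
      exact this
    exact Submodule.eq_top_iff'.1 h1 y
  -- `T` collects the first factors that are admissible with every second factor; it contains
  -- `high`. Modulo `S`, lowering then acts on the first factor alone.
  have h2 : ∀ x y, tensor x y ∈ S := fun x => by
    let T : Submodule ℂ (V k) := ⨅ y, S.comap ((tensorₗ k).flip y)
    have hT : ∀ x, x ∈ T ↔ ∀ y, tensor x y ∈ S := fun x => by
      simp only [T, Submodule.mem_iInf]; rfl
    have := eq_top_of_lowering T ((hT _).2 h1) fun C v hv => (hT _).2 fun y => by
      rw [hT] at hv
      exact (S.add_mem_iff_left (hv _)).1 (key _ (isDerivation_lowering hk C) _ _ (hv y))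
    exact (hT x).1 (Submodule.eq_top_iff'.1 this x)
  refine Submodule.eq_top_iff'.2 fun t => ?_
  rw [← sum_smul_tensor t]
  exact S.sum_mem fun p _ => S.smul_mem _ (h2 _ _)

/-! ### The matrix of the symplectic form and the dual basis -/

lemma sum_smul_stdVec (v : V k) : ∑ p, v p • stdVec p = v := (pi_eq_sum_univ' v).symm

lemma sympl_eq_sum (x y : V k) : sympl x y = ∑ p, y p * sympl x (stdVec p) := by
  have h := congrArg (symplₗ k x) (sum_smul_stdVec y)
  rw [map_sum] at h
  simp only [map_smul, smul_eq_mul] at h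
  exact h.symm

lemma sympl_eq_sum_left (x y : V k) : sympl x y = ∑ p, x p * sympl (stdVec p) y := by
  rw [sympl_swap, sympl_eq_sum, ← Finset.sum_neg_distrib]
  exact Finset.sum_congr rfl fun p _ => by rw [sympl_swap (stdVec p) y]; ring

lemma J_mulVec (v : V k) (p : VIdx k) : (J k).mulVec v p = sympl (stdVec p) v := by
  rw [sympl_eq_sum]
  exact Finset.sum_congr rfl fun q _ => mul_comm _ _

lemma sympl_eq_dotProduct (x y : V k) : sympl x y = x ⬝ᵥ (J k).mulVec y := by
  rw [sympl_eq_sum_left]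
  exact Finset.sum_congr rfl fun p _ => by rw [J_mulVec]

lemma eq_zero_of_sympl {x : V k} (h : ∀ y, sympl y x = 0) : x = 0 := by
  refine V.ext_parts ?_ ?_ (eq_of_form fun Z => ?_) (eq_of_form fun Z => ?_)
  · have := h (V.mk 0 1 0 0)
    simp [sympl] at this
    exact this
  · have := h (V.mk 1 0 0 0)
    simp [sympl] at this
    exact this
  · have := h (V.mk 0 0 0 Z)
    simp [sympl] at this
    rw [form_comm, this]
    exact (form_zero_left _).symm
  · have := h (V.mk 0 0 Z 0)
    simp [sympl] at this
    rw [form_comm, this]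
    exact (form_zero_left _).symm

lemma eq_of_sympl {x y : V k} (h : ∀ z, sympl z x = sympl z y) : x = y := by
  refine sub_eq_zero.1 (eq_zero_of_sympl fun z => ?_)
  exact ((symplₗ k z).map_sub x y).trans (sub_eq_zero.2 (h z))

lemma eq_of_sympl_left {x y : V k} (h : ∀ z, sympl x z = sympl y z) : x = y :=
  eq_of_sympl fun z => by rw [sympl_swap, h, sympl_swap y]

lemma J_transpose : (J k).transpose = -J k := by
  ext p q
  exact sympl_swap _ _

lemma isUnit_det_J : IsUnit (J k).det := by
  rw [isUnit_iff_ne_zero]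
  intro h
  obtain ⟨v, hv, h0⟩ := Matrix.exists_mulVec_eq_zero_iff.2 h
  refine hv (eq_zero_of_sympl fun y => ?_)
  rw [sympl_eq_dotProduct, h0, dotProduct_zero]

lemma J_inv_transpose : ((J k)⁻¹).transpose = -(J k)⁻¹ := by
  rw [Matrix.transpose_nonsing_inv, J_transpose]
  refine Matrix.inv_eq_left_inv ?_
  rw [neg_mul_neg, Matrix.nonsing_inv_mul _ isUnit_det_J]

/-- The rows of `J⁻¹`; they represent the coordinate functions with respect to the form. -/
def dualVec (p : VIdx k) : V k := (J k)⁻¹ p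

lemma sympl_dualVec (p : VIdx k) (v : V k) : sympl (dualVec p) v = v p := by
  rw [sympl_eq_dotProduct]
  change ((J k)⁻¹.mulVec ((J k).mulVec v)) p = v p
  rw [Matrix.mulVec_mulVec, Matrix.nonsing_inv_mul _ isUnit_det_J, Matrix.one_mulVec]

lemma dualVec_eq {p : VIdx k} {x : V k} (h : ∀ v, sympl x v = v p) : dualVec p = x :=
  eq_of_sympl_left fun z => by rw [sympl_dualVec, h]

lemma dualVec_apply_swap (p q : VIdx k) : dualVec q p = -dualVec p q :=
  congrFun (congrFun J_inv_transpose p) q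

lemma sum_sympl_smul_dualVec (v : V k) : ∑ p, sympl (stdVec p) v • dualVec p = -v := by
  refine eq_of_sympl_left fun z => ?_
  change symplₗ k _ z = symplₗ k _ z
  rw [map_sum, map_neg, LinearMap.sum_apply, LinearMap.neg_apply]
  simp only [map_smul, LinearMap.smul_apply, smul_eq_mul]
  change ∑ p, sympl (stdVec p) v * sympl (dualVec p) z = -sympl v z
  rw [← sympl_swap, sympl_eq_sum_left]
  exact Finset.sum_congr rfl fun p _ => by rw [sympl_dualVec, mul_comm]

/-- Skewness of `X` for the symplectic form lets its action on an upper index be moved onto the dual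
vectors; this is how invariance of $d$ becomes equivariance of $D$. -/
lemma sum_apply_smul_dualVec {X : Matrix (VIdx k) (VIdx k) ℂ}
    (hX : ∀ v w, sympl (X.mulVec v) w + sympl v (X.mulVec w) = 0) (p : VIdx k) :
    ∑ s, X p s • dualVec s = -X.mulVec (dualVec p) := by
  refine eq_of_sympl_left fun z => ?_
  have h := hX (dualVec p) z
  rw [sympl_dualVec] at h
  change symplₗ k _ z = symplₗ k _ z
  rw [map_sum, map_neg, LinearMap.sum_apply, LinearMap.neg_apply]
  simp only [map_smul, LinearMap.smul_apply, smul_eq_mul]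
  change ∑ s, X p s * sympl (dualVec s) z = -sympl _ z
  simp only [sympl_dualVec]
  change X.mulVec z p = _
  linear_combination h

/-! ### The components of the quartic tensor -/

lemma sum_mul_dForm (x y z w : V k) : ∑ s, x s * dForm (stdVec s) y z w = dForm x y z w := by
  have h := congrArg (dFormₗ y z w) (sum_smul_stdVec x)
  rw [map_sum] at h
  simp only [map_smul, smul_eq_mul] at h
  exact h

lemma sum_mul_dForm₂ (x y z w : V k) : ∑ s, y s * dForm x (stdVec s) z w = dForm x y z w := by
  simp only [dForm_isSymmetric.swap₁ x, sum_mul_dForm]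

lemma sum_mul_dForm₃ (x y z w : V k) : ∑ s, z s * dForm x y (stdVec s) w = dForm x y z w := by
  rw [dForm_isSymmetric.swap₂, ← sum_mul_dForm₂]
  exact Finset.sum_congr rfl fun s _ => by rw [dForm_isSymmetric.swap₂]

lemma sum_mul_dForm₄ (x y z w : V k) : ∑ s, w s * dForm x y z (stdVec s) = dForm x y z w := by
  rw [dForm_isSymmetric.swap₃, ← sum_mul_dForm₃]
  exact Finset.sum_congr rfl fun s _ => by rw [dForm_isSymmetric.swap₃]

lemma dForm_sum_smul (c : VIdx k → ℂ) (x : VIdx k → V k) (y z w : V k) :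
    dForm (∑ s, c s • x s : V k) y z w = ∑ s, c s * dForm (x s) y z w := by
  have h := map_sum (dFormₗ y z w) (fun s => c s • x s) Finset.univ
  simp only [map_smul, smul_eq_mul] at h
  exact h

lemma dForm_neg (x y z w : V k) : dForm (-x) y z w = -dForm x y z w := (dFormₗ y z w).map_neg x

lemma quarticOp_apply (p q : VIdx k × VIdx k) :
    quarticOp k p q = dForm (dualVec p.1) (dualVec p.2) (stdVec q.1) (stdVec q.2) := by
  rw [← sum_mul_dForm]
  refine Finset.sum_congr rfl fun s _ => ?_
  rw [← sum_mul_dForm₂, Finset.mul_sum]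
  refine Finset.sum_congr rfl fun t _ => ?_
  rw [dTensor_eq]
  exact mul_assoc _ _ _

lemma quarticOp_mulVec_tensor (x y : V k) (p : VIdx k × VIdx k) :
    (quarticOp k).mulVec (tensor x y) p = dForm (dualVec p.1) (dualVec p.2) x y := by
  simp only [Matrix.mulVec, dotProduct, quarticOp_apply, tensor]
  rw [Fintype.sum_prod_type, ← sum_mul_dForm₃]
  refine Finset.sum_congr rfl fun s _ => ?_
  rw [← sum_mul_dForm₄, Finset.mul_sum]
  exact Finset.sum_congr rfl fun t _ => by ring

/-- Equality of operators on `V ⊗ V` may be tested on basis tensors. -/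
lemma end2_ext {M N : End2 k} (h : ∀ q : VIdx k × VIdx k,
    M.mulVec (tensor (stdVec q.1) (stdVec q.2)) = N.mulVec (tensor (stdVec q.1) (stdVec q.2))) :
    M = N := by
  ext p q
  have := congrFun (h q) p
  simpa [tensor_stdVec] using this

lemma toLin'_isDerivation_iff {X : Matrix (VIdx k) (VIdx k) ℂ} :
    IsDerivation (Matrix.toLin' X) ↔
      (∀ v w, sympl (X.mulVec v) w + sympl v (X.mulVec w) = 0) ∧
      ∀ x y z w, dForm (X.mulVec x) y z w + dForm x (X.mulVec y) z w + dForm x y (X.mulVec z) w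
        + dForm x y z (X.mulVec w) = 0 :=
  ⟨fun h => ⟨h.1, h.2⟩, fun h => ⟨h.1, h.2⟩⟩

lemma mulVec_stdVec (X : Matrix (VIdx k) (VIdx k) ℂ) (p t : VIdx k) :
    X.mulVec (stdVec p) t = X t p := by
  simp [stdVec]

lemma isInfinitesimalSymmetry_iff (X : Matrix (VIdx k) (VIdx k) ℂ) :
    IsInfinitesimalSymmetry X ↔ IsDerivation (Matrix.toLin' X) := by
  rw [toLin'_isDerivation_iff]
  refine and_congr ?_ ?_
  · have h : ∀ v w : V k, sympl (X.mulVec v) w + sympl v (X.mulVec w) =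
        v ⬝ᵥ (X.transpose * J k + J k * X).mulVec w := fun v w => by
      rw [sympl_eq_dotProduct, sympl_eq_dotProduct, Matrix.add_mulVec, dotProduct_add,
        ← Matrix.mulVec_mulVec, ← Matrix.mulVec_mulVec, Matrix.mulVec_transpose,
        dotProduct_comm v (Matrix.vecMul _ _), ← Matrix.dotProduct_mulVec,
        dotProduct_comm _ (X.mulVec v)]
    simp only [h]
    constructor
    · intro h0 v w
      rw [h0, Matrix.zero_mulVec, dotProduct_zero]
    · intro h0
      ext p q
      simpa [stdVec] using h0 (stdVec p) (stdVec q)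
  · have h : ∀ p : Fin 4 → VIdx k,
        ∑ i : Fin 4, ∑ t : VIdx k, X t (p i) * dTensor k (Function.update p i t) =
        dForm (X.mulVec (stdVec (p 0))) (stdVec (p 1)) (stdVec (p 2)) (stdVec (p 3))
        + dForm (stdVec (p 0)) (X.mulVec (stdVec (p 1))) (stdVec (p 2)) (stdVec (p 3))
        + dForm (stdVec (p 0)) (stdVec (p 1)) (X.mulVec (stdVec (p 2))) (stdVec (p 3))
        + dForm (stdVec (p 0)) (stdVec (p 1)) (stdVec (p 2)) (X.mulVec (stdVec (p 3))) := by
      intro p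
      rw [Fin.sum_univ_four, ← sum_mul_dForm, ← sum_mul_dForm₂, ← sum_mul_dForm₃, ← sum_mul_dForm₄]
      simp only [mulVec_stdVec, dTensor_eq]
      simp [Function.update]
    simp only [h]
    constructor
    · intro h0
      let δ := variation (Matrix.toLin' X)
      have hs : IsSymmetricQuadriadditive δ := variation_isSymmetric (Matrix.toLin' X)
      have h0' : ∀ p q r s, δ (stdVec p) (stdVec q) (stdVec r) (stdVec s) = 0 := fun p q r s =>
        h0 ![p, q, r, s]
      -- The structure records additivity only, so linearity in the first slot is exhibited by `f`;
      -- symmetry then brings the other slots into first position one by one.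
      have step : ∀ y z w : V k, (∀ p, δ (stdVec p) y z w = 0) → ∀ x, δ x y z w = 0 := by
        intro y z w h x
        let f : V k →ₗ[ℂ] ℂ := (dFormₗ y z w).comp (Matrix.toLin' X) + dFormₗ (X.mulVec y) z w
          + dFormₗ y (X.mulVec z) w + dFormₗ y z (X.mulVec w)
        change f x = 0
        rw [← sum_smul_stdVec x, map_sum]
        exact Finset.sum_eq_zero fun p _ => by
          rw [map_smul, show f (stdVec p) = 0 from h p, smul_zero]
      have h1 : ∀ q r s x, δ x (stdVec q) (stdVec r) (stdVec s) = 0 := fun q r s x =>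
        step _ _ _ (fun p => h0' p q r s) x
      have h2 : ∀ r s x y, δ x y (stdVec r) (stdVec s) = 0 := fun r s x y =>
        step _ _ _ (fun p => (hs.swap₁ _ _ _ _).trans (h1 p r s y)) x
      have h3 : ∀ s x y z, δ x y z (stdVec s) = 0 := fun s x y z =>
        step _ _ _ (fun p => (hs.swap₁₃ _ _ _ _).trans (h2 p s z y)) x
      exact fun x y z w => step _ _ _ (fun p => (hs.swap₁₄ _ _ _ _).trans (h3 p w y z)) x
    · intro h0 p
      exact h0 _ _ _ _

/-! ### The operators on `V ⊗ V` and their equivariance -/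

lemma swapOp_apply (p q : VIdx k × VIdx k) : swapOp k p q = if p.swap = q then 1 else 0 := by
  simp only [swapOp, Prod.ext_iff, Prod.fst_swap, Prod.snd_swap, and_comm]

lemma swapOp_mulVec (t : VIdx k × VIdx k → ℂ) (p : VIdx k × VIdx k) :
    (swapOp k).mulVec t p = t p.swap := by
  simp only [Matrix.mulVec, dotProduct, swapOp_apply, ite_mul, one_mul, zero_mul,
    Finset.sum_ite_eq, Finset.mem_univ, if_true]

lemma swapOp_mul_apply (M : End2 k) (p q : VIdx k × VIdx k) :
    (swapOp k * M) p q = M p.swap q := by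
  simp only [Matrix.mul_apply, swapOp_apply, ite_mul, one_mul, zero_mul, Finset.sum_ite_eq,
    Finset.mem_univ, if_true]

lemma mul_swapOp_apply (M : End2 k) (p q : VIdx k × VIdx k) :
    (M * swapOp k) p q = M p q.swap := by
  have h : ∀ r : VIdx k × VIdx k, r.swap = q ↔ r = q.swap := fun r => Prod.swap_eq_iff_eq_swap
  simp only [Matrix.mul_apply, swapOp_apply, h, mul_ite, mul_one, mul_zero, Finset.sum_ite_eq',
    Finset.mem_univ, if_true]

lemma swapOp_mul_swapOp : swapOp k * swapOp k = 1 := by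
  ext p q
  rw [swapOp_mul_apply, swapOp_apply, Prod.swap_swap, Matrix.one_apply]

lemma swapOp_mul_quarticOp : swapOp k * quarticOp k = quarticOp k := by
  ext p q
  rw [swapOp_mul_apply, quarticOp_apply, quarticOp_apply]
  exact dForm_isSymmetric.swap₁ _ _ _ _

lemma quarticOp_mul_swapOp : quarticOp k * swapOp k = quarticOp k := by
  ext p q
  rw [mul_swapOp_apply, quarticOp_apply, quarticOp_apply]
  exact dForm_isSymmetric.swap₃ _ _ _ _

lemma J_swap (p q : VIdx k) : J k q p = -J k p q := sympl_swap _ _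

lemma J_inv_swap (p q : VIdx k) : (J k)⁻¹ q p = -(J k)⁻¹ p q := dualVec_apply_swap p q

lemma swapOp_mul_cupCap : swapOp k * cupCap k = -cupCap k := by
  ext p q
  rw [swapOp_mul_apply, Matrix.neg_apply, cupCap, cupCap, Prod.fst_swap, Prod.snd_swap,
    J_inv_swap, neg_mul]

lemma cupCap_mul_swapOp : cupCap k * swapOp k = -cupCap k := by
  ext p q
  rw [mul_swapOp_apply, Matrix.neg_apply, cupCap, cupCap, Prod.fst_swap, Prod.snd_swap, J_swap,
    mul_neg]

lemma cupCap_mul_apply (M : End2 k) (p q : VIdx k × VIdx k) :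
    (cupCap k * M) p q = (J k)⁻¹ p.1 p.2 * ∑ r : VIdx k × VIdx k, J k r.1 r.2 * M r q := by
  simp only [Matrix.mul_apply, cupCap, mul_assoc, Finset.mul_sum]

lemma mul_cupCap_apply (M : End2 k) (p q : VIdx k × VIdx k) :
    (M * cupCap k) p q = (∑ r : VIdx k × VIdx k, M p r * (J k)⁻¹ r.1 r.2) * J k q.1 q.2 := by
  simp only [Matrix.mul_apply, cupCap, ← mul_assoc, Finset.sum_mul]

lemma card_VIdx : Fintype.card (VIdx k) = 6 * 2 ^ k + 8 := by
  simp [VIdx, HermIdx]; ring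

/-- The closed loop is the trace of $JJ^{-1}$, the dimension of $V$, with a sign from the
antisymmetry of $J^{-1}$. -/
lemma cupCap_mul_cupCap : cupCap k * cupCap k = -((6 * m k + 8) • cupCap k) := by
  have h : ∑ r : VIdx k × VIdx k, J k r.1 r.2 * (J k)⁻¹ r.1 r.2 = -(6 * m k + 8) := by
    have h1 : Matrix.trace (J k * (J k)⁻¹) = 6 * m k + 8 := by
      rw [Matrix.mul_nonsing_inv _ isUnit_det_J, Matrix.trace_one, card_VIdx, m]
      push_cast; rfl
    rw [← h1, Matrix.trace, Fintype.sum_prod_type, ← Finset.sum_neg_distrib]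
    refine Finset.sum_congr rfl fun p _ => ?_
    rw [Matrix.diag_apply, Matrix.mul_apply, ← Finset.sum_neg_distrib]
    exact Finset.sum_congr rfl fun q _ => by rw [J_inv_swap p q]; ring
  ext p q
  rw [cupCap_mul_apply]
  simp only [cupCap, ← mul_assoc, mul_comm _ ((J k)⁻¹ _ _), Matrix.neg_apply, Matrix.smul_apply,
    smul_eq_mul]
  rw [← Finset.sum_mul]
  simp only [mul_comm ((J k)⁻¹ _ _) (J k _ _), h]
  ring

lemma sum_eq_zero_of_swap (f : VIdx k × VIdx k → ℂ) (h : ∀ p, f p.swap = -f p) : ∑ p, f p = 0 := by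
  have h1 := (Equiv.prodComm (VIdx k) (VIdx k)).sum_comp f
  simp only [Equiv.prodComm_apply, h, Finset.sum_neg_distrib] at h1
  linear_combination -h1 / 2

lemma cupCap_mul_quarticOp : cupCap k * quarticOp k = 0 := by
  ext p q
  rw [cupCap_mul_apply, sum_eq_zero_of_swap, mul_zero, Matrix.zero_apply]
  intro r
  rw [quarticOp_apply, quarticOp_apply, Prod.fst_swap, Prod.snd_swap, J_swap,
    dForm_isSymmetric.swap₁, neg_mul]

lemma quarticOp_mul_cupCap : quarticOp k * cupCap k = 0 := by
  ext p q
  rw [mul_cupCap_apply, sum_eq_zero_of_swap, zero_mul, Matrix.zero_apply]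
  intro r
  rw [quarticOp_apply, quarticOp_apply, Prod.fst_swap, Prod.snd_swap, J_inv_swap,
    dForm_isSymmetric.swap₃, mul_neg]

lemma swapOp_mul_diagAct (X : Matrix (VIdx k) (VIdx k) ℂ) :
    swapOp k * diagAct X = diagAct X * swapOp k := by
  refine end2_ext fun q => ?_
  funext p
  rw [← Matrix.mulVec_mulVec, ← Matrix.mulVec_mulVec, swapOp_mulVec, diagAct_mulVec, diagAct_mulVec,
    add_comm]
  simp only [swapOp_mulVec, Prod.fst_swap, Prod.snd_swap, Prod.swap_prod_mk]

lemma quarticOp_mul_diagAct {X : Matrix (VIdx k) (VIdx k) ℂ}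
    (hX : IsDerivation (Matrix.toLin' X)) :
    quarticOp k * diagAct X = diagAct X * quarticOp k := by
  rw [toLin'_isDerivation_iff] at hX
  refine end2_ext fun q => ?_
  funext p
  have h1 := sum_apply_smul_dualVec hX.1
  have h := hX.2 (dualVec p.1) (dualVec p.2) (stdVec q.1) (stdVec q.2)
  rw [← Matrix.mulVec_mulVec, ← Matrix.mulVec_mulVec, diagAct_mulVec, diagAct_mulVec_tensor,
    Matrix.mulVec_add, Pi.add_apply]
  simp only [quarticOp_mulVec_tensor, dForm_isSymmetric.swap₁ (dualVec p.1)]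
  rw [← dForm_sum_smul, ← dForm_sum_smul, h1, h1, dForm_neg, dForm_neg,
    dForm_isSymmetric.swap₁ (Matrix.mulVec X (dualVec p.2))]
  simp only [dForm_isSymmetric.swap₁ (dualVec p.2)]
  linear_combination h

/-- The operator `3 (1 + P) + D`, a multiple of `P₃`. -/
def symOp (k : ℕ) : End2 k := (3 : ℂ) • (1 + swapOp k) + quarticOp k

lemma symOp_mul_diagAct {X : Matrix (VIdx k) (VIdx k) ℂ} (hX : IsDerivation (Matrix.toLin' X)) :
    symOp k * diagAct X = diagAct X * symOp k := by
  simp only [symOp, add_mul, mul_add, smul_add, smul_mul_assoc, mul_smul_comm, one_mul, mul_one,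
    swapOp_mul_diagAct, quarticOp_mul_diagAct hX]

/-! ### The range of `3 (1 + P) + D` consists of infinitesimal symmetries -/

lemma dForm_sub (x x' y z w : V k) : dForm (x - x') y z w = dForm x y z w - dForm x' y z w :=
  (dFormₗ y z w).map_sub x x'

lemma IsDerivation.lie {X Y : V k →ₗ[ℂ] V k} (hX : IsDerivation X) (hY : IsDerivation Y) :
    IsDerivation (X ∘ₗ Y - Y ∘ₗ X) where
  sympl v w := by
    have h1 := hX.sympl (Y v) w
    have h2 := hX.sympl v (Y w)
    have h3 := hY.sympl (X v) w
    have h4 := hY.sympl v (X w)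
    change symplₗ k (X (Y v) - Y (X v)) w + symplₗ k v (X (Y w) - Y (X w)) = 0
    rw [map_sub, map_sub, LinearMap.sub_apply]
    change ESeven.sympl (X (Y v)) w - ESeven.sympl (Y (X v)) w
      + (ESeven.sympl v (X (Y w)) - ESeven.sympl v (Y (X w))) = 0
    linear_combination h1 + h2 - h3 - h4
  dForm x y z w := by
    have hd := dForm_isSymmetric (k := k)
    simp only [LinearMap.sub_apply, LinearMap.comp_apply]
    rw [hd.swap₁ x (X (Y y) - _), hd.swap₁₃ x y (X (Y z) - _), hd.swap₁₄ x y z (X (Y w) - _),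
      dForm_sub, dForm_sub, dForm_sub, dForm_sub, hd.swap₁ _ x, hd.swap₁ _ x, hd.swap₁₃ _ y x,
      hd.swap₁₃ _ y x, hd.swap₁₄ _ y z x, hd.swap₁₄ _ y z x]
    linear_combination hX.dForm (Y x) y z w + hX.dForm x (Y y) z w + hX.dForm x y (Y z) w
      + hX.dForm x y z (Y w) - hY.dForm (X x) y z w - hY.dForm x (X y) z w
      - hY.dForm x y (X z) w - hY.dForm x y z (X w)

/-- The Lie algebra of infinitesimal symmetries as a space of matrices. -/
def derivations (k : ℕ) : Submodule ℂ (Matrix (VIdx k) (VIdx k) ℂ) where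
  carrier := {X | IsDerivation (Matrix.toLin' X)}
  zero_mem' := ⟨fun v w => by
      change (symplₗ k (Matrix.toLin' 0 v) w) + symplₗ k v (Matrix.toLin' 0 w) = 0
      simp,
    fun x y z w => by
      have hd := dForm_isSymmetric (k := k)
      have h0 : ∀ y z w : V k, dForm 0 y z w = 0 := fun y z w => (dFormₗ y z w).map_zero
      simp only [map_zero, LinearMap.zero_apply]
      rw [hd.swap₁ x, hd.swap₁₃ x, hd.swap₁₄ x]
      simp [h0]⟩
  add_mem' {X Y} hX hY := ⟨fun v w => by
      have h1 := hX.1 v w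
      have h2 := hY.1 v w
      simp only [map_add, LinearMap.add_apply, sympl_add_left, sympl_add_right]
      linear_combination h1 + h2,
    fun x y z w => by
      have hd := dForm_isSymmetric (k := k)
      have h1 := hX.2 x y z w
      have h2 := hY.2 x y z w
      simp only [map_add, LinearMap.add_apply, hd.add, hd.add₂, hd.add₃, hd.add₄]
      linear_combination h1 + h2⟩
  smul_mem' c X hX := ⟨fun v w => by
      have h1 := hX.1 v w
      simp only [map_smul, LinearMap.smul_apply, sympl_smul_left, sympl_smul_right]
      linear_combination c * h1,
    fun x y z w => by
      have hd := dForm_isSymmetric (k := k)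
      have h1 := hX.2 x y z w
      simp only [map_smul, LinearMap.smul_apply]
      rw [hd.swap₁ x (c • _), hd.swap₁₃ x y (c • _), hd.swap₁₄ x y z (c • _), dForm_smul,
        dForm_smul, dForm_smul, dForm_smul, hd.swap₁ _ x, hd.swap₁₃ _ y x, hd.swap₁₄ _ y z x]
      linear_combination c * h1⟩

lemma mem_derivations {X : Matrix (VIdx k) (VIdx k) ℂ} :
    X ∈ derivations k ↔ IsDerivation (Matrix.toLin' X) := Iff.rfl

/-- The matrix `t^{ab} J_{bc}` attached to a tensor. -/
def lowered (k : ℕ) : (VIdx k × VIdx k → ℂ) →ₗ[ℂ] Matrix (VIdx k) (VIdx k) ℂ where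
  toFun t := Matrix.of (fun a b => t (a, b)) * J k
  map_add' s t := by rw [← add_mul]; rfl
  map_smul' c t := by rw [RingHom.id_apply, ← smul_mul_assoc]; rfl

lemma lowered_mulVec (t : VIdx k × VIdx k → ℂ) (v : V k) (p : VIdx k) :
    (lowered k t).mulVec v p = ∑ q, t (p, q) * sympl (stdVec q) v := by
  change (Matrix.of (fun a b => t (a, b)) * J k).mulVec v p = _
  rw [← Matrix.mulVec_mulVec]
  simp only [Matrix.mulVec, dotProduct, Matrix.of_apply]
  exact Finset.sum_congr rfl fun q _ => by rw [← J_mulVec]; rfl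

lemma lowered_diagAct {X : Matrix (VIdx k) (VIdx k) ℂ} (hX : IsDerivation (Matrix.toLin' X))
    (t : VIdx k × VIdx k → ℂ) :
    lowered k ((diagAct X).mulVec t) = X * lowered k t - lowered k t * X := by
  have h1 : Matrix.of (fun a b => (diagAct X).mulVec t (a, b)) =
      X * Matrix.of (fun a b => t (a, b)) + Matrix.of (fun a b => t (a, b)) * X.transpose := by
    ext a b
    rw [Matrix.of_apply, diagAct_mulVec, Matrix.add_apply, Matrix.mul_apply, Matrix.mul_apply]
    congr 1
    exact Finset.sum_congr rfl fun s _ => mul_comm _ _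
  have h2 : X.transpose * J k = -(J k * X) :=
    eq_neg_of_add_eq_zero_left ((isInfinitesimalSymmetry_iff X).2 hX).1
  change Matrix.of (fun a b => (diagAct X).mulVec t (a, b)) * J k =
    X * (Matrix.of (fun a b => t (a, b)) * J k) - Matrix.of (fun a b => t (a, b)) * J k * X
  rw [h1, add_mul, mul_assoc, mul_assoc, h2, mul_neg, mul_assoc, sub_eq_add_neg]

lemma lowered_symOp_tensor_mulVec (x y v : V k) (p : VIdx k) :
    (lowered k ((symOp k).mulVec (tensor x y))).mulVec v p =
      3 * (sympl y v * x p + sympl x v * y p) - dForm (dualVec p) v x y := by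
  have h1 : ∀ q, (symOp k).mulVec (tensor x y) (p, q) =
      3 * (x p * y q + y p * x q) + dForm (dualVec p) (dualVec q) x y := fun q => by
    rw [symOp, Matrix.add_mulVec, Matrix.smul_mulVec, Matrix.add_mulVec, Matrix.one_mulVec]
    simp only [Pi.add_apply, Pi.smul_apply, smul_eq_mul, swapOp_mulVec, quarticOp_mulVec_tensor,
      tensor, Prod.fst_swap, Prod.snd_swap]
    ring
  have h2 : ∑ q, dForm (dualVec p) (dualVec q) x y * sympl (stdVec q) v =
      -dForm (dualVec p) v x y := by
    rw [dForm_isSymmetric.swap₁ _ v, ← dForm_neg, ← sum_sympl_smul_dualVec, dForm_sum_smul]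
    exact Finset.sum_congr rfl fun q _ => by rw [dForm_isSymmetric.swap₁, mul_comm]
  rw [lowered_mulVec]
  simp only [h1, add_mul, Finset.sum_add_distrib, h2]
  rw [sympl_eq_sum_left y, sympl_eq_sum_left x, sub_eq_add_neg]
  congr 1
  simp only [Finset.sum_mul, Finset.mul_sum, ← Finset.sum_add_distrib]
  exact Finset.sum_congr rfl fun q _ => by ring

/-- The linear map `v ↦ dForm · v high low`, expressed by the symplectic form. -/
def gradeQuartic (v : V k) : V k :=
  V.mk (6 * v.a) (-6 * v.b) ((-3 : ℂ) • v.A) ((3 : ℂ) • v.B)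

lemma dForm_high_low (z v : V k) : dForm z v (V.high k) (V.low k) = sympl z (gradeQuartic v) := by
  simp only [dForm, sympl, gradeQuartic, V.high, V.low, pairing, V.a_mk, V.b_mk, V.A_mk, V.B_mk,
    cross_zero_right, form_zero_left, form_zero_right, form_smul_right, form_comm v.A z.B]
  ring

/-- The grading operator. -/
def grading (k : ℕ) : V k →ₗ[ℂ] V k where
  toFun v := V.mk (-9 * v.a) (9 * v.b) ((3 : ℂ) • v.A) ((-3 : ℂ) • v.B)
  map_add' v w := V.ext_parts (by simp; ring) (by simp; ring) (by simp) (by simp)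
  map_smul' c v := V.ext_parts (by simp; ring) (by simp; ring) (by simp [smul_smul]; ring_nf)
    (by simp [smul_smul]; ring_nf)

lemma isDerivation_grading : IsDerivation (grading k) := by
  refine .of_diag (fun v w => ?_) fun v => ?_
  · simp only [grading, LinearMap.coe_mk, AddHom.coe_mk, sympl, V.a_mk, V.b_mk, V.A_mk, V.B_mk,
      form_smul_left, form_smul_right]
    ring
  · have hA := form_cross_self v.A
    have hB := form_cross_self v.B
    simp only [cross_self, form_smul_left] at hA hB
    simp only [grading, LinearMap.coe_mk, AddHom.coe_mk, dForm_diag, pairing, V.a_mk, V.b_mk,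
      V.A_mk, V.B_mk, cross_smul_right, cross_self, form_smul_left, form_smul_right]
    linear_combination -54 * v.a * hA + 54 * v.b * hB

/-- The part $3(1+P)$ acts only on the two extreme lines and the quartic part is diagonal; together
they give the weights −9, 9, 3, −3. -/
lemma lowered_symOp_high_low :
    Matrix.toLin' (lowered k ((symOp k).mulVec (tensor (V.high k) (V.low k)))) = grading k := by
  refine LinearMap.ext fun (v : V k) => funext fun p => ?_
  rw [Matrix.toLin'_apply, lowered_symOp_tensor_mulVec, dForm_high_low, sympl_dualVec]
  have h1 : sympl (V.low k) v = -v.a := by simp [sympl, V.low]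
  have h2 : sympl (V.high k) v = v.b := by simp [sympl, V.high]
  rw [h1, h2]
  have h : (3 : ℂ) • (-v.a • V.high k + v.b • V.low k) - gradeQuartic v = grading k v := by
    rw [sub_eq_add_neg, ← neg_one_smul ℂ (gradeQuartic v)]
    refine V.ext_parts ?_ ?_ ?_ ?_ <;> simp [V.high, V.low, gradeQuartic, grading] <;> ring
  exact congrFun h p

/-- The range of `3 (1 + P) + D` consists of infinitesimal symmetries. -/
theorem isDerivation_lowered_symOp (hk : k ≤ 3) (t : VIdx k × VIdx k → ℂ) :
    IsDerivation (Matrix.toLin' (lowered k ((symOp k).mulVec t))) := by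
  -- The tensors whose image lies in the Lie algebra form a stable subspace: by equivariance the
  -- diagonal action of a symmetry becomes a commutator with it.
  have h := eq_top_of_tensor_mem hk
    ((derivations k).comap ((lowered k).comp (symOp k).mulVecLin))
    (by
      rw [Submodule.mem_comap, mem_derivations]
      change IsDerivation (Matrix.toLin' (lowered k ((symOp k).mulVec _)))
      rw [lowered_symOp_high_low]
      exact isDerivation_grading)
    (fun X hX t ht => by
      rw [Submodule.mem_comap, mem_derivations] at ht ⊢
      change IsDerivation (Matrix.toLin' (lowered k ((symOp k).mulVec _)))
      rw [Matrix.mulVec_mulVec, symOp_mul_diagAct hX, ← Matrix.mulVec_mulVec, lowered_diagAct hX,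
        map_sub, Matrix.toLin'_mul, Matrix.toLin'_mul]
      exact hX.lie ht)
  exact Submodule.eq_top_iff'.1 h t

/-! ### The quadratic relation of the quartic operator -/

lemma stdVec_high : stdVec (false, Sum.inl ()) = V.high k := by
  funext p
  rcases p with ⟨_ | _, _ | i⟩ <;> simp [stdVec, V.high, V.mk]

lemma stdVec_low : stdVec (true, Sum.inl ()) = V.low k := by
  funext p
  rcases p with ⟨_ | _, _ | i⟩ <;> simp [stdVec, V.low, V.mk]

lemma stdVec_A (i : HermIdx k) : stdVec (false, Sum.inr i) = V.mk 0 0 (Pi.single i 1) 0 := by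
  funext p
  rcases p with ⟨_ | _, _ | j⟩ <;> simp [stdVec, V.mk, Pi.single_apply]

lemma stdVec_B (i : HermIdx k) : stdVec (true, Sum.inr i) = V.mk 0 0 0 (Pi.single i 1) := by
  funext p
  rcases p with ⟨_ | _, _ | j⟩ <;> simp [stdVec, V.mk, Pi.single_apply]

lemma dualVec_high : dualVec (false, Sum.inl ()) = (-1 : ℂ) • V.low k :=
  dualVec_eq fun v => by rw [sympl_smul_left]; simp [sympl, V.low]; rfl

lemma dualVec_low : dualVec (true, Sum.inl ()) = V.high k :=
  dualVec_eq fun v => by simp [sympl, V.high]; rfl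

lemma dualVec_A (i : HermIdx k) :
    dualVec (false, Sum.inr i) = (-weight i) • V.mk 0 0 0 (Pi.single i 1) :=
  dualVec_eq fun v => by
    rw [sympl_smul_left]
    simp only [sympl, V.a_mk, V.b_mk, V.A_mk, V.B_mk, form_zero_left, form_comm _ v.A]
    change _ = v.A i
    rw [← form_single v.A i]
    ring

lemma dualVec_B (i : HermIdx k) :
    dualVec (true, Sum.inr i) = weight i • V.mk 0 0 (Pi.single i 1) 0 :=
  dualVec_eq fun v => by
    rw [sympl_smul_left]
    simp only [sympl, V.a_mk, V.b_mk, V.A_mk, V.B_mk, form_zero_left, form_comm _ v.B]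
    change _ = v.B i
    rw [← form_single v.B i]
    ring

lemma gradeQuartic_smul (c : ℂ) (v : V k) : gradeQuartic (c • v) = c • gradeQuartic v := by
  refine V.ext_parts ?_ ?_ ?_ ?_ <;> simp [gradeQuartic, smul_smul] <;> ring_nf

lemma sum_VIdx (f : VIdx k → ℂ) : ∑ p, f p = f (false, Sum.inl ()) + f (true, Sum.inl ())
    + (∑ i, f (false, Sum.inr i) + ∑ i, f (true, Sum.inr i)) := by
  rw [Fintype.sum_prod_type, Fintype.sum_bool, Fintype.sum_sum_type (fun x => f (false, x)),
    Fintype.sum_sum_type (fun x => f (true, x))]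
  simp only [Fintype.sum_unique]
  change f (true, Sum.inl ()) + _ + (f (false, Sum.inl ()) + _) = _
  ring

/-- The contraction of the quartic form with the tensor dual to `V.A ⊗ V.B`. -/
lemma sum_weight_mul_dForm (hk : k ≤ 3) (z w : V k) :
    ∑ i : HermIdx k, weight i * dForm z w (V.mk 0 0 (Pi.single i 1) 0)
      (V.mk 0 0 0 (Pi.single i 1)) =
    6 * (m k + 2) * (z.A.form w.B + w.A.form z.B) + 3 * (3 * m k + 3) * pairing z w
      - 3 * (z.A.form w.B + w.A.form z.B) := by
  have h : ∀ X : Herm k, dForm z w (V.mk 0 0 X 0) (V.mk 0 0 0 X) =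
      6 * (form (cross z.A X) (cross w.B X) + form (cross w.A X) (cross z.B X))
      + 3 * (pairing z w * form X X)
      - 3 * (form z.B X * form w.A X + form z.A X * form w.B X) := fun X => by
    simp only [dForm, pairing, V.a_mk, V.b_mk, V.A_mk, V.B_mk, cross_zero_left, cross_zero_right,
      form_zero_left, form_zero_right, form_comm X z.B, form_comm X w.B]
    ring
  have e : ∀ i : HermIdx k, weight i * dForm z w (V.mk 0 0 (Pi.single i 1) 0)
        (V.mk 0 0 0 (Pi.single i 1)) =
      6 * (weight i * form (cross z.A (Pi.single i 1)) (cross w.B (Pi.single i 1)))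
      + 6 * (weight i * form (cross w.A (Pi.single i 1)) (cross z.B (Pi.single i 1)))
      + 3 * pairing z w * (weight i * form (Pi.single i 1 : Herm k) (Pi.single i 1))
      - 3 * (weight i * (form z.B (Pi.single i 1) * form w.A (Pi.single i 1)))
      - 3 * (weight i * (form z.A (Pi.single i 1) * form w.B (Pi.single i 1))) := fun i => by
    rw [h]; ring
  simp only [e, Finset.sum_sub_distrib, Finset.sum_add_distrib, ← Finset.mul_sum]
  rw [sum_weight_mul_form_cross_cross hk, sum_weight_mul_form_cross_cross hk,
    sum_weight_mul_form_self, sum_form_mul_form, sum_form_mul_form, form_comm z.B]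
  ring

/-- The inner $D$ applied to high ⊗ low is diagonal, so the double contraction collapses to one sum
over a basis of $V$. The extreme lines return multiples of $D$(high ⊗ low), and the two Jordan
summands return the trace in `sum_weight_mul_dForm`. -/
lemma quarticOp_quarticOp_high_low (hk : k ≤ 3) (p : VIdx k × VIdx k) :
    (quarticOp k * quarticOp k).mulVec (tensor (V.high k) (V.low k)) p =
      6 * (m k + 2) * (quarticOp k).mulVec (tensor (V.high k) (V.low k)) p
      + 18 * (m k + 3) * (tensor (V.high k) (V.low k) p + tensor (V.high k) (V.low k) p.swap) := by
  have hd := dForm_isSymmetric (k := k)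
  have h1 : (quarticOp k * quarticOp k).mulVec (tensor (V.high k) (V.low k)) p =
      ∑ s, dForm (dualVec p.1) (dualVec p.2) (gradeQuartic (dualVec s)) (stdVec s) := by
    rw [← Matrix.mulVec_mulVec, Matrix.mulVec, dotProduct, Fintype.sum_prod_type_right]
    refine Finset.sum_congr rfl fun s _ => ?_
    rw [← sum_mul_dForm₃]
    refine Finset.sum_congr rfl fun r _ => ?_
    rw [quarticOp_apply, quarticOp_mulVec_tensor, dForm_high_low, sympl_dualVec, mul_comm]
  have hsmul : ∀ (c : ℂ) (x y z w : V k), dForm x y (c • z) w = c * dForm x y z w :=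
    fun c x y z w => by rw [hd.swap₁₃, dForm_smul, hd.swap₁₃]
  rw [h1, quarticOp_mulVec_tensor, sum_VIdx]
  have ht : ∀ q : VIdx k × VIdx k, tensor (V.high k) (V.low k) q =
      sympl (dualVec q.1) (V.high k) * sympl (dualVec q.2) (V.low k) := fun q => by
    rw [sympl_dualVec, sympl_dualVec]; rfl
  rw [ht, ht, Prod.fst_swap, Prod.snd_swap]
  generalize dualVec p.1 = z
  generalize dualVec p.2 = w
  have eA : ∀ i : HermIdx k, gradeQuartic (V.mk 0 0 0 (Pi.single i 1)) =
      (3 : ℂ) • V.mk 0 0 0 (Pi.single i 1) := fun i => by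
    refine V.ext_parts ?_ ?_ ?_ ?_ <;> simp [gradeQuartic]
  have eB : ∀ i : HermIdx k, gradeQuartic (V.mk 0 0 (Pi.single i 1) 0) =
      (-3 : ℂ) • V.mk 0 0 (Pi.single i 1) 0 := fun i => by
    refine V.ext_parts ?_ ?_ ?_ ?_ <;> simp [gradeQuartic]
  have el : gradeQuartic (V.low k) = (-6 : ℂ) • V.low k := by
    refine V.ext_parts ?_ ?_ ?_ ?_ <;> simp [gradeQuartic, V.low]
  have eh : gradeQuartic (V.high k) = (6 : ℂ) • V.high k := by
    refine V.ext_parts ?_ ?_ ?_ ?_ <;> simp [gradeQuartic, V.high]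
  have hs := sum_weight_mul_dForm hk z w
  have hA : ∀ i : HermIdx k, dForm z w ((-weight i) • (3 : ℂ) • V.mk 0 0 0 (Pi.single i 1))
      (V.mk 0 0 (Pi.single i 1) 0) = -3 * (weight i * dForm z w (V.mk 0 0 (Pi.single i 1) 0)
      (V.mk 0 0 0 (Pi.single i 1))) := fun i => by
    rw [hsmul, hsmul, hd.swap₃]; ring
  have hB : ∀ i : HermIdx k, dForm z w (weight i • (-3 : ℂ) • V.mk 0 0 (Pi.single i 1) 0)
      (V.mk 0 0 0 (Pi.single i 1)) = -3 * (weight i * dForm z w (V.mk 0 0 (Pi.single i 1) 0)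
      (V.mk 0 0 0 (Pi.single i 1))) := fun i => by
    rw [hsmul, hsmul]; ring
  simp only [dualVec_high, dualVec_low, dualVec_A, dualVec_B, stdVec_high, stdVec_low, stdVec_A,
    stdVec_B, gradeQuartic_smul, eA, eB, el, eh, hA, hB, ← Finset.mul_sum, hs]
  rw [hsmul, hsmul, hsmul, hd.swap₃ z w (V.low k), dForm_high_low]
  simp only [sympl, pairing, gradeQuartic, V.high, V.low, V.a_mk, V.b_mk, V.A_mk, V.B_mk,
    form_zero_right, form_smul_right, form_comm w.A z.B]
  ring

/-- The quadratic relation of the quartic operator. -/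
theorem quarticOp_mul_quarticOp (hk : k ≤ 3) :
    quarticOp k * quarticOp k =
      (6 * (m k + 2)) • quarticOp k + (18 * (m k + 3)) • (1 + swapOp k) := by
  let E : End2 k := quarticOp k * quarticOp k -
    ((6 * (m k + 2)) • quarticOp k + (18 * (m k + 3)) • (1 + swapOp k))
  have h := eq_top_of_tensor_mem hk (LinearMap.ker E.mulVecLin)
    (by
      rw [LinearMap.mem_ker]
      funext p
      change E.mulVec _ p = 0
      simp only [E, Matrix.sub_mulVec, Matrix.add_mulVec, Matrix.smul_mulVec, Matrix.one_mulVec,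
        Pi.sub_apply, Pi.add_apply, Pi.smul_apply, smul_eq_mul, swapOp_mulVec,
        quarticOp_quarticOp_high_low hk]
      ring)
    (fun X hX t ht => by
      rw [LinearMap.mem_ker] at ht ⊢
      change E.mulVec _ = 0
      change E.mulVec _ = 0 at ht
      have hE : E * diagAct X = diagAct X * E := by
        have hD := quarticOp_mul_diagAct hX
        simp only [E, sub_mul, mul_sub, add_mul, mul_add, smul_mul_assoc, mul_smul_comm, one_mul,
          mul_one, swapOp_mul_diagAct, hD]
        rw [mul_assoc, hD, ← mul_assoc, hD, mul_assoc]
      rw [Matrix.mulVec_mulVec, hE, ← Matrix.mulVec_mulVec, ht, Matrix.mulVec_zero])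
  refine sub_eq_zero.1 (end2_ext (M := E) (N := 0) fun q => ?_)
  rw [Matrix.zero_mulVec]
  exact Submodule.eq_top_iff'.1 h _

/-! ### The Yang–Baxter equation in an abstract algebra -/

section Abstract

section Ring

variable {A : Type*} [Ring A]

/-- The involution `g` exchanges `u` and `v`. -/
def Exchanges (g u v : A) : Prop := g * u = v * g ∧ g * v = u * g

lemma mul_mul_of_eq {u v w : A} (h : u * v = w) (t : A) : t * u * v = t * w := by
  rw [mul_assoc, h]

lemma conj_eq {g u v : A} (hg : g * g = 1) (h : Exchanges g u v) : g * u * g = v := by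
  rw [h.1, mul_assoc, hg, mul_one]

/-- Conjugation of a product relation by an involution. -/
lemma conj_rel {g u v w u' v' w' : A} (hg : g * g = 1) (hu : Exchanges g u u')
    (hv : Exchanges g v v') (hw : Exchanges g w w') (h : u * v = -(u * w)) :
    u' * v' = -(u' * w') := by
  have h1 : u' * v' = g * (u * v) * g := by
    rw [← conj_eq hg hu, ← conj_eq hg hv, show g * u * g * (g * v * g) = g * u * (g * g) * v * g by
      noncomm_ring, hg]
    noncomm_ring
  have h2 : u' * w' = g * (u * w) * g := by
    rw [← conj_eq hg hu, ← conj_eq hg hw, show g * u * g * (g * w * g) = g * u * (g * g) * w * g by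
      noncomm_ring, hg]
    noncomm_ring
  rw [h1, h2, h]
  noncomm_ring

lemma conj_rel' {g u v w u' v' w' : A} (hg : g * g = 1) (hu : Exchanges g u u')
    (hv : Exchanges g v v') (hw : Exchanges g w w') (h : v * u = -(w * u)) :
    v' * u' = -(w' * u') := by
  have h1 : v' * u' = g * (v * u) * g := by
    rw [← conj_eq hg hu, ← conj_eq hg hv, show g * v * g * (g * u * g) = g * v * (g * g) * u * g by
      noncomm_ring, hg]
    noncomm_ring
  have h2 : w' * u' = g * (w * u) * g := by
    rw [← conj_eq hg hu, ← conj_eq hg hw, show g * w * g * (g * u * g) = g * w * (g * g) * u * g by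
      noncomm_ring, hg]
    noncomm_ring
  rw [h1, h2, h]
  noncomm_ring

lemma exchanges_self {g u : A} (h : g * u = u * g) : Exchanges g u u := ⟨h, h⟩

end Ring

variable {A : Type*} [Ring A] [Algebra ℂ A]

/-- The relations between the flip `p`, the contraction `x` and the Casimir operator `a`
on two tensor factors, for the parameter `m`. -/
structure TwoStrand (m : ℂ) (p x a : A) : Prop where
  pp : p * p = 1
  px : p * x = -x
  xp : x * p = -x
  xx : x * x = -((6 * m + 8) • x)
  pa : p * a = a + (3 : ℂ) • p + (6 : ℂ) • x - (3 : ℂ) • 1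
  ap : a * p = a + (3 : ℂ) • p + (6 : ℂ) • x - (3 : ℂ) • 1
  xa : x * a = (18 * m + 27) • x
  ax : a * x = (18 * m + 27) • x
  aa : a * a = (6 * (m + 1)) • a + (36 * (m + 2)) • (p - x) + (18 * m + 63) • (1 : A)

/-- The relations on three tensor factors: `(p, x, a)`, `(q, y, b)`, `(r, z, c)` act on the
factors `12`, `13`, `23`. -/
structure ThreeStrand (m : ℂ) (p q r x y z a b c : A) : Prop where
  s₁₂ : TwoStrand m p x a
  s₁₃ : TwoStrand m q y b
  s₂₃ : TwoStrand m r z c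
  pqr : Exchanges p q r
  qpr : Exchanges q p r
  rpq : Exchanges r p q
  pyz : Exchanges p y z
  qxz : Exchanges q x z
  rxy : Exchanges r x y
  pbc : Exchanges p b c
  qac : Exchanges q a c
  rab : Exchanges r a b
  xy : x * y = -(x * r)
  yx : y * x = -(y * r)
  xb : x * b = -(x * c)
  bx : b * x = -(c * x)
  comm : a * b + a * c = b * a + c * a

namespace ThreeStrand

variable {m : ℂ} {p q r x y z a b c : A}

-- All three-letter words are rewritten into a common normal form, which leaves rational identities
-- in $m,u,v$. The longest word, $abc$, is the only one that the quadratic relations do not reach;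
-- `cubic` settles it.
set_option maxHeartbeats 4000000 in
theorem yang_baxter_core (H : ThreeStrand m p q r x y z a b c) {u v : ℂ}
    (hu : 2 * m + 2 - u ≠ 0) (hv : 2 * m + 2 - v ≠ 0) (hw : 2 * m + 2 - (u + v) ≠ 0) :
    ((v * (v - (m + 1))) • 1 + (2 * m + 4) • p + ((2 * m + 4) * v / (2 * m + 2 - v)) • x
      + (v / 3) • a)
    * (((u + v) * ((u + v) - (m + 1))) • 1 + (2 * m + 4) • q
      + ((2 * m + 4) * (u + v) / (2 * m + 2 - (u + v))) • y + ((u + v) / 3) • b)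
    * ((u * (u - (m + 1))) • 1 + (2 * m + 4) • r + ((2 * m + 4) * u / (2 * m + 2 - u)) • z
      + (u / 3) • c) =
    ((u * (u - (m + 1))) • 1 + (2 * m + 4) • r + ((2 * m + 4) * u / (2 * m + 2 - u)) • z
      + (u / 3) • c)
    * (((u + v) * ((u + v) - (m + 1))) • 1 + (2 * m + 4) • q
      + ((2 * m + 4) * (u + v) / (2 * m + 2 - (u + v))) • y + ((u + v) / 3) • b)
    * ((v * (v - (m + 1))) • 1 + (2 * m + 4) • p + ((2 * m + 4) * v / (2 * m + 2 - v)) • x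
      + (v / 3) • a) := by
  obtain ⟨⟨pp, px, xp, xx, pa, ap, xa, ax, aa⟩, ⟨qq, qy, yq, yy, qb, bq, yb, by', bb⟩,
    ⟨rr, rz, zr, zz, rc, cr, zc, cz, cc⟩, ⟨pq, pr⟩, ⟨qp, qr⟩, ⟨rp, rq⟩, ⟨py, pz⟩, ⟨qx, qz⟩,
    ⟨rx, ry⟩, ⟨pb, pc⟩, ⟨qa, qc⟩, ⟨ra, rb⟩, xy, yx, xb, bx, comm⟩ := H
  have ep : Exchanges p x x := exchanges_self (px.trans xp.symm)
  have eq' : Exchanges q y y := exchanges_self (qy.trans yq.symm)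
  have er : Exchanges r z z := exchanges_self (rz.trans zr.symm)
  have ec : Exchanges r c c := exchanges_self (rc.trans cr.symm)
  have ea : Exchanges p a a := exchanges_self (pa.trans ap.symm)
  have eb : Exchanges q b b := exchanges_self (qb.trans bq.symm)
  -- Relations are assumed for one pair of strands only; conjugation by the flips gives the
  -- remaining ones.
  have xz : x * z = -(x * q) := conj_rel pp ep ⟨py, pz⟩ ⟨pr, pq⟩ xy
  have zx : z * x = -(z * q) := conj_rel pp ⟨py, pz⟩ ep ⟨pr, pq⟩ yx
  have yz : y * z = -(y * p) := conj_rel rr ⟨rx, ry⟩ er ⟨rq, rp⟩ xz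
  have zy : z * y = -(z * p) := conj_rel rr er ⟨rx, ry⟩ ⟨rq, rp⟩ zx
  have ya : y * a = -(y * c) := conj_rel rr ⟨rx, ry⟩ ⟨rb, ra⟩ ec xb
  have ay : a * y = -(c * y) := conj_rel' rr ⟨rx, ry⟩ ⟨rb, ra⟩ ec bx
  have za : z * a = -(z * b) := conj_rel pp ⟨py, pz⟩ ea ⟨pc, pb⟩ ya
  have az : a * z = -(b * z) := conj_rel' pp ⟨py, pz⟩ ea ⟨pc, pb⟩ ay
  have comm' : c * a + c * b = a * c + b * c := by
    have h1 : ∀ w w' : A, q * (w * w') * q = (q * w * q) * (q * w' * q) := fun w w' => by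
      rw [show (q * w * q) * (q * w' * q) = q * w * (q * q) * w' * q by noncomm_ring, qq]
      noncomm_ring
    have h := congrArg (fun w => q * w * q) comm
    simp only [mul_add, add_mul, h1, conj_eq qq ⟨qa, qc⟩, conj_eq qq ⟨qc, qa⟩,
      conj_eq qq eb] at h
    linear_combination (norm := abel) h
  have cubic' : a * (b * c) = c * (b * a) + (1 / 2 : ℂ) • (a * (a * b) - b * (a * a) + c * (c * a)
      - a * (c * c) - b * (b * c) + c * (b * b)) := by
    -- In this combination of left and right multiples of the two commutation relations all cubic
    -- words in three distinct letters cancel except $abc$ and $cba$; the rest contain a square.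
    have h := congrArg (fun w => (1 / 2 : ℂ) • w) (congrArg₂ (· + ·) (congrArg₂ (· + ·)
      (congrArg₂ (· - ·) (congrArg (c * ·) comm) (congrArg (a * ·) comm))
      (congrArg₂ (· - ·) (congrArg (· * c) comm) (congrArg (· * a) comm)))
      (congrArg₂ (· + ·)
      (congrArg₂ (· + ·) (congrArg (a * ·) comm'.symm) (congrArg (b * ·) comm'.symm))
      (congrArg₂ (· + ·) (congrArg (· * a) comm'.symm) (congrArg (· * b) comm'.symm))))
    simp only [mul_add, add_mul, mul_assoc] at h ⊢
    linear_combination (norm := module) h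
  have ca : c * a = a * c + a * b - b * a := by linear_combination (norm := abel) -comm
  have cb : c * b = b * c - a * b + b * a := by linear_combination (norm := abel) comm' + comm
  have cy' : c * y = -(a * y) := by rw [ay, neg_neg]
  have zb' : z * b = -(z * a) := by rw [za, neg_neg]
  have bz' : b * z = -(a * z) := by rw [az, neg_neg]
  have yc' : y * c = -(y * a) := by rw [ya, neg_neg]
  have prp : p * r * p = q := by rw [pr, mul_assoc, pp, mul_one]
  have rpr : r * p * r = q := by rw [rp, mul_assoc, rr, mul_one]
  have xrp : x * r * p = -(x * q) := by rw [mul_assoc, ← pq, ← mul_assoc, xp, neg_mul]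
  have zpr : z * p * r = -(z * q) := by rw [mul_assoc, ← rq, ← mul_assoc, zr, neg_mul]
  have cbx : c * b * x = -(c * c * x) := by rw [mul_assoc, bx, mul_neg, mul_assoc]
  have cubic : a * b * c = c * b * a + (1 / 2 : ℂ) • (a * a * b - b * a * a + c * c * a
      - a * c * c - b * b * c + c * b * b) := by
    simpa only [mul_assoc] using cubic'
  -- The scalar coefficients stay opaque while the words are being rewritten.
  generalize ha₀ : v * (v - (m + 1)) = a₀
  generalize hb₀ : (u + v) * ((u + v) - (m + 1)) = b₀
  generalize hc₀ : u * (u - (m + 1)) = c₀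
  generalize hn : 2 * m + 4 = n
  generalize ha₁ : n * v / (2 * m + 2 - v) = a₁
  generalize hb₁ : n * (u + v) / (2 * m + 2 - (u + v)) = b₁
  generalize hc₁ : n * u / (2 * m + 2 - u) = c₁
  generalize ha₂ : v / 3 = a₂
  generalize hb₂ : (u + v) / 3 = b₂
  generalize hc₂ : u / 3 = c₂
  simp only [mul_add, add_mul, smul_mul_assoc, mul_smul_comm, mul_one, one_mul, smul_smul,
    ← mul_assoc, cubic, cbx, smul_add, smul_sub]
  -- Freezing this word keeps the rule for `c * b` from expanding it.
  generalize c * b * a = W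
  simp only [pq, qr, qp, rq, pb, pc, qa, qc, ra, rb, py, pz, qx, qz, rx, ry, xx, zz, xa, ax, zc,
    cz, aa, bb, cc, xy, yx, xz, zx, yz, zy, xb, bx, yc', cy', zb', bz', ca, cb, prp, rpr, xrp, zpr,
    mul_mul_of_eq pp, mul_mul_of_eq rr, mul_mul_of_eq qr, mul_mul_of_eq qp, mul_mul_of_eq pa,
    mul_mul_of_eq pc, mul_mul_of_eq qa, mul_mul_of_eq qc, mul_mul_of_eq ra, mul_mul_of_eq rc,
    mul_mul_of_eq px, mul_mul_of_eq pz, mul_mul_of_eq qx, mul_mul_of_eq qz, mul_mul_of_eq rx,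
    mul_mul_of_eq rz, mul_mul_of_eq ap, mul_mul_of_eq cr, mul_mul_of_eq ax, mul_mul_of_eq cz,
    mul_mul_of_eq aa, mul_mul_of_eq bb, mul_mul_of_eq cc, mul_mul_of_eq yx, mul_mul_of_eq yz,
    mul_mul_of_eq yc', mul_mul_of_eq bz', mul_mul_of_eq cb,
    mul_add, add_mul, mul_sub, sub_mul, smul_mul_assoc, mul_smul_comm, mul_one, one_mul,
    smul_smul, ← mul_assoc, neg_mul, mul_neg, smul_add, smul_sub, smul_neg, neg_neg]
  -- The three denominators become the independent variables, so clearing them leaves polynomial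
  -- identities.
  obtain ⟨s, t, d, rfl, rfl, rfl⟩ : ∃ s t d : ℂ, m = (s + t - d) / 2 - 1 ∧ u = t - d ∧ v = s - d :=
    ⟨2 * m + 2 - u, 2 * m + 2 - v, 2 * m + 2 - (u + v), by ring, by ring, by ring⟩
  rw [show 2 * ((s + t - d) / 2 - 1) + 2 - (t - d) = s by ring] at hu hc₁
  rw [show 2 * ((s + t - d) / 2 - 1) + 2 - (s - d) = t by ring] at hv ha₁
  rw [show 2 * ((s + t - d) / 2 - 1) + 2 - (t - d + (s - d)) = d by ring] at hw hb₁
  subst ha₁ hb₁ hc₁ ha₀ hb₀ hc₀ hn ha₂ hb₂ hc₂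
  match_scalars <;> field_simp <;> ring

end ThreeStrand

end Abstract

/-! ### The relations in `End (V ⊗ V)` -/

/-- The Casimir operator `D - 3 P - 3 K`. -/
def casimirOp (k : ℕ) : End2 k := quarticOp k - (3 : ℂ) • swapOp k - (3 : ℂ) • cupCap k

lemma twoStrand (hk : k ≤ 3) : TwoStrand (m k) (swapOp k) (cupCap k) (casimirOp k) where
  pp := swapOp_mul_swapOp
  px := swapOp_mul_cupCap
  xp := cupCap_mul_swapOp
  xx := cupCap_mul_cupCap
  pa := by
    simp only [casimirOp, mul_sub, mul_smul_comm, swapOp_mul_swapOp, swapOp_mul_cupCap,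
      swapOp_mul_quarticOp]
    module
  ap := by
    simp only [casimirOp, sub_mul, smul_mul_assoc, swapOp_mul_swapOp, cupCap_mul_swapOp,
      quarticOp_mul_swapOp]
    module
  xa := by
    simp only [casimirOp, mul_sub, mul_smul_comm, cupCap_mul_swapOp, cupCap_mul_cupCap,
      cupCap_mul_quarticOp]
    module
  ax := by
    simp only [casimirOp, sub_mul, smul_mul_assoc, swapOp_mul_cupCap, cupCap_mul_cupCap,
      quarticOp_mul_cupCap]
    module
  aa := by
    simp only [casimirOp, mul_sub, sub_mul, smul_mul_assoc, mul_smul_comm, swapOp_mul_swapOp,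
      swapOp_mul_cupCap, cupCap_mul_swapOp, cupCap_mul_cupCap, cupCap_mul_quarticOp,
      quarticOp_mul_cupCap, swapOp_mul_quarticOp, quarticOp_mul_swapOp,
      quarticOp_mul_quarticOp hk]
    module

/-! ### The projectors, the spectral form, and the symmetry of the quartic tensor. -/

lemma m_add_four_ne_zero (k : ℕ) : m k + 4 ≠ 0 := by
  have : (2 ^ k + 4 : ℕ) ≠ 0 := by positivity
  rw [m]
  exact_mod_cast this

lemma six_mul_m_add_eight_ne_zero (k : ℕ) : 6 * m k + 8 ≠ 0 := by
  have : (6 * 2 ^ k + 8 : ℕ) ≠ 0 := by positivity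
  rw [m]
  exact_mod_cast this

lemma completeOrthogonalIdempotents_projP (hk : k ≤ 3) :
    CompleteOrthogonalIdempotents (projP k) := by
  have h4 := m_add_four_ne_zero k
  have h8 := six_mul_m_add_eight_ne_zero k
  have hn : ∀ i j : Fin 4, i ≠ j → projP k i * projP k j = 0 := by
    intro i j hij
    fin_cases i <;> fin_cases j <;> first | exact absurd rfl hij | skip
    all_goals
      simp only [projP, Fin.zero_eta, Fin.mk_one, Fin.reduceFinMk, Matrix.cons_val, mul_sub,
          sub_mul,
        mul_add, add_mul, mul_neg, neg_mul, smul_mul_assoc, mul_smul_comm, mul_one, one_mul,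
        swapOp_mul_swapOp, swapOp_mul_cupCap, cupCap_mul_swapOp, cupCap_mul_cupCap,
        cupCap_mul_quarticOp, quarticOp_mul_cupCap, swapOp_mul_quarticOp, quarticOp_mul_swapOp,
        quarticOp_mul_quarticOp hk]
      match_scalars <;> field_simp <;> ring
  -- Idempotency needs no separate check: it follows on multiplying the sum by one projector.
  refine CompleteOrthogonalIdempotents.iff_ortho_complete.2 ⟨fun i j h => hn i j h, ?_⟩
  simp only [Fin.sum_univ_four, projP, Matrix.cons_val]
  match_scalars <;> field_simp <;> ring

lemma smul_Rspec {u : ℂ} (h₁ : u ≠ 2) (h₂ : u ≠ m k + 2) (h₃ : u ≠ 2 * m k + 2) :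
    ((2 - u) * (m k + 2 - u)) • Rspec k u = Rresc k u := by
  have h4 := m_add_four_ne_zero k
  have h8 := six_mul_m_add_eight_ne_zero k
  replace h₁ := sub_ne_zero.2 h₁.symm
  replace h₂ := sub_ne_zero.2 h₂.symm
  replace h₃ := sub_ne_zero.2 h₃.symm
  have h8' : m k * 6 + 8 ≠ 0 := by rwa [mul_comm]
  have h₃' : 2 * (m k + 1) - u ≠ 0 := by rwa [mul_add, mul_one]
  simp only [Rspec, Rresc, projP, Matrix.cons_val]
  match_scalars <;> field_simp <;> ring

/-- A permutation merely reindexes the subsets in the polarization formula and preserves their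
sizes. -/
lemma dTensor_comp_perm (p : Fin 4 → VIdx k) (σ : Equiv.Perm (Fin 4)) :
    dTensor k (p ∘ σ) = dTensor k p := by
  have h := Equiv.sum_comp σ.finsetCongr
    fun S : Finset (Fin 4) => (-1) ^ S.card * quartic (∑ i ∈ S, stdVec (p i))
  simp only [Equiv.finsetCongr_apply, Finset.card_map, Finset.sum_map, Equiv.coe_toEmbedding] at h
  simp only [dTensor, Function.comp_apply, h]

/-! ### The range of the third projector -/

lemma linearMap_ext_dualVec {f g : V k →ₗ[ℂ] ℂ} (h : ∀ p, f (dualVec p) = g (dualVec p)) (v : V k) :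
    f v = g v := by
  rw [← neg_neg v, ← sum_sympl_smul_dualVec, map_sum, map_sum]
  simp only [map_smul, h]

/-- The quadratic relation of $D$ gives this when `a` and `b` are dual basis vectors; linearity
frees the two slots one at a time. -/
lemma sum_dForm_mul_dForm (hk : k ≤ 3) (a b c d : V k) :
    ∑ p : VIdx k × VIdx k, dForm a b (stdVec p.1) (stdVec p.2)
      * dForm (dualVec p.1) (dualVec p.2) c d =
    6 * (m k + 2) * dForm a b c d
      + 18 * (m k + 3) * (sympl a c * sympl b d + sympl a d * sympl b c) := by
  have hd := dForm_isSymmetric (k := k)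
  have h1 : ∀ (p : VIdx k × VIdx k),
      ∑ q : VIdx k × VIdx k, dForm (dualVec p.1) (dualVec p.2) (stdVec q.1) (stdVec q.2)
        * dForm (dualVec q.1) (dualVec q.2) c d =
      6 * (m k + 2) * dForm (dualVec p.1) (dualVec p.2) c d + 18 * (m k + 3)
        * (sympl (dualVec p.1) c * sympl (dualVec p.2) d
          + sympl (dualVec p.1) d * sympl (dualVec p.2) c) := fun p => by
    have h := congrFun (congrArg (fun M : End2 k => M.mulVec (tensor c d))
      (quarticOp_mul_quarticOp hk)) p
    simp only [← Matrix.mulVec_mulVec, Matrix.add_mulVec, Matrix.smul_mulVec, Matrix.one_mulVec,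
      Pi.add_apply, Pi.smul_apply, smul_eq_mul, quarticOp_mulVec_tensor, swapOp_mulVec, tensor,
      Prod.fst_swap, Prod.snd_swap] at h
    simp only [sympl_dualVec]
    rw [mul_comm (d p.1), ← h]
    exact Finset.sum_congr rfl fun q _ =>
      congrArg₂ (· * ·) (quarticOp_apply p q).symm (quarticOp_mulVec_tensor c d q).symm
  have h2 : ∀ p, ∑ q : VIdx k × VIdx k, dForm a (dualVec p) (stdVec q.1) (stdVec q.2)
        * dForm (dualVec q.1) (dualVec q.2) c d =
      6 * (m k + 2) * dForm a (dualVec p) c d + 18 * (m k + 3)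
        * (sympl a c * sympl (dualVec p) d + sympl a d * sympl (dualVec p) c) := fun p => by
    have h := linearMap_ext_dualVec
      (f := ∑ q : VIdx k × VIdx k, dForm (dualVec q.1) (dualVec q.2) c d •
        dFormₗ (dualVec p) (stdVec q.1) (stdVec q.2))
      (g := (6 * (m k + 2)) • dFormₗ (dualVec p) c d + (18 * (m k + 3)) •
        (sympl (dualVec p) d • (symplₗ k).flip c + sympl (dualVec p) c • (symplₗ k).flip d))
      (fun q => by
        have := h1 (q, p)
        simp only [LinearMap.sum_apply, LinearMap.smul_apply, LinearMap.add_apply, smul_eq_mul]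
        rw [mul_comm (sympl (dualVec p) d), mul_comm (sympl (dualVec p) c)]
        refine Eq.trans (Finset.sum_congr rfl fun r _ => mul_comm _ _) this) a
    simp only [LinearMap.sum_apply, LinearMap.smul_apply, LinearMap.add_apply, smul_eq_mul] at h
    rw [mul_comm (sympl a c), mul_comm (sympl a d)]
    refine Eq.trans (Finset.sum_congr rfl fun r _ => mul_comm _ _) h
  have h := linearMap_ext_dualVec
    (f := ∑ q : VIdx k × VIdx k, dForm (dualVec q.1) (dualVec q.2) c d •
      dFormₗ a (stdVec q.1) (stdVec q.2))
    (g := (6 * (m k + 2)) • dFormₗ a c d + (18 * (m k + 3)) •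
      (sympl a c • (symplₗ k).flip d + sympl a d • (symplₗ k).flip c))
    (fun q => by
      have := h2 q
      simp only [hd.swap₁ a] at this
      simp only [LinearMap.sum_apply, LinearMap.smul_apply, LinearMap.add_apply, smul_eq_mul]
      refine Eq.trans (Finset.sum_congr rfl fun r _ => mul_comm _ _) this) b
  simp only [LinearMap.sum_apply, LinearMap.smul_apply, LinearMap.add_apply, smul_eq_mul] at h
  simp only [hd.swap₁ a]
  exact Eq.trans (Finset.sum_congr rfl fun r _ => mul_comm _ _) h

/-- Exchanging the two ends of a contraction costs a sign because $J^{-1}$ is antisymmetric. -/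
lemma sum_dualVec_mul_stdVec (f g : V k →ₗ[ℂ] ℂ) :
    ∑ p, f (dualVec p) * g (stdVec p) = -∑ p, f (stdVec p) * g (dualVec p) := by
  have h : ∀ (f : V k →ₗ[ℂ] ℂ) (v : V k), f v = ∑ p, v p * f (stdVec p) := fun f v => by
    conv_lhs => rw [← sum_smul_stdVec v, map_sum]
    simp only [map_smul, smul_eq_mul]
  simp only [h f (dualVec _), h g (dualVec _), Finset.sum_mul, Finset.mul_sum]
  rw [Finset.sum_comm, ← Finset.sum_neg_distrib]
  refine Finset.sum_congr rfl fun p _ => ?_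
  rw [← Finset.sum_neg_distrib]
  refine Finset.sum_congr rfl fun q _ => ?_
  rw [dualVec_apply_swap]
  ring

lemma sum_dForm_mul_dForm' (hk : k ≤ 3) (a b c d : V k) :
    ∑ p : VIdx k × VIdx k, dForm a (dualVec p.2) (stdVec p.1) b
      * dForm c (stdVec p.2) (dualVec p.1) d =
    -(6 * (m k + 2) * dForm a b c d
      + 18 * (m k + 3) * (sympl a c * sympl b d + sympl a d * sympl b c)) := by
  have hd := dForm_isSymmetric (k := k)
  rw [← sum_dForm_mul_dForm hk, Fintype.sum_prod_type (α₁ := VIdx k) (α₂ := VIdx k),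
      Fintype.sum_prod_type (α₁ := VIdx k) (α₂ := VIdx k),
    ← Finset.sum_neg_distrib]
  refine Finset.sum_congr rfl fun p _ => ?_
  have h := sum_dualVec_mul_stdVec (dFormₗ a (stdVec p) b) (dFormₗ c (dualVec p) d)
  change ∑ q, dForm (dualVec q) a (stdVec p) b * dForm (stdVec q) c (dualVec p) d =
    -∑ q, dForm (stdVec q) a (stdVec p) b * dForm (dualVec q) c (dualVec p) d at h
  simp only [hd.swap₁ a, hd.swap₁ c (stdVec _), h]
  refine congrArg Neg.neg (Finset.sum_congr rfl fun q _ => ?_)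
  rw [hd.swap₁₄ (stdVec q), hd.swap₁ b, hd.swap₁₃ (dualVec q), hd.swap₂ (dualVec p)]

lemma dForm_swap_pairs (x y z w : V k) : dForm x y z w = dForm z w x y := by
  have hd := dForm_isSymmetric (k := k)
  rw [hd.swap₁₃, hd.swap₂, hd.swap₃, hd.swap₂]

lemma sum_dForm_dualVec_stdVec (x y : V k) : ∑ p, dForm (dualVec p) x (stdVec p) y = 0 := by
  have hd := dForm_isSymmetric (k := k)
  have h : ∀ p, dForm (dualVec p) x (stdVec p) y =
      ∑ q, dualVec p q * dForm (stdVec q) x (stdVec p) y := fun p => (sum_mul_dForm _ _ _ _).symm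
  simp only [h]
  rw [← Fintype.sum_prod_type' (f := fun p q => dualVec p q * dForm (stdVec q) x (stdVec p) y)]
  refine sum_eq_zero_of_swap _ fun p => ?_
  rw [Prod.fst_swap, Prod.snd_swap, dualVec_apply_swap, hd.swap₁₃]
  ring

section

variable {t : VIdx k × VIdx k → ℂ}

lemma lowered_mulVec_dualVec (a b : VIdx k) : (lowered k t).mulVec (dualVec a) b = -t (b, a) := by
  rw [lowered_mulVec]
  simp only [sympl_swap (dualVec a), sympl_dualVec, stdVec, Pi.single_apply, mul_neg, mul_ite,
    mul_one, mul_zero, Finset.sum_neg_distrib, Finset.sum_ite_eq, Finset.mem_univ, if_true]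

/-- Skewness of the endomorphism for $\omega$ is exactly symmetry of the tensor. -/
lemma apply_swap_of_isDerivation (h : IsDerivation (Matrix.toLin' (lowered k t))) (a b : VIdx k) :
    t (b, a) = t (a, b) := by
  have h1 := (toLin'_isDerivation_iff.1 h).1 (dualVec a) (dualVec b)
  rw [sympl_swap (dualVec b), sympl_dualVec, sympl_dualVec, lowered_mulVec_dualVec,
    lowered_mulVec_dualVec] at h1
  linear_combination h1

lemma sum_dForm_lowered_stdVec (x y : V k) :
    ∑ p, dForm ((lowered k t).mulVec (dualVec p)) x (stdVec p) y =
      -∑ q : VIdx k × VIdx k, t q * dForm (stdVec q.1) (stdVec q.2) x y := by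
  have hd := dForm_isSymmetric (k := k)
  rw [Fintype.sum_prod_type_right (α₁ := VIdx k) (α₂ := VIdx k), ← Finset.sum_neg_distrib]
  refine Finset.sum_congr rfl fun p _ => ?_
  rw [← sum_mul_dForm, ← Finset.sum_neg_distrib]
  refine Finset.sum_congr rfl fun q _ => ?_
  rw [lowered_mulVec_dualVec, hd.swap₂, neg_mul]

lemma sum_J_mul_dForm_dualVec (s : VIdx k) (x y z : V k) :
    ∑ p, J k s p * dForm (dualVec p) x y z = dForm (stdVec s) x y z := by
  rw [← dForm_sum_smul]
  congr 1
  have h := sum_sympl_smul_dualVec (-stdVec (k := k) s)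
  rw [neg_neg] at h
  rw [← h]
  refine Finset.sum_congr rfl fun p _ => ?_
  congr 1
  exact (sympl_swap _ _).trans ((symplₗ k _).map_neg _).symm

lemma sum_dForm_dualVec_lowered (x y : V k) :
    ∑ p, dForm (dualVec p) x ((lowered k t).mulVec (stdVec p)) y =
      ∑ q : VIdx k × VIdx k, t q * dForm (stdVec q.1) (stdVec q.2) x y := by
  have hd := dForm_isSymmetric (k := k)
  have h1 : ∀ p, dForm (dualVec p) x ((lowered k t).mulVec (stdVec p)) y =
      ∑ r, ∑ s, t (r, s) * (J k s p * dForm (dualVec p) x (stdVec r) y) := fun p => by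
    rw [← sum_mul_dForm₃]
    refine Finset.sum_congr rfl fun r _ => ?_
    rw [lowered_mulVec, Finset.sum_mul]
    exact Finset.sum_congr rfl fun s _ => mul_assoc _ _ _
  simp only [h1]
  rw [Finset.sum_comm, Fintype.sum_prod_type (α₁ := VIdx k) (α₂ := VIdx k)]
  refine Finset.sum_congr rfl fun r _ => ?_
  rw [Finset.sum_comm]
  refine Finset.sum_congr rfl fun s _ => ?_
  rw [← Finset.mul_sum, sum_J_mul_dForm_dualVec, hd.swap₁₃, hd.swap₂]

lemma trace_lowered (h : ∀ a b, t (b, a) = t (a, b)) : ∑ p, lowered k t p p = 0 := by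
  change ∑ p, ∑ q, t (p, q) * J k q p = 0
  rw [← Fintype.sum_prod_type' (f := fun p q => t (p, q) * J k q p)]
  refine sum_eq_zero_of_swap _ fun p => ?_
  rw [Prod.fst_swap, Prod.snd_swap, h, J_swap, mul_neg]

/-- Contracting the four-term invariance of $d$ with a second $d$ in three slots leaves a two-index
equation. The quadratic relation evaluates each term as a combination of $Dt$ and $t$, so $t$ is an
eigenvector. -/
theorem quarticOp_mulVec_of_isDerivation (hk : k ≤ 3)
    (h : IsDerivation (Matrix.toLin' (lowered k t))) :
    (quarticOp k).mulVec t = (6 * (m k + 3)) • t := by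
  have hd := dForm_isSymmetric (k := k)
  have hS := (toLin'_isDerivation_iff.1 h).1
  have hD := (toLin'_isDerivation_iff.1 h).2
  set X := lowered k t with hX
  have htr : ∑ p, X p p = 0 := trace_lowered (apply_swap_of_isDerivation h)
  have hXp : ∀ p, sympl (dualVec p) (X.mulVec (stdVec p)) = X p p := fun p => by
    rw [sympl_dualVec, mulVec_stdVec]
  have hXz : ∀ y z, ∑ p, y p * sympl z (X.mulVec (stdVec p)) = sympl z (X.mulVec y) :=
    fun y z => by
      have := congrArg (fun v => sympl z (X.mulVec v)) (sum_smul_stdVec y)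
      rw [← this, Matrix.mulVec_sum]
      simp only [Matrix.mulVec_smul]
      exact ((map_sum (symplₗ k z) _ _).trans
        (Finset.sum_congr rfl fun p _ => sympl_smul_right _ _ _)).symm
  funext p
  obtain ⟨b, a⟩ := p
  set y : V k := dualVec a with hy
  set z : V k := dualVec b with hz
  have hDt : ∑ q : VIdx k × VIdx k, t q * dForm (stdVec q.1) (stdVec q.2) z y =
      (quarticOp k).mulVec t (b, a) :=
    Finset.sum_congr rfl fun q _ => by
      rw [mul_comm, dForm_swap_pairs]
      exact congrArg (· * t q) (quarticOp_apply (b, a) q).symm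
  have hDt' : ∑ q : VIdx k × VIdx k, t q * dForm (stdVec q.1) (stdVec q.2) y z =
      (quarticOp k).mulVec t (b, a) := by
    simp only [← hDt, hd.swap₃ _ _ y]
  have h0 : ∑ i, ∑ q : VIdx k × VIdx k, (dForm (X.mulVec (dualVec q.1)) (dualVec q.2) (stdVec i) y
      + dForm (dualVec q.1) (X.mulVec (dualVec q.2)) (stdVec i) y
      + dForm (dualVec q.1) (dualVec q.2) (X.mulVec (stdVec i)) y
      + dForm (dualVec q.1) (dualVec q.2) (stdVec i) (X.mulVec y))
      * dForm (stdVec q.1) (stdVec q.2) (dualVec i) z = 0 := by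
    simp only [hD, zero_mul, Finset.sum_const_zero]
  simp only [add_mul, Finset.sum_add_distrib] at h0
  -- The factor $6m+9$ is $\dim V+1$: one pairing closes a loop, the other joins `z` to `X.mulVec
  -- y`.
  have t4 : ∑ i, ∑ q : VIdx k × VIdx k, dForm (dualVec q.1) (dualVec q.2) (stdVec i) (X.mulVec y)
      * dForm (stdVec q.1) (stdVec q.2) (dualVec i) z =
      18 * (m k + 3) * (6 * m k + 9) * sympl z (X.mulVec y) := by
    have h1 : ∀ i, ∑ q : VIdx k × VIdx k,
        dForm (dualVec q.1) (dualVec q.2) (stdVec i) (X.mulVec y)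
          * dForm (stdVec q.1) (stdVec q.2) (dualVec i) z = _ := fun i =>
      (Finset.sum_congr rfl fun q _ => by
        rw [mul_comm, dForm_swap_pairs (stdVec q.1)]).trans
        (sum_dForm_mul_dForm hk (dualVec i) z (stdVec i) (X.mulVec y))
    simp only [h1, Finset.sum_add_distrib, ← Finset.mul_sum, sum_dForm_dualVec_stdVec,
      sympl_dualVec, ← sympl_eq_sum]
    simp [stdVec, m]
    ring
  have t3 : ∑ i, ∑ q : VIdx k × VIdx k, dForm (dualVec q.1) (dualVec q.2) (X.mulVec (stdVec i)) y
      * dForm (stdVec q.1) (stdVec q.2) (dualVec i) z =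
      6 * (m k + 2) * (quarticOp k).mulVec t (b, a)
        + 18 * (m k + 3) * sympl z (X.mulVec y) := by
    have h1 : ∀ i, ∑ q : VIdx k × VIdx k,
        dForm (dualVec q.1) (dualVec q.2) (X.mulVec (stdVec i)) y
          * dForm (stdVec q.1) (stdVec q.2) (dualVec i) z = _ := fun i =>
      (Finset.sum_congr rfl fun q _ => by
        rw [mul_comm, dForm_swap_pairs (stdVec q.1)]).trans
        (sum_dForm_mul_dForm hk (dualVec i) z (X.mulVec (stdVec i)) y)
    simp only [h1, Finset.sum_add_distrib, ← Finset.mul_sum, hXp, ← Finset.sum_mul, htr]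
    simp only [sympl_dualVec, hXz]
    rw [hX, sum_dForm_dualVec_lowered, hDt]
    ring
  -- Here `X` sits on a contracted dual vector. That index is summed last and the inner double sum
  -- is the flipped contraction; a loop through `X` vanishes because `X` is traceless.
  have t1 : ∑ i, ∑ q : VIdx k × VIdx k, dForm (X.mulVec (dualVec q.1)) (dualVec q.2) (stdVec i) y
      * dForm (stdVec q.1) (stdVec q.2) (dualVec i) z =
      6 * (m k + 2) * (quarticOp k).mulVec t (b, a)
        + 18 * (m k + 3) * sympl z (X.mulVec y) := by
    have h1 : ∀ i, ∑ q : VIdx k × VIdx k,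
        dForm (X.mulVec (dualVec i)) (dualVec q.2) (stdVec q.1) y
          * dForm (stdVec i) (stdVec q.2) (dualVec q.1) z = _ := fun i =>
      sum_dForm_mul_dForm' hk (X.mulVec (dualVec i)) y (stdVec i) z
    have h2 : ∀ i v, sympl (X.mulVec (dualVec i)) v = -X.mulVec v i := fun i v => by
      rw [← sympl_dualVec i (X.mulVec v)]
      linear_combination hS (dualVec i) v
    simp only [Fintype.sum_prod_type (α₁ := VIdx k) (α₂ := VIdx k)] at h1 ⊢
    rw [Finset.sum_comm]
    simp only [h1]
    simp only [Finset.sum_neg_distrib, Finset.sum_add_distrib, ← Finset.mul_sum, h2,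
      mulVec_stdVec, neg_mul, ← Finset.sum_mul, htr, ← sympl_eq_sum]
    rw [hX, sum_dForm_lowered_stdVec, hDt', ← hX]
    have h3 := hS y z
    rw [sympl_swap z] at h3
    linear_combination 18 * (m k + 3) * h3
  have t2 : ∑ i, ∑ q : VIdx k × VIdx k, dForm (dualVec q.1) (X.mulVec (dualVec q.2)) (stdVec i) y
      * dForm (stdVec q.1) (stdVec q.2) (dualVec i) z =
      6 * (m k + 2) * (quarticOp k).mulVec t (b, a)
        + 18 * (m k + 3) * sympl z (X.mulVec y) := by
    rw [← t1]
    refine Finset.sum_congr rfl fun i _ => ?_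
    rw [← (Equiv.prodComm _ _).sum_comp]
    refine Finset.sum_congr rfl fun q _ => ?_
    simp only [Equiv.prodComm_apply, Prod.fst_swap, Prod.snd_swap]
    rw [hd.swap₁, hd.swap₁ (stdVec q.2)]
  rw [t1, t2, t3, t4, hz, sympl_dualVec, hy, hX, lowered_mulVec_dualVec] at h0
  -- The four terms add up to $18(m+2)\,(Dt-6(m+3)t)$, whose scalar factor is cancelled.
  have hm : 18 * (m k + 2) ≠ 0 := by
    have : (18 * (2 ^ k + 2) : ℕ) ≠ 0 := by positivity
    rw [m]
    exact_mod_cast this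
  refine mul_left_cancel₀ hm ?_
  rw [Pi.smul_apply, smul_eq_mul]
  linear_combination h0

end

lemma projP_two_eq (k : ℕ) : projP k 2 = (1 / (6 * (m k + 4))) • symOp k := rfl

theorem projP_two_mulVec_eq_iff (hk : k ≤ 3) (t : Matrix (VIdx k) (VIdx k) ℂ) :
    (projP k 2).mulVec (fun p => t p.1 p.2) = (fun p => t p.1 p.2) ↔
      IsInfinitesimalSymmetry (t * J k) := by
  rw [isInfinitesimalSymmetry_iff]
  set s : VIdx k × VIdx k → ℂ := fun p => t p.1 p.2 with hs
  have hl : t * J k = lowered k s := rfl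
  rw [hl, projP_two_eq, Matrix.smul_mulVec]
  refine ⟨fun h => ?_, fun h => ?_⟩
  · rw [← h, map_smul]
    exact (derivations k).smul_mem _ (isDerivation_lowered_symOp hk s)
  · have h1 : (swapOp k).mulVec s = s := funext fun p => by
      rw [swapOp_mulVec]
      exact apply_swap_of_isDerivation h p.1 p.2
    have h4 := m_add_four_ne_zero k
    rw [symOp, Matrix.add_mulVec, Matrix.smul_mulVec, Matrix.add_mulVec, Matrix.one_mulVec, h1,
      quarticOp_mulVec_of_isDerivation hk h]
    match_scalars
    field_simp
    ring

/-! ### Operators on three factors -/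

/-- The operator acting on the first and third factors. -/
def on13 (M : End2 k) : End3 k := fun i j =>
  if i.1.2 = j.1.2 then M (i.1.1, i.2) (j.1.1, j.2) else 0

lemma on12_apply (M : End2 k) (i j : (VIdx k × VIdx k) × VIdx k) :
    on12 M i j = if i.2 = j.2 then M i.1 j.1 else 0 := by
  rw [on12, Matrix.kroneckerMap_apply, Matrix.one_apply, mul_ite, mul_one, mul_zero]

lemma on23_apply (M : End2 k) (i j : (VIdx k × VIdx k) × VIdx k) :
    on23 M i j = if i.1.1 = j.1.1 then M (i.1.2, i.2) (j.1.2, j.2) else 0 := by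
  change (1 : Matrix (VIdx k) (VIdx k) ℂ) i.1.1 j.1.1 * M (i.1.2, i.2) (j.1.2, j.2) = _
  rw [Matrix.one_apply, ite_mul, one_mul, zero_mul]

lemma on12_mul (M N : End2 k) : on12 (M * N) = on12 M * on12 N := by
  rw [on12, on12, on12, ← Matrix.mul_kronecker_mul, one_mul]

lemma on12_add (M N : End2 k) : on12 (M + N) = on12 M + on12 N := Matrix.add_kronecker _ _ _

lemma on12_smul (c : ℂ) (M : End2 k) : on12 (c • M) = c • on12 M := Matrix.smul_kronecker _ _ _

lemma on12_one : on12 (1 : End2 k) = 1 := Matrix.one_kronecker_one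

lemma on12_swapOp_mul_apply (T : End3 k) (i j : (VIdx k × VIdx k) × VIdx k) :
    (on12 (swapOp k) * T) i j = T (i.1.swap, i.2) j := by
  have h : ∀ l, on12 (swapOp k) i l = if (i.1.swap, i.2) = l then 1 else 0 := fun l => by
    rw [on12_apply, swapOp_apply, ← ite_and]
    simp only [Prod.ext_iff (x := (i.1.swap, i.2)), and_comm]
  simp only [Matrix.mul_apply, h, ite_mul, one_mul, zero_mul, Finset.sum_ite_eq, Finset.mem_univ,
    if_true]

lemma mul_on12_swapOp_apply (T : End3 k) (i j : (VIdx k × VIdx k) × VIdx k) :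
    (T * on12 (swapOp k)) i j = T i (j.1.swap, j.2) := by
  have h : ∀ l, on12 (swapOp k) l j = if l = (j.1.swap, j.2) then 1 else 0 := fun l => by
    rw [on12_apply, swapOp_apply, ← ite_and]
    simp only [Prod.ext_iff (x := l), and_comm, Prod.swap_eq_iff_eq_swap]
  simp only [Matrix.mul_apply, h, mul_ite, mul_one, mul_zero, Finset.sum_ite_eq', Finset.mem_univ,
    if_true]

lemma on23_swapOp_mul_apply (T : End3 k) (i j : (VIdx k × VIdx k) × VIdx k) :
    (on23 (swapOp k) * T) i j = T ((i.1.1, i.2), i.1.2) j := by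
  have h : ∀ l, on23 (swapOp k) i l = if ((i.1.1, i.2), i.1.2) = l then 1 else 0 := fun l => by
    rw [on23_apply, swapOp_apply, ← ite_and]
    simp only [Prod.ext_iff, Prod.swap, and_assoc]
  simp only [Matrix.mul_apply, h, ite_mul, one_mul, zero_mul, Finset.sum_ite_eq, Finset.mem_univ,
    if_true]

lemma mul_on23_swapOp_apply (T : End3 k) (i j : (VIdx k × VIdx k) × VIdx k) :
    (T * on23 (swapOp k)) i j = T i ((j.1.1, j.2), j.1.2) := by
  have h : ∀ l, on23 (swapOp k) l j = if l = ((j.1.1, j.2), j.1.2) then 1 else 0 := fun l => by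
    rw [on23_apply, swapOp_apply, ← ite_and]
    obtain ⟨⟨a, b⟩, c⟩ := l
    refine if_congr ?_ rfl rfl
    simp only [Prod.mk.injEq, Prod.swap_prod_mk]
    tauto
  simp only [Matrix.mul_apply, h, mul_ite, mul_one, mul_zero, Finset.sum_ite_eq', Finset.mem_univ,
    if_true]

lemma exchanges_on12_swapOp (M : End2 k) :
    Exchanges (on12 (swapOp k)) (on13 M) (on23 M) := by
  constructor <;> ext i j <;>
    rw [on12_swapOp_mul_apply, mul_on12_swapOp_apply, on13, on23_apply] <;> rfl

lemma exchanges_on23_swapOp (M : End2 k) :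
    Exchanges (on23 (swapOp k)) (on12 M) (on13 M) := by
  constructor <;> ext i j <;>
    rw [on23_swapOp_mul_apply, mul_on23_swapOp_apply, on13, on12_apply]

lemma on12_swapOp_mul_self : on12 (swapOp k) * on12 (swapOp k) = 1 := by
  rw [← on12_mul, swapOp_mul_swapOp, on12_one]

lemma on13_eq (M : End2 k) : on13 M = on23 (swapOp k) * on12 M * on23 (swapOp k) := by
  ext i j
  rw [mul_on23_swapOp_apply, on23_swapOp_mul_apply, on12_apply, on13]

lemma on23_mul (M N : End2 k) : on23 (M * N) = on23 M * on23 N := by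
  simp only [on23, Matrix.reindex_apply, Matrix.submatrix_mul_equiv, ← Matrix.mul_kronecker_mul,
    one_mul]

lemma on23_one : on23 (1 : End2 k) = 1 := by
  simp only [on23, Matrix.one_kronecker_one, Matrix.reindex_apply, Matrix.submatrix_one_equiv]

lemma on23_add (M N : End2 k) : on23 (M + N) = on23 M + on23 N := by
  simp only [on23, Matrix.kronecker_add, Matrix.reindex_apply]
  rfl

lemma on23_smul (c : ℂ) (M : End2 k) : on23 (c • M) = c • on23 M := by
  simp only [on23, Matrix.kronecker_smul, Matrix.reindex_apply]
  rfl

/-- The outer flip carries $M_{12}$ to $M_{32}$; commutation with the flip identifies this with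
$M_{23}$. The proof uses $P_{13}=P_{12}P_{23}P_{12}=P_{23}P_{12}P_{23}$. -/
lemma exchanges_on13_swapOp {M : End2 k} (hM : swapOp k * M = M * swapOp k) :
    Exchanges (on13 (swapOp k)) (on12 M) (on23 M) := by
  obtain ⟨h1, h2⟩ := exchanges_on12_swapOp M
  obtain ⟨h3, h4⟩ := exchanges_on23_swapOp M
  have h5 : on12 (swapOp k) * on12 M = on12 M * on12 (swapOp k) := by
    rw [← on12_mul, hM, on12_mul]
  have h6 : on23 (swapOp k) * on23 M = on23 M * on23 (swapOp k) := by
    rw [← on23_mul, hM, on23_mul]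
  have h7 := on13_eq (swapOp k)
  have h8 : on13 (swapOp k) = on12 (swapOp k) * on23 (swapOp k) * on12 (swapOp k) := by
    rw [(exchanges_on12_swapOp _).2, mul_assoc, on12_swapOp_mul_self, mul_one]
  constructor
  · calc on13 (swapOp k) * on12 M
        = on12 (swapOp k) * on23 (swapOp k) * (on12 (swapOp k) * on12 M) := by
          rw [h8]; noncomm_ring
      _ = on12 (swapOp k) * (on23 (swapOp k) * on12 M) * on12 (swapOp k) := by
          rw [h5]; noncomm_ring
      _ = on12 (swapOp k) * on13 M * on23 (swapOp k) * on12 (swapOp k) := by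
          rw [h3]; noncomm_ring
      _ = on23 M * on13 (swapOp k) := by rw [h1, h8]; noncomm_ring
  · calc on13 (swapOp k) * on23 M
        = on23 (swapOp k) * on12 (swapOp k) * (on23 (swapOp k) * on23 M) := by
          rw [h7]; noncomm_ring
      _ = on23 (swapOp k) * (on12 (swapOp k) * on23 M) * on23 (swapOp k) := by
          rw [h6]; noncomm_ring
      _ = on23 (swapOp k) * on13 M * on12 (swapOp k) * on23 (swapOp k) := by
          rw [h2]; noncomm_ring
      _ = on12 M * on13 (swapOp k) := by rw [h4, h7]; noncomm_ring

lemma on13_mul (M N : End2 k) : on13 (M * N) = on13 M * on13 N := by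
  have h : on23 (swapOp k) * on23 (swapOp k) = 1 := by
    rw [← on23_mul, swapOp_mul_swapOp, on23_one]
  calc on13 (M * N) = on23 (swapOp k) * on12 M * 1 * on12 N * on23 (swapOp k) := by
        rw [on13_eq, on12_mul]; noncomm_ring
    _ = on13 M * on13 N := by rw [← h, on13_eq, on13_eq]; noncomm_ring

lemma on13_add (M N : End2 k) : on13 (M + N) = on13 M + on13 N := by
  simp only [on13_eq, on12_add, mul_add, add_mul]

lemma on13_smul (c : ℂ) (M : End2 k) : on13 (c • M) = c • on13 M := by
  simp only [on13_eq, on12_smul, mul_smul_comm, smul_mul_assoc]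

lemma on13_one : on13 (1 : End2 k) = 1 := by
  rw [on13_eq, on12_one, mul_one, ← on23_mul, swapOp_mul_swapOp, on23_one]

lemma TwoStrand.map {A B : Type*} [Ring A] [Algebra ℂ A] [Ring B] [Algebra ℂ B] {m : ℂ} {p x a : A}
    (h : TwoStrand m p x a) (f : A →ₐ[ℂ] B) : TwoStrand m (f p) (f x) (f a) where
  pp := by rw [← map_mul, h.pp, map_one]
  px := by rw [← map_mul, h.px, map_neg]
  xp := by rw [← map_mul, h.xp, map_neg]
  xx := by rw [← map_mul, h.xx, map_neg, map_smul]
  pa := by rw [← map_mul, h.pa]; simp only [map_add, map_sub, map_smul, map_one]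
  ap := by rw [← map_mul, h.ap]; simp only [map_add, map_sub, map_smul, map_one]
  xa := by rw [← map_mul, h.xa, map_smul]
  ax := by rw [← map_mul, h.ax, map_smul]
  aa := by rw [← map_mul, h.aa]; simp only [map_add, map_sub, map_smul, map_one]

/-- `on12` as a homomorphism of algebras. -/
def on12Hom (k : ℕ) : End2 k →ₐ[ℂ] End3 k :=
  AlgHom.ofLinearMap ⟨⟨on12, on12_add⟩, on12_smul⟩ on12_one on12_mul

/-- `on13` as a homomorphism of algebras. -/
def on13Hom (k : ℕ) : End2 k →ₐ[ℂ] End3 k :=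
  AlgHom.ofLinearMap ⟨⟨on13, on13_add⟩, on13_smul⟩ on13_one on13_mul

/-- `on23` as a homomorphism of algebras. -/
def on23Hom (k : ℕ) : End2 k →ₐ[ℂ] End3 k :=
  AlgHom.ofLinearMap ⟨⟨on23, on23_add⟩, on23_smul⟩ on23_one on23_mul

/-! ### The Casimir operator and the diagonal action -/

/-- The operator on one factor obtained from `casimirOp` by fixing the indices of the other. -/
def casimirSlice (k : ℕ) (c f : VIdx k) : Matrix (VIdx k) (VIdx k) ℂ :=
  Matrix.of fun a d => casimirOp k (a, c) (d, f)

/-- The corrections $-3P-3K$ in the Casimir operator are the two halves of $3(1+P)$ read across the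
other pair of indices, so every slice lies in the known space of symmetries. -/
lemma casimirSlice_eq (c f : VIdx k) : casimirSlice k c f =
    -lowered k ((symOp k).mulVec (tensor (dualVec c) (stdVec f))) := by
  ext a d
  have h := lowered_symOp_tensor_mulVec (dualVec c) (stdVec f) (stdVec d) a
  rw [mulVec_stdVec, sympl_dualVec] at h
  rw [Matrix.neg_apply, h, casimirSlice, Matrix.of_apply, casimirOp, Matrix.sub_apply,
    Matrix.sub_apply, Matrix.smul_apply, Matrix.smul_apply, quarticOp_apply, swapOp_apply, cupCap,
    dForm_isSymmetric.swap₂]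
  have h1 : (J k)⁻¹ a c = -dualVec c a := J_inv_swap c a
  have h2 : J k d f = -sympl (stdVec f) (stdVec d) := sympl_swap _ _
  have h3 : (if Prod.swap (a, c) = (d, f) then 1 else 0 : ℂ) =
      (stdVec d : V k) c * (stdVec f : V k) a := by
    simp only [Prod.swap_prod_mk, Prod.mk.injEq, stdVec, Pi.single_apply, ite_and, ite_mul, one_mul,
      zero_mul]
  simp only [smul_eq_mul]
  rw [h1, h2, h3]
  ring

lemma isDerivation_casimirSlice (hk : k ≤ 3) (c f : VIdx k) :
    IsDerivation (Matrix.toLin' (casimirSlice k c f)) := by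
  rw [casimirSlice_eq]
  exact (derivations k).neg_mem (isDerivation_lowered_symOp hk _)

/-- Once the indices of the third factor are fixed, $\Omega_{13}+\Omega_{23}$ is the diagonal action
of a symmetry, and the mixed relations follow from invariance of the operators on factors 1 and 2.
-/
lemma casimir_block (i j : VIdx k × VIdx k) (c f : VIdx k) :
    (on13 (casimirOp k) + on23 (casimirOp k)) (i, c) (j, f) = diagAct (casimirSlice k c f) i j := by
  rw [Matrix.add_apply, on13, on23_apply, diagAct, Matrix.add_apply, Matrix.kroneckerMap_apply,
    Matrix.kroneckerMap_apply, Matrix.one_apply, Matrix.one_apply, mul_ite, mul_one, mul_zero,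
    ite_mul, one_mul, zero_mul]
  rfl

lemma on12_mul_apply (M : End2 k) (T : End3 k) (i j : VIdx k × VIdx k) (c f : VIdx k) :
    (on12 M * T) (i, c) (j, f) = ∑ l, M i l * T (l, c) (j, f) := by
  rw [Matrix.mul_apply, Fintype.sum_prod_type (α₁ := VIdx k × VIdx k) (α₂ := VIdx k)]
  simp only [on12_apply, ite_mul, zero_mul, Finset.sum_ite_eq, Finset.mem_univ, if_true]

lemma mul_on12_apply (M : End2 k) (T : End3 k) (i j : VIdx k × VIdx k) (c f : VIdx k) :
    (T * on12 M) (i, c) (j, f) = ∑ l, T (i, c) (l, f) * M l j := by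
  rw [Matrix.mul_apply, Fintype.sum_prod_type (α₁ := VIdx k × VIdx k) (α₂ := VIdx k)]
  simp only [on12_apply, mul_ite, mul_zero, Finset.sum_ite_eq', Finset.mem_univ, if_true]

lemma on12_mul_casimir_apply (M : End2 k) (i j : VIdx k × VIdx k) (c f : VIdx k) :
    (on12 M * (on13 (casimirOp k) + on23 (casimirOp k))) (i, c) (j, f) =
      (M * diagAct (casimirSlice k c f)) i j := by
  rw [on12_mul_apply, Matrix.mul_apply]
  simp only [casimir_block]

lemma casimir_mul_on12_apply (M : End2 k) (i j : VIdx k × VIdx k) (c f : VIdx k) :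
    ((on13 (casimirOp k) + on23 (casimirOp k)) * on12 M) (i, c) (j, f) =
      (diagAct (casimirSlice k c f) * M) i j := by
  rw [mul_on12_apply, Matrix.mul_apply]
  simp only [casimir_block]

section

variable {X : Matrix (VIdx k) (VIdx k) ℂ}

lemma cupCap_mul_diagAct (hX : X.transpose * J k + J k * X = 0) : cupCap k * diagAct X = 0 := by
  ext p q
  rw [cupCap_mul_apply, Matrix.zero_apply]
  have h := congrFun (congrFun hX q.1) q.2
  have h1 : ∑ r : VIdx k × VIdx k, J k r.1 r.2 * diagAct X r q =
      (X.transpose * J k + J k * X) q.1 q.2 := by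
    rw [Fintype.sum_prod_type (α₁ := VIdx k) (α₂ := VIdx k)]
    simp only [diagAct, Matrix.add_apply, Matrix.kroneckerMap_apply, Matrix.one_apply, mul_add,
      Finset.sum_add_distrib, mul_ite, mul_one, mul_zero, ite_mul, one_mul, zero_mul,
      Finset.sum_ite_eq', Finset.mem_univ, if_true, Matrix.mul_apply, Matrix.transpose_apply]
    rw [Finset.sum_comm]
    simp only [Finset.sum_ite_eq', Finset.mem_univ, if_true, mul_comm (X _ _)]
  rw [h1, h, Matrix.zero_apply, mul_zero]

lemma diagAct_mul_cupCap (hX : X.transpose * J k + J k * X = 0) : diagAct X * cupCap k = 0 := by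
  have h1 : X * (J k)⁻¹ + (J k)⁻¹ * X.transpose = 0 := by
    have h := congrArg (fun M => (J k)⁻¹ * M * (J k)⁻¹) hX
    have h2 := Matrix.nonsing_inv_mul (J k) isUnit_det_J
    have h3 := Matrix.mul_nonsing_inv (J k) isUnit_det_J
    simp only [mul_add, add_mul, mul_zero, zero_mul] at h
    rw [mul_assoc (J k)⁻¹, mul_assoc _ (J k), h3, ← mul_assoc (J k)⁻¹ (J k), h2, mul_one,
      one_mul] at h
    rw [add_comm, h]
  ext p q
  rw [mul_cupCap_apply, Matrix.zero_apply]
  have h := congrFun (congrFun h1 p.1) p.2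
  have h4 : ∑ r : VIdx k × VIdx k, diagAct X p r * (J k)⁻¹ r.1 r.2 =
      (X * (J k)⁻¹ + (J k)⁻¹ * X.transpose) p.1 p.2 := by
    refine (diagAct_mulVec X (fun r => (J k)⁻¹ r.1 r.2) p).trans ?_
    simp only [Matrix.add_apply, Matrix.mul_apply, Matrix.transpose_apply, mul_comm (X p.2 _)]
  rw [h4, h, Matrix.zero_apply, zero_mul]

end

/-- The zigzag $J^{-1}J=1$ contracts the shared strand; one reversal of $J^{-1}$ gives the sign. -/
lemma cupCap12_cupCap13 : on12 (cupCap k) * on13 (cupCap k) =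
    -(on12 (cupCap k) * on23 (swapOp k)) := by
  ext i j
  rw [Matrix.neg_apply, mul_on23_swapOp_apply, on12_mul_apply (c := i.2) (f := j.2) (i :=
      i.1) (j := j.1)]
  obtain ⟨⟨a, b⟩, c⟩ := i
  obtain ⟨⟨d, e⟩, f⟩ := j
  rw [Fintype.sum_prod_type (α₁ := VIdx k) (α₂ := VIdx k), on12_apply]
  simp only [on13, cupCap, mul_ite, mul_zero, Finset.sum_ite_eq', Finset.mem_univ, if_true]
  have h := congrFun (congrFun (Matrix.nonsing_inv_mul (J k) isUnit_det_J) c) e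
  simp only [Matrix.mul_apply, Matrix.one_apply] at h
  have h1 : ∀ s, (J k)⁻¹ a b * J k s e * ((J k)⁻¹ s c * J k d f) =
      -((J k)⁻¹ a b * J k d f * ((J k)⁻¹ c s * J k s e)) := fun s => by
    rw [J_inv_swap c s]
    ring
  simp only [h1, Finset.sum_neg_distrib, ← Finset.mul_sum, h]
  rw [mul_ite, mul_one, mul_zero]

lemma cupCap13_cupCap12 : on13 (cupCap k) * on12 (cupCap k) =
    -(on13 (cupCap k) * on23 (swapOp k)) := by
  ext i j
  rw [Matrix.neg_apply, mul_on23_swapOp_apply,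
    mul_on12_apply (c := i.2) (f := j.2) (i := i.1) (j := j.1)]
  obtain ⟨⟨a, b⟩, c⟩ := i
  obtain ⟨⟨d, e⟩, f⟩ := j
  rw [Fintype.sum_prod_type (α₁ := VIdx k) (α₂ := VIdx k)]
  simp only [on13, cupCap, ite_mul, zero_mul, Finset.sum_ite_eq, Finset.mem_univ, if_true]
  have h := congrFun (congrFun (Matrix.nonsing_inv_mul (J k) isUnit_det_J) b) f
  simp only [Matrix.mul_apply, Matrix.one_apply] at h
  have h1 : ∀ s, (J k)⁻¹ a c * J k s f * ((J k)⁻¹ s b * J k d e) =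
      -((J k)⁻¹ a c * J k d e * ((J k)⁻¹ b s * J k s f)) := fun s => by
    rw [J_inv_swap b s]
    ring
  simp only [h1, Finset.sum_neg_distrib, ← Finset.mul_sum, h]
  rw [mul_ite, mul_one, mul_zero]

lemma threeStrand (hk : k ≤ 3) : ThreeStrand (m k)
    (on12 (swapOp k)) (on13 (swapOp k)) (on23 (swapOp k))
    (on12 (cupCap k)) (on13 (cupCap k)) (on23 (cupCap k))
    (on12 (casimirOp k)) (on13 (casimirOp k)) (on23 (casimirOp k)) :=
  have h := twoStrand hk
  have hx : swapOp k * cupCap k = cupCap k * swapOp k := h.px.trans h.xp.symm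
  have ha : swapOp k * casimirOp k = casimirOp k * swapOp k := h.pa.trans h.ap.symm
  have hs := isDerivation_casimirSlice hk
  have hJ := fun c f => ((isInfinitesimalSymmetry_iff _).2 (hs c f)).1
  { s₁₂ := h.map (on12Hom k)
    s₁₃ := h.map (on13Hom k)
    s₂₃ := h.map (on23Hom k)
    pqr := exchanges_on12_swapOp _
    qpr := exchanges_on13_swapOp rfl
    rpq := exchanges_on23_swapOp _
    pyz := exchanges_on12_swapOp _
    qxz := exchanges_on13_swapOp hx
    rxy := exchanges_on23_swapOp _
    pbc := exchanges_on12_swapOp _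
    qac := exchanges_on13_swapOp ha
    rab := exchanges_on23_swapOp _
    xy := cupCap12_cupCap13
    yx := cupCap13_cupCap12
    xb := by
      rw [eq_neg_iff_add_eq_zero, ← mul_add]
      ext i j
      rw [on12_mul_casimir_apply (c := i.2) (f := j.2) (i := i.1) (j := j.1),
        cupCap_mul_diagAct (hJ _ _)]
      rfl
    bx := by
      rw [eq_neg_iff_add_eq_zero, ← add_mul]
      ext i j
      rw [casimir_mul_on12_apply (c := i.2) (f := j.2) (i := i.1) (j := j.1),
        diagAct_mul_cupCap (hJ _ _)]
      rfl
    comm := by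
      rw [← mul_add, ← add_mul]
      ext i j
      rw [on12_mul_casimir_apply (c := i.2) (f := j.2) (i := i.1) (j := j.1),
        casimir_mul_on12_apply (c := i.2) (f := j.2) (i := i.1) (j := j.1)]
      simp only [casimirOp, sub_mul, mul_sub, smul_mul_assoc, mul_smul_comm,
        cupCap_mul_diagAct (hJ _ _), diagAct_mul_cupCap (hJ _ _), swapOp_mul_diagAct,
        quarticOp_mul_diagAct (hs _ _)] }

/-! ### The Yang–Baxter equation -/

/-- The rescaled R-matrix composed with the flip. -/
def Rflip (k : ℕ) (u : ℂ) : End2 k :=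
  (u * (u - (m k + 1))) • 1 + (2 * m k + 4) • swapOp k
    + ((2 * m k + 4) * u / (2 * m k + 2 - u)) • cupCap k + (u / 3) • casimirOp k

lemma Rresc_eq {u : ℂ} (hu : u ≠ 2 * m k + 2) : Rresc k u = swapOp k * Rflip k u := by
  replace hu := sub_ne_zero.2 hu.symm
  have hu' : 2 * (m k + 1) - u ≠ 0 := by rwa [mul_add, mul_one]
  simp only [Rresc, Rflip, casimirOp, mul_add, mul_sub, mul_smul_comm, mul_one, swapOp_mul_swapOp,
    swapOp_mul_cupCap, swapOp_mul_quarticOp]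
  match_scalars <;> field_simp <;> ring

lemma yangBaxter_Rflip (hk : k ≤ 3) {u v : ℂ} (hu : u ≠ 2 * m k + 2) (hv : v ≠ 2 * m k + 2)
    (hw : u + v ≠ 2 * m k + 2) :
    on12 (Rflip k v) * on13 (Rflip k (u + v)) * on23 (Rflip k u) =
      on23 (Rflip k u) * on13 (Rflip k (u + v)) * on12 (Rflip k v) := by
  simp only [Rflip, on12_add, on12_smul, on12_one, on13_add, on13_smul, on13_one, on23_add,
    on23_smul, on23_one]
  exact (threeStrand hk).yang_baxter_core (sub_ne_zero.2 hu.symm) (sub_ne_zero.2 hv.symm)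
    (sub_ne_zero.2 hw.symm)

/-- Pushing all flips to the left turns the braided equation into `yangBaxter_Rflip`; the flips
collected on the two sides agree by the braid relation. -/
theorem yangBaxterAt_Rresc (hk : k ≤ 3) {u v : ℂ} (hu : u ≠ 2 * m k + 2) (hv : v ≠ 2 * m k + 2)
    (hw : u + v ≠ 2 * m k + 2) : YangBaxterAt (Rresc k) u v := by
  rw [YangBaxterAt, Rresc_eq hu, Rresc_eq hv, Rresc_eq hw]
  simp only [on12_mul, on23_mul]
  have p₂ := fun M => (exchanges_on12_swapOp (k := k) M).2
  have r₂ := fun M => (exchanges_on23_swapOp (k := k) M).2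
  have p₁ := fun M => (exchanges_on12_swapOp (k := k) M).1
  have r₁ := fun M => (exchanges_on23_swapOp (k := k) M).1
  have hy := yangBaxter_Rflip hk hu hv hw
  have hprp : on12 (swapOp k) * on23 (swapOp k) * on12 (swapOp k) =
      on23 (swapOp k) * on12 (swapOp k) * on23 (swapOp k) := by
    rw [← on13_eq, p₂, mul_assoc, on12_swapOp_mul_self, mul_one]
  calc on12 (swapOp k) * on12 (Rflip k u) * (on23 (swapOp k) * on23 (Rflip k (u + v)))
        * (on12 (swapOp k) * on12 (Rflip k v))
      = on12 (swapOp k) * (on12 (Rflip k u) * on23 (swapOp k))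
        * (on23 (Rflip k (u + v)) * on12 (swapOp k)) * on12 (Rflip k v) := by noncomm_ring
    _ = on12 (swapOp k) * on23 (swapOp k) * (on13 (Rflip k u) * on12 (swapOp k))
        * on13 (Rflip k (u + v)) * on12 (Rflip k v) := by
      rw [← r₂ (Rflip k u), ← p₁ (Rflip k (u + v))]; noncomm_ring
    _ = (on12 (swapOp k) * on23 (swapOp k) * on12 (swapOp k))
        * (on23 (Rflip k u) * on13 (Rflip k (u + v)) * on12 (Rflip k v)) := by
      rw [← p₂]; noncomm_ring
    _ = (on23 (swapOp k) * on12 (swapOp k) * on23 (swapOp k))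
        * (on12 (Rflip k v) * on13 (Rflip k (u + v)) * on23 (Rflip k u)) := by rw [hprp, hy]
    _ = on23 (swapOp k) * on12 (swapOp k) * (on13 (Rflip k v) * on23 (swapOp k))
        * on13 (Rflip k (u + v)) * on23 (Rflip k u) := by rw [← r₁]; noncomm_ring
    _ = on23 (swapOp k) * (on23 (Rflip k v) * on12 (swapOp k))
        * (on12 (Rflip k (u + v)) * on23 (swapOp k)) * on23 (Rflip k u) := by
      rw [← r₂ (Rflip k (u + v)), ← p₁ (Rflip k v)]; noncomm_ring
    _ = on23 (swapOp k) * on23 (Rflip k v) * (on12 (swapOp k) * on12 (Rflip k (u + v)))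
        * (on23 (swapOp k) * on23 (Rflip k u)) := by noncomm_ring

/-- Each side is linear in the R-matrix at each of the same three parameters, so rescaling
multiplies both by one nonzero scalar. -/
lemma YangBaxterAt.of_smul {R S : ℂ → End2 k} {u v : ℂ} (c : ℂ → ℂ)
    (h : ∀ w ∈ ({u, v, u + v} : Set ℂ), c w ≠ 0 ∧ c w • R w = S w) (hS : YangBaxterAt S u v) :
    YangBaxterAt R u v := by
  obtain ⟨hu, hu'⟩ := h u (by simp)
  obtain ⟨hv, hv'⟩ := h v (by simp)
  obtain ⟨hw, hw'⟩ := h (u + v) (by simp)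
  rw [YangBaxterAt, ← hu', ← hv', ← hw'] at hS
  simp only [on12_smul, on23_smul, smul_mul_assoc, mul_smul_comm, smul_smul] at hS
  refine smul_right_injective _ (mul_ne_zero (mul_ne_zero hu hw) hv) ?_
  convert hS using 2 <;> ring

end ESeven

end

/-! ### Assembly of the theorem. -/

theorem theorem5p8 (k : ℕ) (hk : k ≤ 3) :
    -- the data: `dim V = 6 m + 8`, the form is symplectic, the quartic tensor is symmetric
    Fintype.card (ESeven.VIdx k) = 6 * 2 ^ k + 8 ∧
    ((ESeven.J k).transpose = -ESeven.J k ∧ IsUnit (ESeven.J k).det) ∧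
    (∀ (p : Fin 4 → ESeven.VIdx k) (σ : Equiv.Perm (Fin 4)),
      ESeven.dTensor k (p ∘ σ) = ESeven.dTensor k p) ∧
    -- the `Pᵢ` are mutually orthogonal idempotents with sum `1`
    CompleteOrthogonalIdempotents (ESeven.projP k) ∧
    -- the range of `P₃` is the Lie algebra of infinitesimal symmetries, with an index lowered
    (∀ t : Matrix (ESeven.VIdx k) (ESeven.VIdx k) ℂ,
      (ESeven.projP k 2).mulVec (fun p => t p.1 p.2) = (fun p => t p.1 p.2) ↔
        ESeven.IsInfinitesimalSymmetry (t * ESeven.J k)) ∧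
    -- the spectral form and the rescaled form of the R-matrix agree up to a scalar
    (∀ u : ℂ, u ≠ 2 → u ≠ ESeven.m k + 2 → u ≠ 2 * ESeven.m k + 2 →
      ((2 - u) * (ESeven.m k + 2 - u)) • ESeven.Rspec k u = ESeven.Rresc k u) ∧
    -- the Yang–Baxter equation, for the spectral form and for the rescaled form,
    -- at all parameters that are not poles
    (∀ u v : ℂ,
      (∀ w ∈ ({u, v, u + v} : Set ℂ),
        w ≠ 2 ∧ w ≠ ESeven.m k + 2 ∧ w ≠ 2 * ESeven.m k + 2) →
      ESeven.YangBaxterAt (ESeven.Rspec k) u v) ∧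
    (∀ u v : ℂ,
      (∀ w ∈ ({u, v, u + v} : Set ℂ), w ≠ 2 * ESeven.m k + 2) →
      ESeven.YangBaxterAt (ESeven.Rresc k) u v) := by
  have hresc : ∀ u v : ℂ, (∀ w ∈ ({u, v, u + v} : Set ℂ), w ≠ 2 * ESeven.m k + 2) →
      ESeven.YangBaxterAt (ESeven.Rresc k) u v := fun u v h =>
    ESeven.yangBaxterAt_Rresc hk (h u (by simp)) (h v (by simp)) (h (u + v) (by simp))
  refine ⟨ESeven.card_VIdx, ⟨ESeven.J_transpose, ESeven.isUnit_det_J⟩, ESeven.dTensor_comp_perm,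
    ESeven.completeOrthogonalIdempotents_projP hk, ESeven.projP_two_mulVec_eq_iff hk,
    fun u => ESeven.smul_Rspec, fun u v h => ?_, hresc⟩
  -- The scalar between the two forms vanishes only at poles of the spectral form, so the rescaled
  -- solution transfers.
  refine ESeven.YangBaxterAt.of_smul (fun w => (2 - w) * (ESeven.m k + 2 - w)) (fun w hw => ?_)
    (hresc u v fun w hw => (h w hw).2.2)
  obtain ⟨h₁, h₂, h₃⟩ := h w hw
  exact ⟨mul_ne_zero (sub_ne_zero.2 h₁.symm) (sub_ne_zero.2 h₂.symm), ESeven.smul_Rspec h₁ h₂ h₃⟩
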